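/- Let $(\tilde M,\phi,\xi_\alpha,\eta^\alpha,g)$, $\alpha=1,\dots,s$ with $s\ge 1$, be an indefinite $\mathcal S$-manifold: $\tilde M$ is a smooth manifold, $g$ is a semi-Riemannian metric on it, $\phi\neq 0$ is a $(1,1)$-tensor field of constant rank, the vector fields $\xi_\alpha$ form a global frame of $\ker\phi$, and the $1$-forms $\eta^\alpha$ satisfy $$\phi^2=-I+\sum_\alpha\eta^\alpha\otimes\xi_\alpha,\qquad \eta^\alpha(\xi_\beta)=\delta^\alpha_\beta,\qquad g(\phi X,\phi Y)=g(X,Y)-\sum_\alpha\epsilon_\alpha\eta^\alpha(X)\eta^\alpha(Y),$$ where $\epsilon_\alpha=g(\xi_\alpha,\xi_\alpha)=\pm1$ according to whether $\xi_\alpha$ is spacelike or timelike; the structure is normal, i.e. $[\phi,\phi]+2\sum_\alpha d\eta^\alpha\otimes\xi_\alpha=0$; and $d\eta^\alpha(X,Y)=g(X,\phi Y)$ for every $\alpha$, where $2\,d\eta(X,Y)=X(\eta(Y))-Y(\eta(X))-\eta([X,Y])$. Put $\epsilon=\sum_\alpha\epsilon_\alpha$. Suppose that $\tilde M=\tilde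 M(c)$ is an indefinite $\mathcal S$-space form, i.e. every plane spanned by $X,\phi X$, with $X$ a non-null tangent vector in the image of $\phi$, has sectional curvature $c$, and that $c\neq\epsilon$ (for $s=1$: $c\neq 1$ if $\xi$ is spacelike and $c\neq-1$ if $\xi$ is timelike). Let $M$ be a connected (possibly only immersed) submanifold of $\tilde M$ on which $g$ restricts to a nondegenerate metric, so that $T_x\tilde M=T_xM\oplus(T_xM)^\perp$ for all $x\in M$, and suppose that all $\xi_\alpha$ are tangent to $M$. Let $\tilde\nabla$ be the Levi-Civita connection of $\tilde M$, let $\nabla_XY$ and $h(X,Y)$ be the tangential and normal parts of $\tilde\nabla_XY$, let $\nabla^\perp_XV$ be the normal part of $\tilde\nabla_XV$ for $V$ normal to $M$, and put $$(\tilde\nabla_Xh)(Y,Z)=\nabla^\perp_X(h(Y,Z))-h(\nabla_XY,Z)-h(Y,\nabla_XZ).$$ If $h$ satisfies the classical Codazzi equation $(\tilde\nabla_Xh)(Y,Z)=(\tilde\nabla_Yh)(X,Z)$ for all vector fields $X,Y,Z$ on $M$, then $M$ is $\phi$-invariant ($\phi(T_xM)\subseteq T_xM$ for all $x\in M$) or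 $\phi$-anti-invariant ($\phi(T_xM)\subseteq(T_xM)^\perp$ for all $x\in M$). -/

import Mathlib

open Bundle Manifold ContDiff VectorField

noncomputable section

set_option linter.unusedSectionVars false

namespace SGeom

section Metric

variable (E : Type*) [NormedAddCommGroup E] [NormedSpace ℝ E]
  (M : Type*) [TopologicalSpace M] [ChartedSpace E M]

/-- Vector fields on `M` (no regularity is built in). -/
abbrev VField : Type _ := (p : M) → TangentSpace 𝓘(ℝ, E) p

/-- A semi-Riemannian metric on `M`: a smooth field of nondegenerate symmetric bilinear forms of
constant index (the index is the largest dimension of a negative definite subspace). -/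
structure SemiRiemannianMetric [IsManifold 𝓘(ℝ, E) ∞ M] where
  /-- the scalar product on each tangent space -/
  inner (p : M) : TangentSpace 𝓘(ℝ, E) p →L[ℝ] TangentSpace 𝓘(ℝ, E) p →L[ℝ] ℝ
  symm (p : M) (v w : TangentSpace 𝓘(ℝ, E) p) : inner p v w = inner p w v
  nondegenerate (p : M) (v : TangentSpace 𝓘(ℝ, E) p) : (∀ w, inner p v w = 0) → v = 0
  contMDiff : ContMDiff 𝓘(ℝ, E) (𝓘(ℝ, E).prod 𝓘(ℝ, E →L[ℝ] E →L[ℝ] ℝ)) ∞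
    (fun p ↦ TotalSpace.mk' (E →L[ℝ] E →L[ℝ] ℝ)
      (E := fun p : M ↦ TangentSpace 𝓘(ℝ, E) p →L[ℝ] TangentSpace 𝓘(ℝ, E) p →L[ℝ] ℝ) p (inner p))
  constant_index : ∃ ν : ℕ, ∀ p : M, IsGreatest
    {k : ℕ | ∃ W : Submodule ℝ (TangentSpace 𝓘(ℝ, E) p),
      Module.finrank ℝ W = k ∧ ∀ v ∈ W, v ≠ 0 → inner p v v < 0} ν

end Metric

section LeviCivita

variable {E : Type*} [NormedAddCommGroup E] [NormedSpace ℝ E] [FiniteDimensional ℝ E]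
  {M : Type*} [TopologicalSpace M] [ChartedSpace E M] [IsManifold 𝓘(ℝ, E) ∞ M]

instance (p : M) : FiniteDimensional ℝ (TangentSpace 𝓘(ℝ, E) p) :=
  inferInstanceAs (FiniteDimensional ℝ E)

namespace SemiRiemannianMetric

variable (g : SemiRiemannianMetric E M)

/-- The function `⟨X, Y⟩`. -/
def pair (X Y : VField E M) : M → ℝ := fun p ↦ g.inner p (X p) (Y p)

theorem mdifferentiableAt_pair {X Y : VField E M} {p : M}
    (hX : MDiffAt (T% X) p) (hY : MDiffAt (T% Y) p) : MDiffAt (g.pair X Y) p := by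
  have hg := (g.contMDiff p).mdifferentiableAt (by simp)
  have := MDifferentiableAt.clm_bundle_apply₂ (F₁ := E) (F₂ := E) (F₃ := ℝ)
    (E₁ := (TangentSpace 𝓘(ℝ, E) : M → Type _)) (E₂ := (TangentSpace 𝓘(ℝ, E) : M → Type _))
    (E₃ := Trivial M ℝ) (b := fun x ↦ x) (ψ := g.inner) hg hX hY
  simp only [mdifferentiableAt_totalSpace] at this
  exact this.2


/-- The right-hand side of the Koszul formula for `2 ⟨∇_X Y, Z⟩`. -/
def koszul (X Y Z : VField E M) (p : M) : ℝ :=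
  mvfderiv 𝓘(ℝ, E) (g.pair Y Z) p (X p) + mvfderiv 𝓘(ℝ, E) (g.pair X Z) p (Y p)
    - mvfderiv 𝓘(ℝ, E) (g.pair X Y) p (Z p)
    + g.pair (mlieBracket 𝓘(ℝ, E) X Y) Z p - g.pair (mlieBracket 𝓘(ℝ, E) X Z) Y p
    - g.pair (mlieBracket 𝓘(ℝ, E) Y Z) X p

theorem pair_comm (X Y : VField E M) : g.pair X Y = g.pair Y X :=
  funext fun p ↦ g.symm p _ _

theorem pair_smul_left (f : M → ℝ) (X Y : VField E M) : g.pair (f • X) Y = f * g.pair X Y := by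
  funext p; simp [pair]

theorem pair_smul_right (f : M → ℝ) (X Y : VField E M) : g.pair X (f • Y) = f * g.pair X Y := by
  funext p; simp [pair]

theorem pair_add_left (X X' Y : VField E M) : g.pair (X + X') Y = g.pair X Y + g.pair X' Y := by
  funext p; simp [pair]

theorem pair_add_right (X Y Y' : VField E M) : g.pair X (Y + Y') = g.pair X Y + g.pair X Y' := by
  funext p; simp [pair]

variable {g}

theorem koszul_tensorial_left {Y Z : VField E M} {p : M} (hY : MDiffAt (T% Y) p)
    (hZ : MDiffAt (T% Z) p) : TensorialAt 𝓘(ℝ, E) E (fun X ↦ g.koszul X Y Z p) p where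
  smul {f X} hf hX := by
    have h1 := g.mdifferentiableAt_pair hX hZ
    have h2 := g.mdifferentiableAt_pair hX hY
    simp only [koszul, pair_smul_left, mvfderiv_mul hf h1, mvfderiv_mul hf h2]
    simp [pair, mlieBracket_smul_left hf hX]
    ring
  add {X X'} hX hX' := by
    simp only [koszul, pair_add_left,
      mvfderiv_add (g.mdifferentiableAt_pair hX hZ) (g.mdifferentiableAt_pair hX' hZ),
      mvfderiv_add (g.mdifferentiableAt_pair hX hY) (g.mdifferentiableAt_pair hX' hY)]
    simp [pair, mlieBracket_add_left hX hX']
    ring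

theorem koszul_tensorial_right {X Y : VField E M} {p : M} (hX : MDiffAt (T% X) p)
    (hY : MDiffAt (T% Y) p) : TensorialAt 𝓘(ℝ, E) E (fun Z ↦ g.koszul X Y Z p) p where
  smul {f Z} hf hZ := by
    have h1 := g.mdifferentiableAt_pair hX hZ
    have h2 := g.mdifferentiableAt_pair hY hZ
    have h3 := g.symm p (Y p) (Z p)
    have h4 := g.symm p (X p) (Z p)
    simp only [koszul, pair_smul_right, mvfderiv_mul hf h1, mvfderiv_mul hf h2]
    simp [pair, mlieBracket_smul_right hf hZ]
    rw [h3, h4]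
    ring
  add {Z Z'} hZ hZ' := by
    simp only [koszul, pair_add_right,
      mvfderiv_add (g.mdifferentiableAt_pair hX hZ) (g.mdifferentiableAt_pair hX hZ'),
      mvfderiv_add (g.mdifferentiableAt_pair hY hZ) (g.mdifferentiableAt_pair hY hZ')]
    simp [pair, mlieBracket_add_right hZ hZ']
    ring

theorem koszul_add_mid {X Y Y' Z : VField E M} {p : M} (hX : MDiffAt (T% X) p)
    (hY : MDiffAt (T% Y) p) (hY' : MDiffAt (T% Y') p) (hZ : MDiffAt (T% Z) p) :
    g.koszul X (Y + Y') Z p = g.koszul X Y Z p + g.koszul X Y' Z p := by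
  simp only [koszul, pair_add_right, pair_add_left,
    mvfderiv_add (g.mdifferentiableAt_pair hX hY) (g.mdifferentiableAt_pair hX hY'),
    mvfderiv_add (g.mdifferentiableAt_pair hY hZ) (g.mdifferentiableAt_pair hY' hZ)]
  simp [pair, mlieBracket_add_right hY hY', mlieBracket_add_left hY hY']
  ring

theorem koszul_smul_mid {X Y Z : VField E M} {f : M → ℝ} {p : M} (hX : MDiffAt (T% X) p)
    (hY : MDiffAt (T% Y) p) (hZ : MDiffAt (T% Z) p) (hf : MDiffAt f p) :
    g.koszul X (f • Y) Z p =
      f p * g.koszul X Y Z p + 2 * (mvfderiv 𝓘(ℝ, E) f p (X p) * g.inner p (Y p) (Z p)) := by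
  have h1 := g.mdifferentiableAt_pair hX hY
  have h2 := g.mdifferentiableAt_pair hY hZ
  have h3 := g.symm p (Y p) (X p)
  simp only [koszul, pair_smul_right, pair_smul_left, mvfderiv_mul hf h1, mvfderiv_mul hf h2]
  simp [pair, mlieBracket_smul_right hf hY, mlieBracket_smul_left hf hY]
  rw [h3]
  ring

variable (g)

/-- The scalar product at `p` as a bilinear form. -/
def bilin (p : M) : LinearMap.BilinForm ℝ (TangentSpace 𝓘(ℝ, E) p) :=
  LinearMap.mk₂ ℝ (fun v w ↦ g.inner p v w) (by simp) (by simp) (by simp) (by simp)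

theorem bilin_nondegenerate (p : M) : (g.bilin p).Nondegenerate :=
  ⟨fun v h ↦ g.nondegenerate p v h,
    fun v h ↦ g.nondegenerate p v fun w ↦ (g.symm p v w).trans (h w)⟩

/-- The musical isomorphism: the tangent vector representing a linear form. -/
def sharp (p : M) : (TangentSpace 𝓘(ℝ, E) p →L[ℝ] ℝ) →ₗ[ℝ] TangentSpace 𝓘(ℝ, E) p :=
  ((g.bilin p).toDual (g.bilin_nondegenerate p)).symm.toLinearMap ∘ₗ
    ContinuousLinearMap.coeLM ℝ

theorem inner_sharp (p : M) (l : TangentSpace 𝓘(ℝ, E) p →L[ℝ] ℝ) (w : TangentSpace 𝓘(ℝ, E) p) :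
    g.inner p (g.sharp p l) w = l w :=
  LinearMap.BilinForm.apply_toDual_symm_apply (hB := g.bilin_nondegenerate p) _ w

theorem eq_of_inner_eq {p : M} {v w : TangentSpace 𝓘(ℝ, E) p}
    (h : ∀ u, g.inner p v u = g.inner p w u) : v = w :=
  sub_eq_zero.1 (g.nondegenerate p _ fun u ↦ by simp [h u])

open Classical in
/-- The covariant derivative `v ↦ ∇_v Y` at `p`, defined by the Koszul formula
(and by `0` at the points where `Y` is not differentiable). -/
def nabla (Y : VField E M) (p : M) : TangentSpace 𝓘(ℝ, E) p →L[ℝ] TangentSpace 𝓘(ℝ, E) p :=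
  if hY : MDiffAt (T% Y) p then
    (LinearMap.toContinuousLinearMap (g.sharp p)) ∘L ((1 / 2 : ℝ) •
      TensorialAt.mkHom₂ (F := E) (F' := E) (I := 𝓘(ℝ, E)) (fun X Z ↦ g.koszul X Y Z p) p
      (fun _ hZ ↦ koszul_tensorial_left hY hZ) (fun _ hX ↦ koszul_tensorial_right hX hY))
  else 0

theorem two_inner_nabla {X Y Z : VField E M} {p : M} (hX : MDiffAt (T% X) p)
    (hY : MDiffAt (T% Y) p) (hZ : MDiffAt (T% Z) p) :
    2 * g.inner p (g.nabla Y p (X p)) (Z p) = g.koszul X Y Z p := by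
  simp only [nabla, dif_pos hY]
  simp [inner_sharp, TensorialAt.mkHom₂_apply _ _ hX hZ]

/-- The Levi-Civita connection; `g.leviCivita Y p v` is `∇_v Y` at `p`. -/
def leviCivita : CovariantDerivative 𝓘(ℝ, E) E (TangentSpace 𝓘(ℝ, E) : M → Type _) where
  toFun := g.nabla
  isCovariantDerivativeOnUniv :=
    { add := fun {Y Y' p} hY hY' _ ↦ by
        ext v
        refine g.eq_of_inner_eq fun u ↦ ?_
        have hv := FiberBundle.mdifferentiableAt_extend 𝓘(ℝ, E) E v
        have hu := FiberBundle.mdifferentiableAt_extend 𝓘(ℝ, E) E u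
        have h1 := g.two_inner_nabla hv (mdifferentiableAt_add_section hY hY') hu
        have h2 := g.two_inner_nabla hv hY hu
        have h3 := g.two_inner_nabla hv hY' hu
        rw [koszul_add_mid hv hY hY' hu] at h1
        simp only [FiberBundle.extend_apply_self] at h1 h2 h3
        simp
        linarith
      leibniz := fun {Y f p} hY hf _ ↦ by
        ext v
        refine g.eq_of_inner_eq fun u ↦ ?_
        have hv := FiberBundle.mdifferentiableAt_extend 𝓘(ℝ, E) E v
        have hu := FiberBundle.mdifferentiableAt_extend 𝓘(ℝ, E) E u
        have h1 := g.two_inner_nabla hv (hf.smul_section hY) hu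
        have h2 := g.two_inner_nabla hv hY hu
        rw [koszul_smul_mid hv hY hu hf] at h1
        simp only [FiberBundle.extend_apply_self] at h1 h2
        simp
        linear_combination (1 / 2 : ℝ) * h1 - (1 / 2 : ℝ) * f p * h2 }

/-- The Levi-Civita connection is torsion-free. -/
theorem leviCivita_torsion {X Y : VField E M} {p : M} (hX : MDiffAt (T% X) p)
    (hY : MDiffAt (T% Y) p) :
    g.leviCivita Y p (X p) - g.leviCivita X p (Y p) = mlieBracket 𝓘(ℝ, E) X Y p := by
  refine g.eq_of_inner_eq fun u ↦ ?_
  have hu := FiberBundle.mdifferentiableAt_extend 𝓘(ℝ, E) E u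
  have h1 := g.two_inner_nabla hX hY hu
  have h2 := g.two_inner_nabla hY hX hu
  rw [koszul, mlieBracket_swap] at h2
  rw [koszul] at h1
  rw [g.pair_comm Y X] at h2
  simp [pair] at h1 h2
  simp [leviCivita]
  linarith

/-- The Levi-Civita connection is compatible with the metric. -/
theorem leviCivita_metric {X Y Z : VField E M} {p : M} (hX : MDiffAt (T% X) p)
    (hY : MDiffAt (T% Y) p) (hZ : MDiffAt (T% Z) p) :
    mvfderiv 𝓘(ℝ, E) (g.pair Y Z) p (X p) =
      g.inner p (g.leviCivita Y p (X p)) (Z p) + g.inner p (Y p) (g.leviCivita Z p (X p)) := by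
  have h1 := g.two_inner_nabla hX hY hZ
  have h2 := g.two_inner_nabla hX hZ hY
  have h3 := g.symm p (Y p) (g.nabla Z p (X p))
  rw [koszul] at h1
  rw [koszul, mlieBracket_swap (V := Z), g.pair_comm Z Y] at h2
  simp [pair] at h1 h2
  simp [leviCivita]
  linarith

/-- The vector field `∇_X Y`. -/
def cov (X Y : VField E M) : VField E M := fun p ↦ g.leviCivita Y p (X p)

/-- The curvature `R(X, Y) Z = ∇_X ∇_Y Z - ∇_Y ∇_X Z - ∇_[X,Y] Z`. -/
def curvature (X Y Z : VField E M) : VField E M :=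
  g.cov X (g.cov Y Z) - g.cov Y (g.cov X Z) - g.cov (mlieBracket 𝓘(ℝ, E) X Y) Z

/-- The sectional curvature at `p` of the plane spanned by `X p` and `Y p` (for `X`, `Y` smooth and
this plane nondegenerate). -/
def sectionalCurvature (X Y : VField E M) (p : M) : ℝ :=
  g.inner p (g.curvature X Y Y p) (X p) /
    (g.inner p (X p) (X p) * g.inner p (Y p) (Y p) - g.inner p (X p) (Y p) ^ 2)

end SemiRiemannianMetric

end LeviCivita

section Structures

variable (E : Type*) [NormedAddCommGroup E] [NormedSpace ℝ E]
  (M : Type*) [TopologicalSpace M] [ChartedSpace E M]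

/-- A globally framed `f`-structure on `M`: a nonzero `(1,1)`-tensor field `φ` of constant rank with
a global frame `ξ_1, …, ξ_s` of `ker φ` and dual 1-forms `η^α`, such that
`φ² = -I + η^α ⊗ ξ_α` and `η^α(ξ_β) = δ^α_β`. (By `φ_sq`, `φ_ξ` and `η_ξ` the `ξ_α` are indeed a
basis of `ker φ` at each point.) -/
structure FramedFStructure [IsManifold 𝓘(ℝ, E) ∞ M] (s : ℕ) where
  φ (p : M) : TangentSpace 𝓘(ℝ, E) p →L[ℝ] TangentSpace 𝓘(ℝ, E) p
  ξ (α : Fin s) : VField E M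
  η (α : Fin s) (p : M) : TangentSpace 𝓘(ℝ, E) p →L[ℝ] ℝ
  contMDiff_φ : ContMDiff 𝓘(ℝ, E) (𝓘(ℝ, E).prod 𝓘(ℝ, E →L[ℝ] E)) ∞
    (fun p ↦ TotalSpace.mk' (E →L[ℝ] E)
      (E := fun p : M ↦ TangentSpace 𝓘(ℝ, E) p →L[ℝ] TangentSpace 𝓘(ℝ, E) p) p (φ p))
  contMDiff_ξ (α : Fin s) : ContMDiff 𝓘(ℝ, E) (𝓘(ℝ, E).prod 𝓘(ℝ, E)) ∞
    (fun p ↦ TotalSpace.mk' E (E := (TangentSpace 𝓘(ℝ, E) : M → Type _)) p (ξ α p))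
  contMDiff_η (α : Fin s) : ContMDiff 𝓘(ℝ, E) (𝓘(ℝ, E).prod 𝓘(ℝ, E →L[ℝ] ℝ)) ∞
    (fun p ↦ TotalSpace.mk' (E →L[ℝ] ℝ)
      (E := fun p : M ↦ TangentSpace 𝓘(ℝ, E) p →L[ℝ] ℝ) p (η α p))
  constant_rank : ∃ r : ℕ, r ≠ 0 ∧ ∀ p, Module.finrank ℝ (φ p).range = r
  φ_sq (p : M) (v : TangentSpace 𝓘(ℝ, E) p) : φ p (φ p v) = -v + ∑ α, η α p v • ξ α p
  η_ξ (p : M) (α β : Fin s) : η α p (ξ β p) = if α = β then 1 else 0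
  φ_ξ (p : M) (α : Fin s) : φ p (ξ α p) = 0

/-- An indefinite globally framed `f`-structure: a semi-Riemannian metric `g` with
`g(φX, φY) = g(X, Y) - ε_α η^α(X) η^α(Y)`, where `ε_α = 1` if `ξ_α` is spacelike and
`ε_α = -1` if `ξ_α` is timelike. -/
structure IndefiniteFramedFStructure [IsManifold 𝓘(ℝ, E) ∞ M] (s : ℕ)
    extends FramedFStructure E M s where
  g : SemiRiemannianMetric E M
  ε (α : Fin s) : ℝ
  ε_eq (α : Fin s) : ε α = 1 ∨ ε α = -1
  inner_ξ (p : M) (α : Fin s) : g.inner p (ξ α p) (ξ α p) = ε α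
  compatible (p : M) (v w : TangentSpace 𝓘(ℝ, E) p) :
    g.inner p (φ p v) (φ p w) = g.inner p v w - ∑ α, ε α * η α p v * η α p w

end Structures

section SManifolds

variable {E : Type*} [NormedAddCommGroup E] [NormedSpace ℝ E]
  {M : Type*} [TopologicalSpace M] [ChartedSpace E M]

/-- The exterior derivative of a 1-form, with the normalization
`2 dη(X, Y) = X(η(Y)) - Y(η(X)) - η([X, Y])`. -/
def extDerivOneForm (η : (p : M) → TangentSpace 𝓘(ℝ, E) p →L[ℝ] ℝ) (X Y : VField E M)
    (p : M) : ℝ :=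
  (1 / 2) * (mvfderiv 𝓘(ℝ, E) (fun q ↦ η q (Y q)) p (X p)
    - mvfderiv 𝓘(ℝ, E) (fun q ↦ η q (X q)) p (Y p) - η p (mlieBracket 𝓘(ℝ, E) X Y p))

/-- The action of a `(1,1)`-tensor field on a vector field. -/
def act (φ : (p : M) → TangentSpace 𝓘(ℝ, E) p →L[ℝ] TangentSpace 𝓘(ℝ, E) p) (X : VField E M) :
    VField E M := fun p ↦ φ p (X p)

/-- The Nijenhuis torsion `[φ, φ](X, Y) = φ²[X, Y] + [φX, φY] - φ[φX, Y] - φ[X, φY]`. -/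
def nijenhuis (φ : (p : M) → TangentSpace 𝓘(ℝ, E) p →L[ℝ] TangentSpace 𝓘(ℝ, E) p)
    (X Y : VField E M) : VField E M :=
  act φ (act φ (mlieBracket 𝓘(ℝ, E) X Y)) + mlieBracket 𝓘(ℝ, E) (act φ X) (act φ Y)
    - act φ (mlieBracket 𝓘(ℝ, E) (act φ X) Y) - act φ (mlieBracket 𝓘(ℝ, E) X (act φ Y))

variable [IsManifold 𝓘(ℝ, E) ∞ M] {s : ℕ}

/-- Normality: `[φ, φ] + 2 dη^α ⊗ ξ_α = 0`. -/
def FramedFStructure.IsNormal (S : FramedFStructure E M s) : Prop :=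
  ∀ X Y : VField E M, CMDiff ∞ (T% X) → CMDiff ∞ (T% Y) → ∀ p : M,
    nijenhuis S.φ X Y p + ∑ α, (2 * extDerivOneForm (S.η α) X Y p) • S.ξ α p = 0

namespace IndefiniteFramedFStructure

/-- Indefinite `S`-manifolds: normal, and `dη^α(X, Y) = Φ(X, Y) = g(X, φY)` for every `α`. -/
structure IsSManifold (S : IndefiniteFramedFStructure E M s) : Prop where
  normal : S.toFramedFStructure.IsNormal
  dη_eq : ∀ (α : Fin s) (X Y : VField E M), CMDiff ∞ (T% X) → CMDiff ∞ (T% Y) → ∀ p : M,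
    extDerivOneForm (S.η α) X Y p = S.g.inner p (X p) (S.φ p (Y p))

/-- Indefinite `S`-space forms: indefinite `S`-manifolds all of whose `φ`-planes, i.e. the planes
spanned by `X` and `φX` with `X` a non-null vector in the image of `φ` (the orthogonal
complement of the `ξ_α`), have sectional curvature `c`. -/
structure IsSSpaceForm [FiniteDimensional ℝ E] (S : IndefiniteFramedFStructure E M s)
    (c : ℝ) : Prop extends S.IsSManifold where
  φ_sectional : ∀ X : VField E M, CMDiff ∞ (T% X) → ∀ p : M,
    X p ∈ (S.φ p).range → S.g.inner p (X p) (X p) ≠ 0 →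
      S.g.sectionalCurvature X (act S.φ X) p = c

end IndefiniteFramedFStructure

end SManifolds

section Submanifolds

variable {E F : Type*} [NormedAddCommGroup E] [NormedSpace ℝ E]
  [NormedAddCommGroup F] [NormedSpace ℝ F]
  {N : Type*} [TopologicalSpace N] [ChartedSpace E N] [IsManifold 𝓘(ℝ, E) ∞ N]
  {M : Type*} [TopologicalSpace M] [ChartedSpace F M]

/-- `f : M → N` makes `M` a (possibly only immersed) submanifold of `N` to which the metric `g` of
`N` restricts nondegenerately, so that `T_{f x} N = T_x M ⊕ (T_x M)^⊥`. Here `T_x M` is identified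
with the image of the differential of `f` at `x`. -/
structure IsSubmanifold (g : SemiRiemannianMetric E N) (f : M → N) : Prop where
  contMDiff : ContMDiff 𝓘(ℝ, F) 𝓘(ℝ, E) ∞ f
  injective (x : M) : Function.Injective (mfderiv 𝓘(ℝ, F) 𝓘(ℝ, E) f x)
  nondegenerate (x : M) (u : TangentSpace 𝓘(ℝ, F) x) :
    (∀ v : TangentSpace 𝓘(ℝ, F) x, g.inner (f x) (mfderiv 𝓘(ℝ, F) 𝓘(ℝ, E) f x u)
      (mfderiv 𝓘(ℝ, F) 𝓘(ℝ, E) f x v) = 0) → u = 0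

/-- Vector fields along `f : M → N`, i.e. sections of `f^* TN`. -/
abbrev VFieldAlong (E : Type*) [NormedAddCommGroup E] [NormedSpace ℝ E] {N : Type*}
    [TopologicalSpace N] [ChartedSpace E N] {M : Type*} (f : M → N) : Type _ :=
  (x : M) → TangentSpace 𝓘(ℝ, E) (f x)

/-- The vector field `X` on `M`, regarded as a vector field along `f`. -/
def push (E : Type*) [NormedAddCommGroup E] [NormedSpace ℝ E] {N : Type*}
    [TopologicalSpace N] [ChartedSpace E N] (f : M → N) (X : VField F M) : VFieldAlong E f :=
  fun x ↦ mfderiv 𝓘(ℝ, F) 𝓘(ℝ, E) f x (X x)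

variable [FiniteDimensional ℝ E]

/-- The covariant derivative `∇̃_X V` of a vector field `V` along `f` (the pullback to `f^* TN` of
the Levi-Civita connection of `N`). In the coordinate frame `e_i` of `TN` around `f x`, if
`V = V^i e_i`, then `∇̃_X V = X(V^i) e_i + V^i ∇̃_{df(X)} e_i` at `x`; the field
`FiberBundle.extend E (V x)` is `∑ V^i(x) e_i`. -/
def covAlong (g : SemiRiemannianMetric E N) (f : M → N) (X : VField F M) (V : VFieldAlong E f) :
    VFieldAlong E f := fun x ↦
  let e := trivializationAt E (TangentSpace 𝓘(ℝ, E) : N → Type _) (f x)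
  e.symmL ℝ (f x) (mvfderiv 𝓘(ℝ, F) (fun y ↦ (e ⟨f y, V y⟩).2) x (X x)) +
    g.leviCivita (FiberBundle.extend E (V x)) (f x) (mfderiv 𝓘(ℝ, F) 𝓘(ℝ, E) f x (X x))

namespace IsSubmanifold

variable [FiniteDimensional ℝ F] {g : SemiRiemannianMetric E N} {f : M → N}

/-- The metric induced on `T_x M`. -/
def induced (g : SemiRiemannianMetric E N) (f : M → N) (x : M) :
    LinearMap.BilinForm ℝ (TangentSpace 𝓘(ℝ, F) x) :=
  (g.bilin (f x)).comp (mfderiv 𝓘(ℝ, F) 𝓘(ℝ, E) f x).toLinearMap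
    (mfderiv 𝓘(ℝ, F) 𝓘(ℝ, E) f x).toLinearMap

theorem induced_nondegenerate (hf : IsSubmanifold (F := F) g f) (x : M) :
    (induced (F := F) g f x).Nondegenerate :=
  ⟨fun u h ↦ hf.nondegenerate x u h,
    fun u h ↦ hf.nondegenerate x u fun v ↦ (g.symm (f x) _ _).trans (h v)⟩

/-- The tangential part of `w ∈ T_{f x} N`, as an element of `T_x M`. -/
def tan (hf : IsSubmanifold (F := F) g f) (x : M) (w : TangentSpace 𝓘(ℝ, E) (f x)) :
    TangentSpace 𝓘(ℝ, F) x :=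
  ((induced (F := F) g f x).toDual (hf.induced_nondegenerate x)).symm
    (g.bilin (f x) w ∘ₗ (mfderiv 𝓘(ℝ, F) 𝓘(ℝ, E) f x).toLinearMap)

/-- The normal part of `w ∈ T_{f x} N`. -/
def nor (hf : IsSubmanifold (F := F) g f) (x : M) (w : TangentSpace 𝓘(ℝ, E) (f x)) :
    TangentSpace 𝓘(ℝ, E) (f x) :=
  w - mfderiv 𝓘(ℝ, F) 𝓘(ℝ, E) f x (hf.tan x w)

/-- `w = tan w + nor w` with `nor w` orthogonal to `T_x M`. -/
theorem inner_nor (hf : IsSubmanifold (F := F) g f) (x : M) (w : TangentSpace 𝓘(ℝ, E) (f x))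
    (v : TangentSpace 𝓘(ℝ, F) x) :
    g.inner (f x) (hf.nor x w) (mfderiv 𝓘(ℝ, F) 𝓘(ℝ, E) f x v) = 0 := by
  have h := LinearMap.BilinForm.apply_toDual_symm_apply (hB := hf.induced_nondegenerate x)
    (g.bilin (f x) w ∘ₗ (mfderiv 𝓘(ℝ, F) 𝓘(ℝ, E) f x).toLinearMap) v
  change g.inner (f x) (mfderiv 𝓘(ℝ, F) 𝓘(ℝ, E) f x (hf.tan x w))
    (mfderiv 𝓘(ℝ, F) 𝓘(ℝ, E) f x v) = g.inner (f x) w (mfderiv 𝓘(ℝ, F) 𝓘(ℝ, E) f x v) at h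
  simp [nor, h]

/-- The induced (Levi-Civita) connection `∇_X Y = tan (∇̃_X Y)` of `M`. -/
def nabla (hf : IsSubmanifold (F := F) g f) (X Y : VField F M) : VField F M :=
  fun x ↦ hf.tan x (covAlong g f X (push E f Y) x)

/-- The second fundamental form `h(X, Y) = nor (∇̃_X Y)`. -/
def secondFF (hf : IsSubmanifold (F := F) g f) (X Y : VField F M) : VFieldAlong E f :=
  fun x ↦ hf.nor x (covAlong g f X (push E f Y) x)

/-- The normal connection `∇^⊥_X V = nor (∇̃_X V)`, for `V` a normal vector field. -/
def normalCov (hf : IsSubmanifold (F := F) g f) (X : VField F M) (V : VFieldAlong E f) :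
    VFieldAlong E f :=
  fun x ↦ hf.nor x (covAlong g f X V x)

/-- `(∇̃_X h)(Y, Z) = ∇^⊥_X (h(Y, Z)) - h(∇_X Y, Z) - h(Y, ∇_X Z)`. -/
def covSecondFF (hf : IsSubmanifold (F := F) g f) (X Y Z : VField F M) : VFieldAlong E f :=
  hf.normalCov X (hf.secondFF Y Z) - hf.secondFF (hf.nabla X Y) Z - hf.secondFF Y (hf.nabla X Z)

/-- The classical Codazzi equation `(∇̃_X h)(Y, Z) = (∇̃_Y h)(X, Z)`. -/
def SatisfiesClassicalCodazzi [IsManifold 𝓘(ℝ, F) ∞ M] (hf : IsSubmanifold (F := F) g f) :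
    Prop :=
  ∀ X Y Z : VField F M, CMDiff ∞ (T% X) → CMDiff ∞ (T% Y) → CMDiff ∞ (T% Z) →
    hf.covSecondFF X Y Z = hf.covSecondFF Y X Z

end IsSubmanifold

variable {s : ℕ}

/-- The structure vector fields `ξ_α` are tangent to `M`. -/
def TangentToFrame (F : Type*) [NormedAddCommGroup F] [NormedSpace ℝ F] {M : Type*}
    [TopologicalSpace M] [ChartedSpace F M] (S : IndefiniteFramedFStructure E N s)
    (f : M → N) : Prop :=
  ∀ (α : Fin s) (x : M), S.ξ α (f x) ∈ (mfderiv 𝓘(ℝ, F) 𝓘(ℝ, E) f x).range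

/-- `M` is `φ`-invariant: `φ(T_x M) ⊆ T_x M` for all `x`. -/
def IsPhiInvariant (F : Type*) [NormedAddCommGroup F] [NormedSpace ℝ F] {M : Type*}
    [TopologicalSpace M] [ChartedSpace F M] (S : IndefiniteFramedFStructure E N s)
    (f : M → N) : Prop :=
  ∀ (x : M) (u : TangentSpace 𝓘(ℝ, F) x),
    S.φ (f x) (mfderiv 𝓘(ℝ, F) 𝓘(ℝ, E) f x u) ∈ (mfderiv 𝓘(ℝ, F) 𝓘(ℝ, E) f x).range

/-- `M` is `φ`-anti-invariant: `φ(T_x M) ⊆ (T_x M)^⊥` for all `x`. -/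
def IsPhiAntiInvariant (F : Type*) [NormedAddCommGroup F] [NormedSpace ℝ F] {M : Type*}
    [TopologicalSpace M] [ChartedSpace F M] (S : IndefiniteFramedFStructure E N s)
    (f : M → N) : Prop :=
  ∀ (x : M) (u v : TangentSpace 𝓘(ℝ, F) x),
    S.g.inner (f x) (S.φ (f x) (mfderiv 𝓘(ℝ, F) 𝓘(ℝ, E) f x u))
      (mfderiv 𝓘(ℝ, F) 𝓘(ℝ, E) f x v) = 0

end Submanifolds

end SGeom

end

/-! For tangent X, Y, Z the normal part of R(X, Y)Z, with R the ambient curvature, is (∇̃_X h)(Y, Z)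
- (∇̃_Y h)(X, Z). The classical Codazzi equation therefore forces R(X, Y)Z to be tangent to M
(`SatisfiesClassicalCodazzi.inner_curvature`).

On the other hand, let X, Y, n be horizontal, that is, annihilated by all η^α, with n orthogonal to
X and Y. In a space form g(R(X, Y)X, n) = 3/4 (c - ε) g(X, φY) g(φX, n)
(`IsSSpaceForm.inner_curvature`). As c ≠ ε, it follows that g(φu, v) g(φu, n) = 0 for all tangent u,
v and normal n (`inner_φ_mul_inner_φ_eq_zero`). The ξ-components of u and v may be removed because
the ξ_α are tangent, and for the same reason normal vectors are horizontal. So each φu is tangent or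
normal. A vector space is not the union of two proper subspaces, hence φ(T_xM) is tangent or normal
at each x. Both alternatives are closed conditions on x. If they hold together at one point, then φ
vanishes on that tangent space, dim M = s, and φ vanishes on all of TM. Otherwise connectedness
selects one of them.

The curvature formula rests on the structure equations ∇_X ξ_α = -ε_α φX (`cov_ξ`) and (∇_X φ)Y =
g(φX, φY) ∑ ξ_α + (∑ ε_α η^α(Y)) φ²X (`covφ_eq`). They show that on horizontal vectors R fails to
commute with φ in the same way as ε times the tensor of constant curvature 1 (`R_φ`). Subtracting
that tensor and a multiple of the Kähler model leaves a Kähler-type curvature tensor with vanishing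
holomorphic sectional curvature. The components needed here then vanish by polarization and the
Bianchi identity (`SCurvature.r_eq`).

The tensor calculus is carried out once, in a module over a commutative ring with an abstract
Levi-Civita connection, and then applied to smooth vector fields. -/

noncomputable section

set_option linter.unusedSectionVars false

/-! ### Abstract Levi-Civita calculus and the symmetries of its curvature -/

namespace SGeom

/-- The algebra underlying the calculus of a Levi-Civita connection: a module `𝔛` of vector fields
over a ring `A` of functions. -/
structure LeviCivitaCalculus (A 𝔛 : Type*) [CommRing A] [AddCommGroup 𝔛] [Module A 𝔛] where
  /-- the derivative of a function along a vector field -/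
  D : 𝔛 →ₗ[A] (A →+ A)
  D_mul (X : 𝔛) (a b : A) : D X (a * b) = a * D X b + b * D X a
  /-- the covariant derivative -/
  cov : 𝔛 →ₗ[A] (𝔛 →+ 𝔛)
  cov_smul (X : 𝔛) (a : A) (Y : 𝔛) : cov X (a • Y) = a • cov X Y + D X a • Y
  /-- the metric -/
  ip : 𝔛 →ₗ[A] 𝔛 →ₗ[A] A
  ip_symm (X Y : 𝔛) : ip X Y = ip Y X
  ip_nondegenerate (X : 𝔛) : (∀ Y, ip X Y = 0) → X = 0
  D_ip (X Y Z : 𝔛) : D X (ip Y Z) = ip (cov X Y) Z + ip Y (cov X Z)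
  -- There is no independent bracket: ∇_X Y - ∇_Y X plays its role, so torsion-freeness is built in,
  -- and its action on functions and the Jacobi identity become axioms.
  D_lie (X Y : 𝔛) (a : A) : D (cov X Y - cov Y X) a = D X (D Y a) - D Y (D X a)
  jacobi (X Y Z : 𝔛) :
    cov X (cov Y Z - cov Z Y) - cov (cov Y Z - cov Z Y) X +
    (cov Y (cov Z X - cov X Z) - cov (cov Z X - cov X Z) Y) +
    (cov Z (cov X Y - cov Y X) - cov (cov X Y - cov Y X) Z) = 0
  eq_zero_of_two_mul (a : A) : 2 * a = 0 → a = 0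

namespace LeviCivitaCalculus

variable {A 𝔛 : Type*} [CommRing A] [AddCommGroup 𝔛] [Module A 𝔛] (C : LeviCivitaCalculus A 𝔛)

/-- The Lie bracket. -/
def lie (X Y : 𝔛) : 𝔛 := C.cov X Y - C.cov Y X

/-- The curvature. -/
def R (X Y Z : 𝔛) : 𝔛 := C.cov X (C.cov Y Z) - C.cov Y (C.cov X Z) - C.cov (C.lie X Y) Z

theorem eq_of_ip_eq {X Y : 𝔛} (h : ∀ Z, C.ip X Z = C.ip Y Z) : X = Y :=
  sub_eq_zero.1 <| C.ip_nondegenerate _ fun Z ↦ by simp [h Z]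

theorem R_swap (X Y Z : 𝔛) : C.R X Y Z = -C.R Y X Z := by
  simp only [R, lie, map_sub, AddMonoidHom.sub_apply]; abel

theorem R_smul_left (a : A) (X Y Z : 𝔛) : C.R (a • X) Y Z = a • C.R X Y Z := by
  simp only [R, lie, map_sub, map_smul, AddMonoidHom.sub_apply, AddMonoidHom.smul_apply,
    C.cov_smul, map_add, AddMonoidHom.add_apply]
  module

theorem R_add_left (X X' Y Z : 𝔛) : C.R (X + X') Y Z = C.R X Y Z + C.R X' Y Z := by
  simp only [R, lie, map_sub, map_add, AddMonoidHom.sub_apply, AddMonoidHom.add_apply]; abel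

/-- With torsion-freeness built into the bracket, the cyclic sum regroups into the Jacobi identity.
-/
theorem bianchi (X Y Z : 𝔛) : C.R X Y Z + C.R Y Z X + C.R Z X Y = 0 := by
  rw [← C.jacobi X Y Z]
  simp only [R, lie, map_sub, AddMonoidHom.sub_apply]; abel

/-- Differentiate the function g(Z, W) along X, Y and [X, Y]: in the commutator of second
derivatives the mixed terms ⟨∇Z, ∇W⟩ cancel and only curvature terms remain. -/
theorem ip_R_skew (X Y Z W : 𝔛) : C.ip (C.R X Y Z) W = -C.ip (C.R X Y W) Z := by
  have h := C.D_lie X Y (C.ip Z W)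
  rw [C.D_ip X, C.D_ip Y, map_add, map_add, C.D_ip, C.D_ip, C.D_ip, C.D_ip, C.D_ip] at h
  have s1 := C.ip_symm Z (C.R X Y W)
  simp only [R, lie, map_sub, LinearMap.sub_apply] at s1 h ⊢
  linear_combination -h - s1

/-- The octahedron argument: a signed sum of four Bianchi identities, reduced by the two skew
symmetries, is twice the claimed difference. -/
theorem ip_R_pair (X Y Z W : 𝔛) : C.ip (C.R X Y Z) W = C.ip (C.R Z W X) Y := by
  have b (X Y Z W : 𝔛) : C.ip (C.R X Y Z) W + C.ip (C.R Y Z X) W + C.ip (C.R Z X Y) W = 0 := by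
    rw [← LinearMap.add_apply, ← LinearMap.add_apply, ← map_add, ← map_add, C.bianchi]; simp
  have k (X Y Z W : 𝔛) : C.ip (C.R X Y Z) W = -C.ip (C.R Y X Z) W := by
    rw [C.R_swap]; simp
  have := C.eq_zero_of_two_mul (C.ip (C.R X Y Z) W - C.ip (C.R Z W X) Y) (by
    linear_combination b X Y Z W + b Y Z W X - b Z W X Y - b W X Y Z
      + C.ip_R_skew X Y Z W - C.ip_R_skew Z W X Y - C.ip_R_skew Y Z X W
      - C.ip_R_skew Z X Y W - C.ip_R_skew W Y Z X + C.ip_R_skew W X Z Y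
      + k Z X W Y + k W Y X Z)
  exact sub_eq_zero.1 this

end LeviCivitaCalculus
end SGeom

/-! ### Structure equations of an S-manifold: ∇ξ, ∇φ and the commutator of R with φ -/

namespace SGeom
namespace LeviCivitaCalculus

variable {A 𝔛 : Type*} [CommRing A] [AddCommGroup 𝔛] [Module A 𝔛]

theorem D_one (C : LeviCivitaCalculus A 𝔛) (X : 𝔛) : C.D X 1 = 0 := by
  have := C.D_mul X 1 1
  simpa using this

/-- An indefinite `S`-structure in the setting of a Levi-Civita calculus. -/
structure SStructure (C : LeviCivitaCalculus A 𝔛) (s : ℕ) where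
  φ : 𝔛 →ₗ[A] 𝔛
  ξ : Fin s → 𝔛
  η : Fin s → 𝔛 →ₗ[A] A
  ε : Fin s → A
  D_ε (X : 𝔛) (α : Fin s) : C.D X (ε α) = 0
  ε_sq (α : Fin s) : ε α * ε α = 1
  φ_sq (X : 𝔛) : φ (φ X) = -X + ∑ α, η α X • ξ α
  η_ξ (α β : Fin s) : η α (ξ β) = if α = β then 1 else 0
  φ_ξ (α : Fin s) : φ (ξ α) = 0
  compatible (X Y : 𝔛) : C.ip (φ X) (φ Y) = C.ip X Y - ∑ α, ε α * η α X * η α Y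
  dη_eq (α : Fin s) (X Y : 𝔛) :
    C.D X (η α Y) - C.D Y (η α X) - η α (C.lie X Y) = 2 * C.ip X (φ Y)
  -- The term 2dη^α(X, Y) is already replaced by 2g(X, φY), which does not depend on α.
  normal (X Y : 𝔛) : φ (φ (C.lie X Y)) + C.lie (φ X) (φ Y) - φ (C.lie (φ X) Y)
    - φ (C.lie X (φ Y)) + ∑ α, (2 * C.ip X (φ Y)) • ξ α = 0

namespace SStructure

variable {C : LeviCivitaCalculus A 𝔛} {s : ℕ} (S : C.SStructure s)

/-- The covariant derivative of `φ`. -/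
def covφ (X Y : 𝔛) : 𝔛 := C.cov X (S.φ Y) - S.φ (C.cov X Y)

/-- The sum of the structure vector fields. -/
def ξsum : 𝔛 := ∑ α, S.ξ α

/-- The 1-form dual to the sum of the structure vector fields. -/
def ηsum : 𝔛 →ₗ[A] A := ∑ α, S.ε α • S.η α

/-- The sum of the signs. -/
def εsum : A := ∑ α, S.ε α

theorem ηsum_apply (X : 𝔛) : S.ηsum X = ∑ α, S.ε α * S.η α X := by
  simp [ηsum, LinearMap.sum_apply]

/-- Computing φ³X as φ²(φX) and as φ(φ²X) gives ∑ η^α(φX) ξ_α = 0. -/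
theorem η_φ (α : Fin s) (X : 𝔛) : S.η α (S.φ X) = 0 := by
  have h1 := S.φ_sq (S.φ X)
  have h2 := congrArg S.φ (S.φ_sq X)
  rw [h1] at h2
  simp only [map_add, map_neg, map_sum, map_smul, S.φ_ξ, smul_zero, Finset.sum_const_zero,
    add_zero, add_eq_left] at h2
  have := congrArg (S.η α) h2
  simpa [map_sum, S.η_ξ] using this

theorem ip_ξ_right (α : Fin s) (X : 𝔛) : C.ip X (S.ξ α) = S.ε α * S.η α X := by
  have h := S.compatible X (S.ξ α)
  simp [S.φ_ξ, S.η_ξ] at h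
  linear_combination -h

theorem ip_ξ_left (α : Fin s) (X : 𝔛) : C.ip (S.ξ α) X = S.ε α * S.η α X := by
  rw [C.ip_symm, ip_ξ_right]

theorem η_eq (α : Fin s) (X : 𝔛) : S.η α X = S.ε α * C.ip X (S.ξ α) := by
  rw [ip_ξ_right]; linear_combination -S.η α X * S.ε_sq α

theorem ip_ξsum (X : 𝔛) : C.ip S.ξsum X = S.ηsum X := by
  simp [ξsum, ηsum_apply, LinearMap.sum_apply, map_sum, ip_ξ_left]

theorem φ_skew (X Y : 𝔛) : C.ip (S.φ X) Y = -C.ip X (S.φ Y) := by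
  have h := S.compatible X (S.φ Y)
  rw [S.φ_sq] at h
  simp [map_sum, S.η_φ, S.ip_ξ_right] at h
  linear_combination -h

theorem eq_of_φ_eq_zero {V : 𝔛} (h : S.φ V = 0) (h' : ∀ α, S.η α V = 0) : V = 0 := by
  have := S.φ_sq V
  simpa [h, h', eq_comm] using this

theorem covφ_skew (X Y Z : 𝔛) : C.ip (S.covφ X Y) Z = -C.ip (S.covφ X Z) Y := by
  have h := congrArg (C.D X) (S.φ_skew Y Z)
  rw [map_neg, C.D_ip, C.D_ip] at h
  have h1 := S.φ_skew (C.cov X Y) Z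
  have h2 := S.φ_skew Y (C.cov X Z)
  have h3 := C.ip_symm Y (C.cov X (S.φ Z))
  have h4 := C.ip_symm Y (S.φ (C.cov X Z))
  simp only [covφ, map_sub, LinearMap.sub_apply]
  linear_combination h - h1 - h2 - h3 + h4

theorem D_η (α : Fin s) (X Y : 𝔛) :
    C.D X (S.η α Y) = S.η α (C.cov X Y) + S.ε α * C.ip Y (C.cov X (S.ξ α)) := by
  rw [S.η_eq, C.D_mul, S.D_ε, C.D_ip, S.η_eq]; ring

/-- Since η^α is ε_α times the metric dual of ξ_α, the form dη^α is the skew part of ∇ξ_α. -/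
theorem two_mul_ip_φ (α : Fin s) (X Y : 𝔛) :
    2 * S.ε α * C.ip X (S.φ Y) = C.ip Y (C.cov X (S.ξ α)) - C.ip X (C.cov Y (S.ξ α)) := by
  have h := S.dη_eq α X Y
  rw [S.D_η, S.D_η, lie, map_sub] at h
  linear_combination - S.ε α * h
    + (C.ip Y (C.cov X (S.ξ α)) - C.ip X (C.cov Y (S.ξ α))) * S.ε_sq α

theorem eq_zero_of_ε_mul {α : Fin s} {a : A} (h : S.ε α * a = 0) : a = 0 := by
  linear_combination S.ε α * h - a * S.ε_sq α

/-- The fundamental form g(X, φY) equals dη^α, hence is closed. In covariant terms: differentiating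
`two_mul_ip_φ` once more expresses ∇φ through second derivatives of ξ_α, whose skew parts are
curvatures R(·,·)ξ_α, and the cyclic sum vanishes by Bianchi. One index α is required, which is
where s ≥ 1 enters. -/
theorem covφ_cyclic (α : Fin s) (X Y Z : 𝔛) :
    C.ip (S.covφ X Y) Z + C.ip (S.covφ Y Z) X + C.ip (S.covφ Z X) Y = 0 := by
  have key (X Y Z : 𝔛) : 2 * S.ε α * C.ip X (S.covφ Z Y) =
      C.ip Y (C.cov Z (C.cov X (S.ξ α)) - C.cov (C.cov Z X) (S.ξ α)) -
      C.ip X (C.cov Z (C.cov Y (S.ξ α)) - C.cov (C.cov Z Y) (S.ξ α)) := by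
    have h := congrArg (C.D Z) (S.two_mul_ip_φ α X Y)
    have h0 : C.D Z (2 : A) = 0 := by
      rw [← one_add_one_eq_two, map_add, C.D_one, add_zero]
    rw [map_sub, C.D_mul, C.D_mul, S.D_ε, h0, C.D_ip, C.D_ip, C.D_ip] at h
    have h1 := S.two_mul_ip_φ α (C.cov Z X) Y
    have h2 := S.two_mul_ip_φ α X (C.cov Z Y)
    simp only [covφ, map_sub]
    linear_combination h - h1 - h2
  have hR (X Y Z : 𝔛) : C.ip Y (C.cov Z (C.cov X (S.ξ α)) - C.cov (C.cov Z X) (S.ξ α)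
      - (C.cov X (C.cov Z (S.ξ α)) - C.cov (C.cov X Z) (S.ξ α)))
      = - C.ip (C.R Z X Y) (S.ξ α) := by
    rw [C.ip_symm, C.ip_R_skew, neg_neg]
    simp only [R, lie, map_sub, LinearMap.sub_apply, AddMonoidHom.sub_apply]
    ring
  have hB : C.ip (C.R Z X Y) (S.ξ α) + C.ip (C.R X Y Z) (S.ξ α) + C.ip (C.R Y Z X) (S.ξ α) = 0 := by
    rw [← LinearMap.add_apply, ← LinearMap.add_apply, ← map_add, ← map_add, C.bianchi]; simp
  apply S.eq_zero_of_ε_mul (α := α)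
  apply C.eq_zero_of_two_mul
  rw [C.ip_symm _ Z, C.ip_symm _ X, C.ip_symm _ Y]
  have k1 := key Z Y X
  have k2 := key X Z Y
  have k3 := key Y X Z
  have r1 := hR X Y Z
  have r2 := hR Y Z X
  have r3 := hR Z X Y
  simp only [map_sub] at k1 k2 k3 r1 r2 r3
  linear_combination k1 + k2 + k3 + hB - r1 - r2 - r3

theorem η_lie_ξ_φ (α β : Fin s) (X : 𝔛) : S.η α (C.lie (S.ξ β) (S.φ X)) = 0 := by
  have h := S.dη_eq α (S.ξ β) (S.φ X)
  have h1 : C.D (S.φ X) (S.η α (S.ξ β)) = 0 := by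
    rw [S.η_ξ]; split_ifs <;> simp [C.D_one]
  rw [S.η_φ, h1, S.ip_ξ_left, S.η_φ] at h
  simpa using h

/-- `φ` is invariant under the flows of the structure vector fields. -/
theorem lie_ξ_φ (β : Fin s) (X : 𝔛) : C.lie (S.ξ β) (S.φ X) = S.φ (C.lie (S.ξ β) X) := by
  refine sub_eq_zero.1 (S.eq_of_φ_eq_zero ?_ fun α ↦ ?_)
  -- With φξ_β = 0, normality at (ξ_β, X) reduces to φ²[ξ_β, X] = φ[ξ_β, φX].
  · have h := S.normal (S.ξ β) X
    have h0 (Z : 𝔛) : C.lie 0 Z = 0 := by simp [lie]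
    rw [S.φ_ξ, h0, h0, S.ip_ξ_left, S.η_φ] at h
    simp only [mul_zero, zero_smul, Finset.sum_const_zero, map_zero, add_zero, sub_zero] at h
    rw [map_sub, ← neg_sub, h, neg_zero]
  · rw [map_sub, S.η_lie_ξ_φ, S.η_φ, sub_zero]

theorem lie_ξ_ξ (α β : Fin s) : C.lie (S.ξ α) (S.ξ β) = 0 := by
  refine S.eq_of_φ_eq_zero ?_ fun γ ↦ ?_
  · rw [← lie_ξ_φ, S.φ_ξ]; simp [lie]
  · have h := S.dη_eq γ (S.ξ α) (S.ξ β)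
    have h1 (α β γ) : C.D (S.ξ α) (S.η γ (S.ξ β)) = 0 := by
      rw [S.η_ξ]; split_ifs <;> simp [C.D_one]
    rw [h1, h1, S.φ_ξ] at h
    simpa using h

/-- The number g(∇_X ξ_β, ξ_α) is skew in α, β because g(ξ_α, ξ_β) is constant. It equals g(X,
∇_{ξ_α} ξ_β) because dη^β(·, ξ_α) = 0, and this is symmetric in α, β because the ξ's commute. -/
theorem ip_cov_ξ_ξ (α β : Fin s) (X : 𝔛) : C.ip (C.cov X (S.ξ β)) (S.ξ α) = 0 := by
  have h1 (α β : Fin s) : C.ip (S.ξ α) (C.cov X (S.ξ β)) = C.ip X (C.cov (S.ξ α) (S.ξ β)) := by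
    have := S.two_mul_ip_φ β X (S.ξ α)
    rw [S.φ_ξ] at this
    simp at this
    linear_combination -this
  have h2 := congrArg (C.D X) (S.ip_ξ_right α (S.ξ β))
  have h3 : C.D X (S.ε α * S.η α (S.ξ β)) = 0 := by
    rw [S.η_ξ]; split_ifs <;> simp [S.D_ε]
  rw [h3, C.D_ip] at h2
  have h4 := S.lie_ξ_ξ α β
  rw [lie, sub_eq_zero] at h4
  have h5 := h1 α β
  have h6 := h1 β α
  rw [h4] at h5
  apply C.eq_zero_of_two_mul
  linear_combination h2 - h6 + h5 - C.ip_symm (S.ξ α) (C.cov X (S.ξ β))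

/-- The structure vector fields are Killing. -/
theorem killing (α : Fin s) (X Y : 𝔛) :
    C.ip (C.cov X (S.ξ α)) Y + C.ip X (C.cov Y (S.ξ α)) = 0 := by
  -- In the directions φY, the Killing equation is closedness of the fundamental form at (ξ_α, Y, X)
  -- combined with the invariance of φ under ξ_α. The ξ directions are treated in `hξ`, and Y = -φ²Y
  -- + ∑ η^β(Y) ξ_β combines both.
  have hφ (X Y : 𝔛) :
      C.ip (C.cov X (S.ξ α)) (S.φ Y) + C.ip X (C.cov (S.φ Y) (S.ξ α)) = 0 := by
    have c := S.covφ_cyclic α (S.ξ α) Y X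
    have s1 := S.covφ_skew Y X (S.ξ α)
    have e1 : S.covφ Y (S.ξ α) = - S.φ (C.cov Y (S.ξ α)) := by simp [covφ, S.φ_ξ]
    have e2 : S.covφ X (S.ξ α) = - S.φ (C.cov X (S.ξ α)) := by simp [covφ, S.φ_ξ]
    have e3 : S.covφ (S.ξ α) Y = C.cov (S.φ Y) (S.ξ α) - S.φ (C.cov Y (S.ξ α)) := by
      have h := S.lie_ξ_φ α Y
      simp only [lie, map_sub] at h
      rw [covφ, sub_eq_sub_iff_add_eq_add, sub_eq_sub_iff_add_eq_add.1 h]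
      abel
    rw [e3, s1, e1, e2] at c
    simp only [map_sub, map_neg, LinearMap.sub_apply, LinearMap.neg_apply] at c
    have f1 := S.φ_skew (C.cov X (S.ξ α)) Y
    have f2 := C.ip_symm X (C.cov (S.φ Y) (S.ξ α))
    linear_combination c + f1 + f2
  have hξ (β : Fin s) : C.ip (C.cov X (S.ξ α)) (S.ξ β) + C.ip X (C.cov (S.ξ β) (S.ξ α)) = 0 := by
    have := S.two_mul_ip_φ α X (S.ξ β)
    rw [S.φ_ξ] at this
    simp at this
    have h2 := S.ip_cov_ξ_ξ β α X
    have h3 := C.ip_symm (S.ξ β) (C.cov X (S.ξ α))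
    linear_combination this + 2 * h2 + h3
  have hY : Y = - S.φ (S.φ Y) + ∑ β, S.η β Y • S.ξ β := by rw [S.φ_sq]; abel
  rw [hY]
  simp only [map_add, map_neg, map_sum, map_smul, AddMonoidHom.add_apply, AddMonoidHom.neg_apply,
    AddMonoidHom.finsetSum_apply, AddMonoidHom.smul_apply, smul_eq_mul]
  have h := hφ X (S.φ Y)
  have h' : ∑ β, S.η β Y * C.ip (C.cov X (S.ξ α)) (S.ξ β)
      + ∑ β, S.η β Y * C.ip X (C.cov (S.ξ β) (S.ξ α)) = 0 := by
    rw [← Finset.sum_add_distrib]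
    exact Finset.sum_eq_zero fun β _ ↦ by rw [← mul_add, hξ, mul_zero]
  linear_combination -h + h'

/-- By the Killing equation ∇ξ_α is skew, so it coincides with its skew part, which dη^α identifies
with φ up to sign. -/
theorem cov_ξ (α : Fin s) (X : 𝔛) : C.cov X (S.ξ α) = -(S.ε α • S.φ X) := by
  refine C.eq_of_ip_eq fun Y ↦ sub_eq_zero.1 (C.eq_zero_of_two_mul _ ?_)
  have h := S.two_mul_ip_φ α X Y
  have k := S.killing α X Y
  have f := S.φ_skew X Y
  have g := C.ip_symm Y (C.cov X (S.ξ α))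
  simp
  linear_combination k + 2 * S.ε α * f - h - g

/-- This is the derivative of φ² = -I + ∑ η^α ⊗ ξ_α, with ∇ξ_α substituted. -/
theorem covφ_φ (X Y : 𝔛) :
    S.covφ X (S.φ Y) + S.φ (S.covφ X Y) = C.ip X (S.φ Y) • S.ξsum - S.ηsum Y • S.φ X := by
  have h : S.covφ X (S.φ Y) + S.φ (S.covφ X Y) = C.cov X (S.φ (S.φ Y)) - S.φ (S.φ (C.cov X Y)) := by
    simp [covφ]
  rw [h, S.φ_sq, S.φ_sq]
  simp only [map_add, map_neg, map_sum, C.cov_smul, S.D_η, S.cov_ξ, ξsum, ηsum_apply,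
    Finset.smul_sum, Finset.sum_smul, map_smul]
  rw [add_sub_add_comm, sub_self, zero_add, ← Finset.sum_sub_distrib, ← Finset.sum_sub_distrib]
  refine Finset.sum_congr rfl fun α _ ↦ ?_
  have h1 : S.ε α * -(S.ε α * C.ip Y (S.φ X)) = C.ip X (S.φ Y) := by
    have h2 := S.φ_skew X Y
    have h3 := C.ip_symm Y (S.φ X)
    linear_combination - C.ip Y (S.φ X) * S.ε_sq α - h2 - h3
  rw [smul_eq_mul, h1]
  module

theorem covφ_φ_ip (X Y Z : 𝔛) : C.ip (S.covφ X (S.φ Y)) Z - C.ip (S.covφ X Y) (S.φ Z) =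
    C.ip X (S.φ Y) * S.ηsum Z + S.ηsum Y * C.ip X (S.φ Z) := by
  have h := congrArg (fun V ↦ C.ip V Z) (S.covφ_φ X Y)
  simp [S.ip_ξsum] at h
  have h1 := S.φ_skew (S.covφ X Y) Z
  have h2 := S.φ_skew X Z
  linear_combination h - h1 - S.ηsum Y * h2

/-- Normality with every bracket replaced by a difference of covariant derivatives. -/
theorem nijenhuis_covφ (X Y : 𝔛) :
    S.covφ (S.φ X) Y - S.covφ (S.φ Y) X + S.φ (S.covφ Y X - S.covφ X Y)
      + (2 * C.ip X (S.φ Y)) • S.ξsum = 0 := by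
  rw [ξsum, Finset.smul_sum, ← S.normal X Y]
  simp only [covφ, lie, map_sub]
  abel

/-- The analogue of the fact that an almost Hermitian structure with closed fundamental form and
vanishing Nijenhuis tensor is Kähler. Closedness at (φX, Y, Z) and (φY, X, Z), the normality
identity, skewness of ∇φ and its anticommutation rule with φ are linear relations between the values
of ∇φ; eliminating leaves twice the claim. -/
theorem ip_covφ_φ (α : Fin s) (X Y Z : 𝔛) :
    C.ip (S.covφ Z X) (S.φ Y) = S.ηsum X * C.ip Y (S.φ Z) := by
  have N := congrArg (fun V ↦ C.ip V Z) (S.nijenhuis_covφ X Y)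
  simp [S.ip_ξsum, S.φ_skew] at N
  have k1 := S.covφ_cyclic α (S.φ X) Y Z
  have k2 := S.covφ_cyclic α (S.φ Y) X Z
  have b1 := S.covφ_φ_ip Y Z X
  have b2 := S.covφ_φ_ip Z X Y
  have b3 := S.covφ_φ_ip X Y Z
  have a1 := S.covφ_skew Z (S.φ X) Y
  have a2 := S.covφ_skew X (S.φ Y) Z
  have a3 := S.covφ_skew Y (S.φ Z) X
  have a4 := S.covφ_skew Z (S.φ Y) X
  have a5 := S.covφ_skew Y Z (S.φ X)
  have a6 := S.covφ_skew X Z (S.φ Y)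
  have a7 := S.covφ_skew Y X (S.φ Z)
  have s1 : C.ip X (S.φ Y) = - C.ip Y (S.φ X) := by rw [← S.φ_skew, C.ip_symm]
  have s2 : C.ip X (S.φ Z) = - C.ip Z (S.φ X) := by rw [← S.φ_skew, C.ip_symm]
  have s3 : C.ip Y (S.φ Z) = - C.ip Z (S.φ Y) := by rw [← S.φ_skew, C.ip_symm]
  rw [← sub_eq_zero]
  apply C.eq_zero_of_two_mul
  grind

/-- Pair with Z = -φ²Z + ∑ η^β(Z) ξ_β: `ip_covφ_φ` gives the first part, and skewness of ∇φ together
with ∇ξ_β gives the components along ξ_β. -/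
theorem covφ_eq (α : Fin s) (X Y : 𝔛) :
    S.covφ X Y = C.ip (S.φ X) (S.φ Y) • S.ξsum + S.ηsum Y • S.φ (S.φ X) := by
  refine C.eq_of_ip_eq fun Z ↦ ?_
  have hξ (β : Fin s) : C.ip (S.covφ X Y) (S.ξ β) = S.ε β * C.ip (S.φ X) (S.φ Y) := by
    rw [S.covφ_skew]
    simp [covφ, S.φ_ξ, S.cov_ξ, S.φ_skew (S.φ X)]
  have hφ := S.ip_covφ_φ α Y (S.φ Z) X
  have hZ : Z = - S.φ (S.φ Z) + ∑ β, S.η β Z • S.ξ β := by rw [S.φ_sq]; abel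
  have e : C.ip (S.covφ X Y) Z = - C.ip (S.covφ X Y) (S.φ (S.φ Z))
      + ∑ β, S.η β Z * C.ip (S.covφ X Y) (S.ξ β) := by
    conv_lhs => rw [hZ]
    simp
  have e2 : ∑ β, S.η β Z * C.ip (S.covφ X Y) (S.ξ β) = C.ip (S.φ X) (S.φ Y) * S.ηsum Z := by
    rw [ηsum_apply, Finset.mul_sum]
    exact Finset.sum_congr rfl fun β _ ↦ by rw [hξ]; ring
  rw [e, e2, hφ]
  simp [S.ip_ξsum, S.φ_skew (S.φ X), C.ip_symm (S.φ Z)]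
  ring

/-- Vector fields in the image of `φ`. -/
def horizontal : Submodule A 𝔛 where
  carrier := {X | ∀ α, S.η α X = 0}
  add_mem' hX hY α := by simp [hX α, hY α]
  zero_mem' α := by simp
  smul_mem' a X hX α := by simp [hX α]

variable {S}

theorem ηsum_of_horizontal {X : 𝔛} (hX : X ∈ S.horizontal) : S.ηsum X = 0 := by
  rw [ηsum_apply]; exact Finset.sum_eq_zero fun α _ ↦ by rw [hX α, mul_zero]

theorem φ_mem_horizontal (X : 𝔛) : S.φ X ∈ S.horizontal := fun α ↦ S.η_φ α X

theorem φ_φ_of_horizontal {X : 𝔛} (hX : X ∈ S.horizontal) : S.φ (S.φ X) = -X := by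
  rw [S.φ_sq, Finset.sum_eq_zero fun α _ ↦ by rw [hX α, zero_smul], add_zero]

theorem ip_φ_φ_of_horizontal {X : 𝔛} (hX : X ∈ S.horizontal) (Y : 𝔛) :
    C.ip (S.φ X) (S.φ Y) = C.ip X Y := by
  rw [← neg_inj, ← S.φ_skew, φ_φ_of_horizontal hX]; simp

/-- Differentiate η^α(Z) = 0; each α contributes ε_α g(Z, φY), whence the factor ε. -/
theorem ηsum_cov {Z : 𝔛} (hZ : Z ∈ S.horizontal) (Y : 𝔛) :
    S.ηsum (C.cov Y Z) = S.εsum * C.ip Z (S.φ Y) := by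
  rw [ηsum_apply, εsum, Finset.sum_mul]
  refine Finset.sum_congr rfl fun α _ ↦ ?_
  have h := S.D_η α Y Z
  rw [hZ α, map_zero, S.cov_ξ] at h
  simp at h
  linear_combination - S.ε α * h + S.ε α * C.ip Z (S.φ Y) * S.ε_sq α

theorem cov_ξsum (X : 𝔛) : C.cov X S.ξsum = -(S.εsum • S.φ X) := by
  simp [ξsum, εsum, S.cov_ξ, Finset.sum_smul]

/-- The commutator of R(X, Y) with φ is the skew second derivative of φ. After inserting ∇φ and
pairing with a horizontal W, the contributions left come from ∇(∑ ξ_α) = -εφ and from the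
ξ-components of ∇Z, and each carries the factor ε. -/
theorem R_φ (α : Fin s) {X Y Z W : 𝔛} (hX : X ∈ S.horizontal) (hY : Y ∈ S.horizontal)
    (hZ : Z ∈ S.horizontal) (hW : W ∈ S.horizontal) :
    C.ip (C.R X Y (S.φ Z)) W + C.ip (C.R X Y Z) (S.φ W) =
      - S.εsum * (C.ip Y Z * C.ip (S.φ X) W - C.ip X Z * C.ip (S.φ Y) W
        + C.ip X (S.φ Z) * C.ip Y W - C.ip Y (S.φ Z) * C.ip X W) := by
  have h1 : C.R X Y (S.φ Z) - S.φ (C.R X Y Z) = C.cov X (S.covφ Y Z) + S.covφ X (C.cov Y Z)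
      - C.cov Y (S.covφ X Z) - S.covφ Y (C.cov X Z) - S.covφ (C.lie X Y) Z := by
    simp only [R, covφ, map_sub]; abel
  have h2 := congrArg (fun V ↦ C.ip V W) h1
  simp only [S.covφ_eq α, ηsum_of_horizontal hZ, ip_φ_φ_of_horizontal hX, ip_φ_φ_of_horizontal hY,
    zero_smul, add_zero, C.cov_smul, cov_ξsum, map_sub, map_add, map_smul, map_neg,
    LinearMap.sub_apply, LinearMap.add_apply, LinearMap.smul_apply, LinearMap.neg_apply,
    S.ip_ξsum, ηsum_of_horizontal hW, smul_eq_mul, ηsum_cov hZ, φ_φ_of_horizontal hX,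
    φ_φ_of_horizontal hY, S.φ_skew (C.R X Y Z)] at h2
  have s1 : C.ip X (S.φ Z) = - C.ip Z (S.φ X) := by rw [← S.φ_skew, C.ip_symm]
  have s2 : C.ip Y (S.φ Z) = - C.ip Z (S.φ Y) := by rw [← S.φ_skew, C.ip_symm]
  rw [s1, s2]
  linear_combination h2

end SStructure
end LeviCivitaCalculus
end SGeom

/-! ### Linear algebra of curvature tensors determined by holomorphic sectional curvature -/

namespace SGeom

/-- An algebraic curvature tensor `r` over an almost Hermitian (indefinite) structure `(g, J)` whose
failure to be Kähler is that of the tensor `ε (g(Y, Z) X - g(X, Z) Y)` of constant curvature. -/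
structure SCurvature (H : Type*) [AddCommGroup H] where
  g : H → H → ℝ
  J : H → H
  r : H → H → H → H → ℝ
  ε : ℝ
  g_add (X X' Y : H) : g (X + X') Y = g X Y + g X' Y
  g_symm (X Y : H) : g X Y = g Y X
  J_add (X Y : H) : J (X + Y) = J X + J Y
  J_J (X : H) : J (J X) = -X
  g_J (X Y : H) : g (J X) Y = - g X (J Y)
  r_add (X X' Y Z W : H) : r (X + X') Y Z W = r X Y Z W + r X' Y Z W
  r_swap (X Y Z W : H) : r X Y Z W = - r Y X Z W
  r_skew (X Y Z W : H) : r X Y Z W = - r X Y W Z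
  r_pair (X Y Z W : H) : r X Y Z W = r Z W X Y
  bianchi (X Y Z W : H) : r X Y Z W + r Y Z X W + r Z X Y W = 0
  r_J (X Y Z W : H) : r X Y (J Z) W + r X Y Z (J W) =
    - ε * (g Y Z * g (J X) W - g X Z * g (J Y) W + g X (J Z) * g Y W - g Y (J Z) * g X W)

/-- Only natural numbers serve as the parameter because `SCurvature` assumes no real scalar
multiplication on H. -/
theorem coeff_zero_of_forall_large {c₀ c₁ c₂ c₃ c₄ : ℝ} {n₀ : ℕ}
    (h : ∀ n : ℕ, n₀ < n → c₀ + c₁ * n + c₂ * n ^ 2 + c₃ * n ^ 3 + c₄ * n ^ 4 = 0) : c₀ = 0 := by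
  open Polynomial in
  let P : ℝ[X] := C c₀ + C c₁ * X + C c₂ * X ^ 2 + C c₃ * X ^ 3 + C c₄ * X ^ 4
  have hP : P = 0 := by
    refine Polynomial.eq_zero_of_infinite_isRoot P
      (((Set.Ioi_infinite n₀).image Nat.cast_injective.injOn).mono ?_)
    rintro _ ⟨n, hn, rfl⟩
    simpa [P] using h n hn
  simpa [P] using congrArg (Polynomial.eval 0) hP

namespace SCurvature

variable {H : Type*} [AddCommGroup H] (S : SCurvature H)

/-- The Kähler curvature tensor of constant holomorphic sectional curvature `4`. -/
def model (X Y Z W : H) : ℝ :=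
  S.g Y Z * S.g X W - S.g X Z * S.g Y W + S.g (S.J Y) Z * S.g (S.J X) W
    - S.g (S.J X) Z * S.g (S.J Y) W - 2 * S.g (S.J X) Y * S.g (S.J Z) W

/-- The difference to the curvature tensor of a space form of `φ`-sectional curvature `c`. -/
def defect (c : ℝ) (X Y Z W : H) : ℝ :=
  S.r X Y Z W - S.ε * (S.g Y Z * S.g X W - S.g X Z * S.g Y W)
    - (c - S.ε) / 4 * S.model X Y Z W

variable (c : ℝ)

theorem g_add_right (X Y Y' : H) : S.g X (Y + Y') = S.g X Y + S.g X Y' := by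
  rw [S.g_symm, S.g_add, S.g_symm Y, S.g_symm Y']

theorem g_neg (X Y : H) : S.g (-X) Y = - S.g X Y :=
  map_neg (AddMonoidHom.mk' (fun X ↦ S.g X Y) fun _ _ ↦ S.g_add _ _ _) X

theorem g_neg_right (X Y : H) : S.g X (-Y) = - S.g X Y := by
  rw [S.g_symm, g_neg, S.g_symm]

theorem g_J_self (X : H) : S.g X (S.J X) = 0 := by
  have h1 := S.g_J X X
  have h2 := S.g_symm X (S.J X)
  linarith

theorem r_add₂ (X Y Y' Z W : H) : S.r X (Y + Y') Z W = S.r X Y Z W + S.r X Y' Z W := by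
  rw [S.r_swap, S.r_add, S.r_swap X Y, S.r_swap X Y']; ring

theorem r_add₃ (X Y Z Z' W : H) : S.r X Y (Z + Z') W = S.r X Y Z W + S.r X Y Z' W := by
  rw [S.r_pair, S.r_add, S.r_pair X Y Z, S.r_pair X Y Z']

theorem r_add₄ (X Y Z W W' : H) : S.r X Y Z (W + W') = S.r X Y Z W + S.r X Y Z W' := by
  rw [S.r_skew, r_add₃, S.r_skew X Y Z W, S.r_skew X Y Z W']; ring

theorem defect_add (X X' Y Z W : H) :
    S.defect c (X + X') Y Z W = S.defect c X Y Z W + S.defect c X' Y Z W := by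
  simp only [defect, model, S.r_add, S.g_add, S.J_add]; ring

theorem defect_swap (X Y Z W : H) : S.defect c X Y Z W = - S.defect c Y X Z W := by
  have h := S.g_symm (S.J X) Y
  rw [defect, defect, model, model, S.r_swap, S.g_J Y X, ← h]; ring

theorem defect_skew (X Y Z W : H) : S.defect c X Y Z W = - S.defect c X Y W Z := by
  have h := S.g_symm (S.J Z) W
  rw [defect, defect, model, model, S.r_skew, S.g_J W Z, ← h]; ring

theorem defect_pair (X Y Z W : H) : S.defect c X Y Z W = S.defect c Z W X Y := by
  have h1 := S.g_symm Z X
  have h2 := S.g_symm Z Y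
  have h3 := S.g_symm W X
  have h4 := S.g_symm W Y
  have h5 : S.g (S.J W) X = - S.g (S.J X) W := by rw [S.g_J, S.g_symm]
  have h6 : S.g (S.J Z) X = - S.g (S.J X) Z := by rw [S.g_J, S.g_symm]
  have h7 : S.g (S.J W) Y = - S.g (S.J Y) W := by rw [S.g_J, S.g_symm]
  have h8 : S.g (S.J Z) Y = - S.g (S.J Y) Z := by rw [S.g_J, S.g_symm]
  rw [defect, defect, model, model, S.r_pair, h1, h2, h3, h4, h5, h6, h7, h8]; ring

theorem defect_bianchi (X Y Z W : H) :
    S.defect c X Y Z W + S.defect c Y Z X W + S.defect c Z X Y W = 0 := by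
  have h := S.bianchi X Y Z W
  have h1 := S.g_symm Z X
  have h2 := S.g_symm Z Y
  have h3 := S.g_symm Y X
  have h6 : S.g (S.J Z) X = - S.g (S.J X) Z := by rw [S.g_J, S.g_symm]
  have h7 : S.g (S.J Y) X = - S.g (S.J X) Y := by rw [S.g_J, S.g_symm]
  have h8 : S.g (S.J Z) Y = - S.g (S.J Y) Z := by rw [S.g_J, S.g_symm]
  simp only [defect, model, h1, h2, h3, h6, h7, h8]; linear_combination h

/-- The right-hand side of `r_J` is exactly the contribution of the constant curvature tensor, and
the model commutes with J. So the defect has all symmetries of a Kähler curvature tensor. -/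
theorem defect_J (X Y Z W : H) : S.defect c X Y (S.J Z) W + S.defect c X Y Z (S.J W) = 0 := by
  have h := S.r_J X Y Z W
  simp only [defect, model, S.J_J, S.g_neg, S.g_neg_right, S.g_J] at h ⊢
  linear_combination h

theorem defect_neg₄ (X Y Z W : H) : S.defect c X Y Z (-W) = - S.defect c X Y Z W := by
  refine map_neg (AddMonoidHom.mk' (fun W ↦ S.defect c X Y Z W) fun W W' ↦ ?_) W
  simp only [S.defect_skew c X Y Z, S.defect_pair c X Y _ Z, S.defect_add]; ring

theorem defect_JJ (X Y Z W : H) : S.defect c X Y (S.J Z) (S.J W) = S.defect c X Y Z W := by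
  have h := S.defect_J c X Y Z (S.J W)
  rw [S.J_J, defect_neg₄] at h
  linarith

theorem defect_add₂ (X Y Y' Z W : H) :
    S.defect c X (Y + Y') Z W = S.defect c X Y Z W + S.defect c X Y' Z W := by
  rw [S.defect_swap, S.defect_add, S.defect_swap c X Y, S.defect_swap c X Y']; ring

theorem defect_add₃ (X Y Z Z' W : H) :
    S.defect c X Y (Z + Z') W = S.defect c X Y Z W + S.defect c X Y Z' W := by
  rw [S.defect_pair, S.defect_add, S.defect_pair c X Y Z, S.defect_pair c X Y Z']

theorem defect_add₄ (X Y Z W W' : H) :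
    S.defect c X Y Z (W + W') = S.defect c X Y Z W + S.defect c X Y Z W' := by
  rw [S.defect_skew, defect_add₃, S.defect_skew c X Y Z W, S.defect_skew c X Y Z W']; ring

variable {c}

/-- On a holomorphic plane the constant curvature part contributes ε and the model contributes 4 ·
(c - ε)/4, in total c. -/
theorem defect_holomorphic {X : H}
    (h : S.r X (S.J X) (S.J X) X = c * (S.g X X * S.g X X)) :
    S.defect c X (S.J X) (S.J X) X = 0 := by
  have e := S.g_J_self X
  simp only [defect, model, S.J_J, S.g_neg, S.g_J, S.g_neg_right, h, e]
  ring

/-- The classical polarization argument for Kähler tensors. The quartic form d(X, JX, JX, X) is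
expanded at X + Y and X - Y and combined with Bianchi to give d(X, Y, X, Y) = 3 d(X, JY, JY, X).
Applying this again with JY in place of Y shows that d(X, Y, X, Y) equals nine times itself. -/
theorem defect_bisectional (h : ∀ X, S.defect c X (S.J X) (S.J X) X = 0) (X Y : H) :
    S.defect c X Y X Y = 0 := by
  let q (X Y Z W : H) := S.defect c X (S.J Y) (S.J Z) W
  have q1 (X X' Y Z W : H) : q (X + X') Y Z W = q X Y Z W + q X' Y Z W := S.defect_add ..
  have q2 (X Y Y' Z W : H) : q X (Y + Y') Z W = q X Y Z W + q X Y' Z W := by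
    simp only [q, S.J_add, S.defect_add₂]
  have q3 (X Y Z Z' W : H) : q X Y (Z + Z') W = q X Y Z W + q X Y Z' W := by
    simp only [q, S.J_add, S.defect_add₃]
  have q4 (X Y Z W W' : H) : q X Y Z (W + W') = q X Y Z W + q X Y Z W' := by
    simp only [q, S.defect_add₄]
  have n1 (X Y Z W : H) : q (-X) Y Z W = - q X Y Z W :=
    map_neg (AddMonoidHom.mk' (fun X ↦ q X Y Z W) fun _ _ ↦ q1 ..) X
  have n2 (X Y Z W : H) : q X (-Y) Z W = - q X Y Z W :=
    map_neg (AddMonoidHom.mk' (fun Y ↦ q X Y Z W) fun _ _ ↦ q2 ..) Y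
  have n3 (X Y Z W : H) : q X Y (-Z) W = - q X Y Z W :=
    map_neg (AddMonoidHom.mk' (fun Z ↦ q X Y Z W) fun _ _ ↦ q3 ..) Z
  have n4 (X Y Z W : H) : q X Y Z (-W) = - q X Y Z W :=
    map_neg (AddMonoidHom.mk' (fun W ↦ q X Y Z W) fun _ _ ↦ q4 ..) W
  have hq (X : H) : q X X X X = 0 := h X
  have s34 (X Y Z W : H) : q X Y Z W = q X Y W Z := by
    have h1 := S.defect_J c X (S.J Y) Z W
    have h2 := S.defect_skew c X (S.J Y) Z (S.J W)
    simp only [q]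
    linarith
  have s12 (X Y Z W : H) : q X Y Z W = q Y X Z W := by
    have hp (X Y Z W : H) : q X Y Z W = q W Z Y X := by
      simp only [q]
      rw [S.defect_pair, S.defect_swap, S.defect_skew, neg_neg]
    rw [hp, s34, hp]
  have key (X Y : H) : S.defect c X Y X Y = 3 * S.defect c X (S.J Y) (S.J Y) X := by
    have p1 := hq (X + Y)
    have p2 := hq (X + -Y)
    simp only [q1, q2, q3, q4, n1, n2, n3, n4, hq] at p1 p2
    have hp : q Y Y X X = q X X Y Y := by
      simp only [q]
      rw [S.defect_pair, S.defect_swap, S.defect_skew, neg_neg]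
    have e1 := s12 Y X X Y
    have e2 := s12 Y X Y X
    have e3 := s34 X Y X Y
    have e4 : q X X Y Y = - 2 * q X Y Y X := by linarith
    have b := S.defect_bianchi c X (S.J X) (S.J Y) Y
    have b1 : S.defect c (S.J X) (S.J Y) X Y = S.defect c X Y X Y := by
      rw [S.defect_pair, S.defect_JJ, S.defect_pair]
    have b2 : S.defect c (S.J Y) X (S.J X) Y = - q X Y X Y := by
      rw [S.defect_swap]
    rw [b1, b2] at b
    change q X X Y Y + _ + _ = 0 at b
    change _ = 3 * q X Y Y X
    linarith
  have k1 := key X Y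
  have k2 := key X (S.J Y)
  rw [S.J_J] at k2
  have m : S.defect c X (-Y) (-Y) X = - S.defect c X Y X Y := by
    rw [S.defect_skew, defect_neg₄, S.defect_swap, S.defect_pair, S.defect_skew,
      defect_neg₄, S.defect_pair, S.defect_swap]
    ring
  have m' : S.defect c X (S.J Y) X (S.J Y) = - S.defect c X (S.J Y) (S.J Y) X := S.defect_skew ..
  rw [m, m'] at k2
  linarith

/-- Polarization in the second and fourth slots, which pair symmetry makes interchangeable here.
These components of the defect suffice for the Codazzi argument. -/
theorem defect_eq_zero (h : ∀ X, S.defect c X (S.J X) (S.J X) X = 0) (X Y W : H) :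
    S.defect c X Y X W = 0 := by
  have h1 := S.defect_bisectional h X (Y + W)
  simp only [S.defect_add₂, S.defect_add₄, S.defect_bisectional h] at h1
  rw [S.defect_pair c X W] at h1
  linarith

/-- Extends the hypothesis to null X. Along X + nY with Y non-null, both sides are quartic
polynomials in n which agree for large n, so their constant terms agree. -/
theorem r_holomorphic (h : ∀ X, S.g X X ≠ 0 → S.r X (S.J X) (S.J X) X = c * (S.g X X * S.g X X))
    {Y : H} (hY : S.g Y Y ≠ 0) (X : H) :
    S.r X (S.J X) (S.J X) X = c * (S.g X X * S.g X X) := by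
  by_cases hX : S.g X X = 0
  swap
  · exact h X hX
  let q (X Y Z W : H) := S.r X (S.J Y) (S.J Z) W
  have q1 (X X' Y Z W : H) : q (X + X') Y Z W = q X Y Z W + q X' Y Z W := S.r_add ..
  have q2 (X Y Y' Z W : H) : q X (Y + Y') Z W = q X Y Z W + q X Y' Z W := by
    simp only [q, S.J_add, S.r_add₂]
  have q3 (X Y Z Z' W : H) : q X Y (Z + Z') W = q X Y Z W + q X Y Z' W := by
    simp only [q, S.J_add, S.r_add₃]
  have q4 (X Y Z W W' : H) : q X Y Z (W + W') = q X Y Z W + q X Y Z W' := by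
    simp only [q, S.r_add₄]
  have n1 (n : ℕ) (X Y Z W : H) : q (n • X) Y Z W = n * q X Y Z W := by
    simpa using map_nsmul (AddMonoidHom.mk' (fun X ↦ q X Y Z W) fun _ _ ↦ q1 ..) n X
  have n2 (n : ℕ) (X Y Z W : H) : q X (n • Y) Z W = n * q X Y Z W := by
    simpa using map_nsmul (AddMonoidHom.mk' (fun Y ↦ q X Y Z W) fun _ _ ↦ q2 ..) n Y
  have n3 (n : ℕ) (X Y Z W : H) : q X Y (n • Z) W = n * q X Y Z W := by
    simpa using map_nsmul (AddMonoidHom.mk' (fun Z ↦ q X Y Z W) fun _ _ ↦ q3 ..) n Z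
  have n4 (n : ℕ) (X Y Z W : H) : q X Y Z (n • W) = n * q X Y Z W := by
    simpa using map_nsmul (AddMonoidHom.mk' (fun W ↦ q X Y Z W) fun _ _ ↦ q4 ..) n W
  have g1 (n : ℕ) (X Y : H) : S.g (n • X) Y = n * S.g X Y := by
    simpa using map_nsmul (AddMonoidHom.mk' (fun X ↦ S.g X Y) fun _ _ ↦ S.g_add ..) n X
  have g2 (n : ℕ) (X Y : H) : S.g X (n • Y) = n * S.g X Y := by
    rw [S.g_symm, g1, S.g_symm]
  have hg (n : ℕ) : S.g (X + n • Y) (X + n • Y) = n * (2 * S.g X Y + n * S.g Y Y) := by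
    simp only [S.g_add, S.g_add_right, g1, g2, hX, S.g_symm Y X]; ring
  -- Besides n = 0, the only zero of g(X + nY, X + nY) is n = -2g(X, Y)/g(Y, Y); beyond it X + nY is
  -- non-null.
  obtain ⟨n₀, hn₀⟩ := exists_nat_gt (-(2 * S.g X Y) / S.g Y Y)
  have hq (n : ℕ) (hn : n₀ < n) : q (X + n • Y) (X + n • Y) (X + n • Y) (X + n • Y) =
      c * (S.g (X + n • Y) (X + n • Y) * S.g (X + n • Y) (X + n • Y)) := by
    refine h _ ?_
    rw [hg]
    refine mul_ne_zero (by exact_mod_cast (Nat.zero_lt_of_lt hn).ne') fun h0 ↦ ?_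
    have : (n : ℝ) = -(2 * S.g X Y) / S.g Y Y := by field_simp; linarith
    have hn' : (n₀ : ℝ) < n := by exact_mod_cast hn
    linarith
  rw [hX, mul_zero, mul_zero]
  change q X X X X = 0
  refine coeff_zero_of_forall_large (n₀ := n₀)
    (c₁ := q Y X X X + q X Y X X + q X X Y X + q X X X Y)
    (c₂ := q Y Y X X + q Y X Y X + q Y X X Y + q X Y Y X + q X Y X Y + q X X Y Y
      - 4 * c * S.g X Y ^ 2)
    (c₃ := q Y Y Y X + q Y Y X Y + q Y X Y Y + q X Y Y Y - 4 * c * S.g X Y * S.g Y Y)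
    (c₄ := q Y Y Y Y - c * S.g Y Y ^ 2) fun n hn ↦ ?_
  have := hq n hn
  rw [hg] at this
  simp only [q1, q2, q3, q4, n1, n2, n3, n4] at this
  linear_combination this

/-- For W orthogonal to X and Y the constant curvature term drops out. Of the model, the terms +1
and +2 times g(X, JY) g(JX, W) remain, whence the coefficient 3/4. -/
theorem r_eq (h : ∀ X, S.g X X ≠ 0 → S.r X (S.J X) (S.J X) X = c * (S.g X X * S.g X X))
    {Y₀ : H} (hY₀ : S.g Y₀ Y₀ ≠ 0) {X Y W : H} (hXW : S.g X W = 0) (hYW : S.g Y W = 0) :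
    S.r X Y X W = 3 / 4 * (c - S.ε) * (S.g X (S.J Y) * S.g (S.J X) W) := by
  have := S.defect_eq_zero (fun X ↦ S.defect_holomorphic (S.r_holomorphic h hY₀ X)) X Y W
  have e := S.g_J_self X
  simp only [defect, model, S.g_J, hXW, hYW, e] at this ⊢
  rw [S.g_symm Y (S.J X), S.g_J] at this
  linear_combination this

end SCurvature

end SGeom

/-! ### Horizontal curvature at a point -/

namespace SGeom
namespace LeviCivitaCalculus.SStructure

variable {A 𝔛 : Type*} [CommRing A] [AddCommGroup 𝔛] [Module A 𝔛]
  {C : LeviCivitaCalculus A 𝔛} {s : ℕ} (S : C.SStructure s)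

/-- The curvature of the horizontal vector fields, evaluated at a point. -/
def horizontalCurvature (α : Fin s) (ev : A →+* ℝ) : SCurvature S.horizontal where
  g X Y := ev (C.ip X Y)
  J X := ⟨S.φ X, φ_mem_horizontal _⟩
  r X Y Z W := ev (C.ip (C.R X Y Z) W)
  ε := ev S.εsum
  g_add X X' Y := by simp
  g_symm X Y := by rw [C.ip_symm]
  J_add X Y := by ext; simp
  J_J X := by ext; simp [φ_φ_of_horizontal X.2]
  g_J X Y := by simp [S.φ_skew]
  r_add X X' Y Z W := by simp [C.R_add_left]
  r_swap X Y Z W := by rw [C.R_swap]; simp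
  r_skew X Y Z W := by rw [C.ip_R_skew]; simp
  r_pair X Y Z W := by rw [C.ip_R_pair]
  bianchi X Y Z W := by
    rw [← map_add, ← map_add, ← LinearMap.add_apply, ← LinearMap.add_apply, ← map_add, ← map_add,
      C.bianchi]
    simp
  r_J X Y Z W := by
    have := congrArg ev (R_φ α X.2 Y.2 Z.2 W.2)
    simpa using this

variable {S}

/-- The part of the curvature tensor of an `S`-space form which enters the Codazzi equation. -/
theorem ip_R_of_sectional (α : Fin s) (ev : A →+* ℝ) {c : ℝ}
    (h : ∀ X ∈ S.horizontal, ev (C.ip X X) ≠ 0 →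
      ev (C.ip (C.R X (S.φ X) (S.φ X)) X) = c * (ev (C.ip X X) * ev (C.ip X X)))
    {Y₀ : 𝔛} (hY₀ : Y₀ ∈ S.horizontal) (hY₀' : ev (C.ip Y₀ Y₀) ≠ 0)
    {X Y W : 𝔛} (hX : X ∈ S.horizontal) (hY : Y ∈ S.horizontal) (hW : W ∈ S.horizontal)
    (hXW : ev (C.ip X W) = 0) (hYW : ev (C.ip Y W) = 0) :
    ev (C.ip (C.R X Y X) W) =
      3 / 4 * (c - ev S.εsum) * (ev (C.ip X (S.φ Y)) * ev (C.ip (S.φ X) W)) :=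
  (S.horizontalCurvature α ev).r_eq (c := c) (fun X hX ↦ h X X.2 hX) (Y₀ := ⟨Y₀, hY₀⟩) hY₀'
    (X := ⟨X, hX⟩) (Y := ⟨Y, hY⟩) (W := ⟨W, hW⟩) hXW hYW

/-- The value of the curvature at a point depends only on the values of the vector fields there,
provided the vector fields are locally spanned by finitely many of them. -/
theorem _root_.SGeom.LeviCivitaCalculus.ev_ip_R_eq_zero (ev : A →+* ℝ) {ι : Type*} [Fintype ι]
    {χ : A} (hχ : ev χ = 1) {e : ι → 𝔛} {X : 𝔛} {θ : ι → A} (hX : χ • X = ∑ i, θ i • e i)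
    (hθ : ∀ i, ev (θ i) = 0) (Y Z W : 𝔛) : ev (C.ip (C.R X Y Z) W) = 0 := by
  have h1 : ev (C.ip (C.R (χ • X) Y Z) W) = ev (C.ip (C.R X Y Z) W) := by
    rw [C.R_smul_left]; simp [hχ]
  have h2 (t : Finset ι) : C.R (∑ i ∈ t, θ i • e i) Y Z = ∑ i ∈ t, θ i • C.R (e i) Y Z := by
    classical
    induction t using Finset.induction_on with
    | empty => simp [R, lie]
    | insert a t ha ih => rw [Finset.sum_insert ha, C.R_add_left, C.R_smul_left, ih,
        Finset.sum_insert ha]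
  rw [← h1, hX, h2]
  simp [map_sum, hθ]

end LeviCivitaCalculus.SStructure
end SGeom

/-! ### Smooth calculus: coordinate frames and the action of brackets on functions -/

namespace SGeom

open Filter Topology

section Calculus

variable {E : Type*} [NormedAddCommGroup E] [NormedSpace ℝ E]
  {M : Type*} [TopologicalSpace M] [ChartedSpace E M] [IsManifold 𝓘(ℝ, E) ∞ M]
  {F : Type*} [NormedAddCommGroup F] [NormedSpace ℝ F]
  {N : Type*} [TopologicalSpace N] [ChartedSpace F N] [IsManifold 𝓘(ℝ, F) ∞ N]

theorem contMDiffAt_mfderiv_apply {f : M → N} {X : VField E M} {p : M}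
    (hf : CMDiffAt ∞ f p) (hX : CMDiffAt ∞ (T% X) p) :
    ContMDiffAt 𝓘(ℝ, E) (𝓘(ℝ, F).prod 𝓘(ℝ, F)) ∞
      (fun q ↦ TotalSpace.mk' F (E := (TangentSpace 𝓘(ℝ, F) : N → Type _)) (f q)
        (mfderiv 𝓘(ℝ, E) 𝓘(ℝ, F) f q (X q))) p :=
  ContMDiffAt.clm_apply_of_inCoordinates (b₁ := id) (b₂ := f)
    (ϕ := fun q ↦ mfderiv 𝓘(ℝ, E) 𝓘(ℝ, F) f q) (hf.mfderiv_const (by simp)) hX hf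

theorem contMDiffAt_mvfderiv_apply {f : M → ℝ} {X : VField E M} {p : M}
    (hf : CMDiffAt ∞ f p) (hX : CMDiffAt ∞ (T% X) p) :
    CMDiffAt ∞ (fun q ↦ mvfderiv 𝓘(ℝ, E) f q (X q)) p := by
  have h := contMDiffAt_mfderiv_apply (F := ℝ) (N := ℝ) hf hX
  rw [contMDiffAt_totalSpace] at h
  refine h.2.congr_of_eventuallyEq (Eventually.of_forall fun q ↦ ?_)
  simp [mvfderiv, NormedSpace.fromTangentSpace]
  rfl

theorem minSmoothness_two_le : minSmoothness ℝ 2 ≤ ∞ := by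
  simpa using (by exact_mod_cast le_top : ((2 : ℕ∞) : WithTop ℕ∞) ≤ ∞)

theorem minSmoothness_three_le : minSmoothness ℝ 3 ≤ ∞ := by
  simpa using (by exact_mod_cast le_top : ((3 : ℕ∞) : WithTop ℕ∞) ≤ ∞)

instance isManifold_minSmoothness_two : IsManifold 𝓘(ℝ, E) (minSmoothness ℝ 2) M :=
  IsManifold.of_le (n := ∞) minSmoothness_two_le

instance isManifold_minSmoothness_three : IsManifold 𝓘(ℝ, E) (minSmoothness ℝ 3) M :=
  IsManifold.of_le (n := ∞) minSmoothness_three_le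

theorem contMDiff_mlieBracket [CompleteSpace E] {X Y : VField E M}
    (hX : CMDiff ∞ (T% X)) (hY : CMDiff ∞ (T% Y)) :
    CMDiff ∞ (T% (mlieBracket 𝓘(ℝ, E) X Y)) := by
  have : IsManifold 𝓘(ℝ, E) (((⊤ : ℕ∞) : WithTop ℕ∞) + 1) M := by
    simpa using ‹IsManifold 𝓘(ℝ, E) ∞ M›
  exact ContDiff.mlieBracket_vectorField (n := ⊤) (m := ⊤) hX hY (by simp)

end Calculus

section Frames

variable {E : Type*} [NormedAddCommGroup E] [NormedSpace ℝ E] [FiniteDimensional ℝ E]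
  {M : Type*} [TopologicalSpace M] [T2Space M] [ChartedSpace E M] [IsManifold 𝓘(ℝ, E) ∞ M]

/-- Chart coordinates and the coordinate frame, both multiplied by a bump function at p: globally
smooth, and dual to each other near p, where the bump function is 1. -/
theorem exists_coordinates (p : M) :
    ∃ (x : Fin (Module.finrank ℝ E) → M → ℝ) (e : Fin (Module.finrank ℝ E) → VField E M),
      (∀ i, CMDiff ∞ (x i)) ∧ (∀ i, CMDiff ∞ (T% (e i))) ∧
      ∀ᶠ q in 𝓝 p, (∀ i j, mvfderiv 𝓘(ℝ, E) (x i) q (e j q) = if i = j then 1 else 0) ∧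
        ∀ v : TangentSpace 𝓘(ℝ, E) q, v = ∑ i, mvfderiv 𝓘(ℝ, E) (x i) q v • e i q := by
  classical
  let b := Module.finBasis ℝ E
  let t := trivializationAt E (TangentSpace 𝓘(ℝ, E) : M → Type _) p
  obtain ⟨ρ⟩ : Nonempty (SmoothBumpFunction 𝓘(ℝ, E) p) := inferInstance
  refine ⟨fun i q ↦ ρ q • b.coord i (extChartAt 𝓘(ℝ, E) p q),
    fun i ↦ (ρ : M → ℝ) • t.localFrame b i, fun i ↦ ?_, fun i ↦ ?_, ?_⟩
  · refine ρ.contMDiff_smul (g := fun q ↦ b.coord i (extChartAt 𝓘(ℝ, E) p q)) ?_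
    exact ((LinearMap.toContinuousLinearMap (b.coord i)).contMDiff (n := ∞)).comp_contMDiffOn
      contMDiffOn_extChartAt
  · exact ContMDiffOn.smul_section_of_tsupport ρ.contMDiff.contMDiffOn t.open_baseSet
      (ρ.tsupport_subset_chartAt_source) (t.contMDiffOn_localFrame_baseSet ∞ b i)
  · have hs : (chartAt E p).source ∈ 𝓝 p := chart_source_mem_nhds E p
    -- The bump function is 1 on a whole neighbourhood of q, so the cutoff does not affect
    -- derivatives at q.
    filter_upwards [ρ.eventuallyEq_one.eventually_nhds, hs] with q hq hqs
    have hqt : q ∈ t.baseSet := hqs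
    have hx (i) (v : TangentSpace 𝓘(ℝ, E) q) :
        mvfderiv 𝓘(ℝ, E) (fun q ↦ ρ q • b.coord i (extChartAt 𝓘(ℝ, E) p q)) q v =
          b.coord i (t.continuousLinearMapAt ℝ q v) := by
      have h1 : (fun q ↦ ρ q • b.coord i (extChartAt 𝓘(ℝ, E) p q)) =ᶠ[𝓝 q]
          (LinearMap.toContinuousLinearMap (b.coord i)) ∘ extChartAt 𝓘(ℝ, E) p := by
        filter_upwards [hq] with q' hq'
        simp [hq']
      have h2 : MDiffAt (extChartAt 𝓘(ℝ, E) p) q := mdifferentiableAt_extChartAt hqs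
      have h3 : MDiffAt (LinearMap.toContinuousLinearMap (b.coord i))
          (extChartAt 𝓘(ℝ, E) p q) :=
        (LinearMap.toContinuousLinearMap (b.coord i)).mdifferentiableAt
      rw [TangentBundle.continuousLinearMapAt_trivializationAt hqs]
      simp only [mvfderiv, h1.mfderiv_eq]
      rw [mfderiv_comp q h3 h2, ContinuousLinearMap.mfderiv_eq]
      rfl
    have he (i) : ((ρ : M → ℝ) • t.localFrame b i) q = t.symmL ℝ q (b i) := by
      have : ρ q = 1 := hq.self_of_nhds
      simp [this, t.localFrame_apply_of_mem_baseSet b hqt, Trivialization.basisAt]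
      exact (t.symmL_apply hqt _).symm
    simp only [hx, he]
    refine ⟨fun i j ↦ ?_, fun v ↦ ?_⟩
    · rw [t.continuousLinearMapAt_symmL hqt]
      simp [Finsupp.single_apply, eq_comm]
    · have h := congrArg (t.symmL ℝ q) (b.sum_repr (t.continuousLinearMapAt ℝ q v))
      rw [t.symmL_continuousLinearMapAt hqt, map_sum] at h
      simpa using h.symm

theorem exists_vfield {p : M} (v : TangentSpace 𝓘(ℝ, E) p) :
    ∃ X : VField E M, CMDiff ∞ (T% X) ∧ X p = v := by
  obtain ⟨x, e, hx, he, h⟩ := exists_coordinates (E := E) p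
  refine ⟨fun q ↦ ∑ i, mvfderiv 𝓘(ℝ, E) (x i) p v • e i q, ?_, (h.self_of_nhds.2 v).symm⟩
  exact ContMDiff.sum_section fun i _ ↦ (he i).const_smul_section

/-- Apply the Jacobi identity to X, Y and fW with W nonzero at p and expand by the Leibniz rule: the
coefficient of W is the claim. -/
theorem mvfderiv_mlieBracket {f : M → ℝ} {X Y : VField E M}
    (hf : CMDiff ∞ f) (hX : CMDiff ∞ (T% X)) (hY : CMDiff ∞ (T% Y)) (p : M) :
    mvfderiv 𝓘(ℝ, E) f p (mlieBracket 𝓘(ℝ, E) X Y p) =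
      mvfderiv 𝓘(ℝ, E) (fun q ↦ mvfderiv 𝓘(ℝ, E) f q (Y q)) p (X p) -
      mvfderiv 𝓘(ℝ, E) (fun q ↦ mvfderiv 𝓘(ℝ, E) f q (X q)) p (Y p) := by
  have : CompleteSpace E := FiniteDimensional.complete ℝ E
  -- In dimension zero no nonvanishing W exists, but then both sides are trivially zero.
  rcases subsingleton_or_nontrivial E with hE | hE
  · have h0 (v : TangentSpace 𝓘(ℝ, E) p) : v = 0 := Subsingleton.elim (α := E) _ _
    rw [h0 (mlieBracket 𝓘(ℝ, E) X Y p), h0 (X p), h0 (Y p)]; simp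
  obtain ⟨v, hv⟩ := exists_ne (0 : E)
  obtain ⟨W, hW, rfl⟩ := exists_vfield (p := p) (v : TangentSpace 𝓘(ℝ, E) p)
  have dV {V : VField E M} (hV : CMDiff ∞ (T% V)) (q : M) : MDiffAt (T% V) q :=
    (hV q).mdifferentiableAt (by simp)
  have df {f : M → ℝ} (hf : CMDiff ∞ f) (q : M) : MDiffAt f q := (hf q).mdifferentiableAt (by simp)
  have sX : CMDiff ∞ (fun q ↦ mvfderiv 𝓘(ℝ, E) f q (X q)) :=
    fun q ↦ contMDiffAt_mvfderiv_apply (hf q) (hX q)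
  have sY : CMDiff ∞ (fun q ↦ mvfderiv 𝓘(ℝ, E) f q (Y q)) :=
    fun q ↦ contMDiffAt_mvfderiv_apply (hf q) (hY q)
  have J (V : VField E M) (hV : CMDiff ∞ (T% V)) :=
    leibniz_identity_mlieBracket_apply (I := 𝓘(ℝ, E)) ((hX p).of_le minSmoothness_two_le)
      ((hY p).of_le minSmoothness_two_le)
      ((hV p).of_le minSmoothness_two_le)
  have sm (V : VField E M) (hV : CMDiff ∞ (T% V)) :
      mlieBracket 𝓘(ℝ, E) V (f • W) = (fun q ↦ mvfderiv 𝓘(ℝ, E) f q (V q)) • W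
        + f • mlieBracket 𝓘(ℝ, E) V W := by
    funext q
    simp [mlieBracket_smul_right (df hf q) (dV hW q)]
  have bXW := contMDiff_mlieBracket hX hW
  have bYW := contMDiff_mlieBracket hY hW
  have bXY := contMDiff_mlieBracket hX hY
  have h1 := J (f • W) (hf.smul_section hW)
  have h2 := J W hW
  rw [sm _ bXY, sm _ hX, sm _ hY,
    mlieBracket_add_right (dV (sY.smul_section hW) p) (dV (hf.smul_section bYW) p),
    mlieBracket_add_right (dV (sX.smul_section hW) p) (dV (hf.smul_section bXW) p),
    mlieBracket_smul_right (df sY p) (dV hW p), mlieBracket_smul_right (df sX p) (dV hW p),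
    mlieBracket_smul_right (df hf p) (dV bYW p), mlieBracket_smul_right (df hf p) (dV bXW p),
    h2] at h1
  simp only [Pi.add_apply, Pi.smul_apply', smul_add] at h1
  rw [eq_sub_iff_add_eq, ← sub_eq_zero]
  refine (smul_eq_zero.1 (?_ : _ • W p = 0)).resolve_right hv
  rw [← sub_eq_zero] at h1
  rw [← neg_eq_zero, ← h1]
  module

end Frames

end SGeom

/-! ### Smoothness of fields defined by a nondegenerate pairing -/

namespace SGeom

open Filter Topology

section Cramer

variable {E : Type*} [NormedAddCommGroup E] [NormedSpace ℝ E]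
  {M : Type*} [TopologicalSpace M] [ChartedSpace E M] {ι : Type*} [Fintype ι] [DecidableEq ι]

theorem contMDiffAt_det {G : M → Matrix ι ι ℝ} {p : M}
    (hG : ∀ i j, CMDiffAt ∞ (fun q ↦ G q i j) p) : CMDiffAt ∞ (fun q ↦ (G q).det) p := by
  simp only [Matrix.det_apply']
  refine contMDiffAt_finsetSum fun σ _ ↦ ?_
  exact contMDiffAt_const.mul (contMDiffAt_finsetProd fun i _ ↦ hG _ _)

/-- By Cramer's rule the solution is a quotient of smooth determinants near p; no regularity of c is
presupposed. -/
theorem contMDiffAt_of_mulVec {G : M → Matrix ι ι ℝ} {c b : M → ι → ℝ} {p : M}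
    (hG : ∀ i j, CMDiffAt ∞ (fun q ↦ G q i j) p) (hdet : (G p).det ≠ 0)
    (hb : ∀ i, CMDiffAt ∞ (fun q ↦ b q i) p) (h : ∀ᶠ q in 𝓝 p, (G q).mulVec (c q) = b q) (i : ι) :
    CMDiffAt ∞ (fun q ↦ c q i) p := by
  have hd := contMDiffAt_det hG
  have hc : CMDiffAt ∞ (fun q ↦ ((G q).det)⁻¹ * ((G q).updateCol i (b q)).det) p := by
    refine (hd.inv₀ hdet).mul (contMDiffAt_det fun k j ↦ ?_)
    by_cases hj : j = i
    · subst hj; simpa using hb k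
    · simpa [Matrix.updateCol_ne hj] using hG k j
  refine hc.congr_of_eventuallyEq ?_
  filter_upwards [h, hd.continuousAt.eventually_ne hdet] with q hq hdq
  rw [← Matrix.cramer_apply, Matrix.cramer_eq_adjugate_mulVec, ← hq, Matrix.mulVec_mulVec,
    Matrix.adjugate_mul, Matrix.smul_mulVec, Matrix.one_mulVec]
  simp [hdq]

end Cramer

section Representation

variable {E : Type*} [NormedAddCommGroup E] [NormedSpace ℝ E] [FiniteDimensional ℝ E]
  {M : Type*} [TopologicalSpace M] [T2Space M] [ChartedSpace E M] [IsManifold 𝓘(ℝ, E) ∞ M]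

/-- A vector field is smooth if its products with smooth vector fields under a smooth field of
nondegenerate bilinear forms are smooth. -/
theorem contMDiffAt_of_bilin {B : (q : M) → LinearMap.BilinForm ℝ (TangentSpace 𝓘(ℝ, E) q)} {p : M}
    (hB : (B p).Nondegenerate)
    (hBs : ∀ Y Z : VField E M, CMDiff ∞ (T% Y) → CMDiff ∞ (T% Z) →
      CMDiffAt ∞ (fun q ↦ B q (Y q) (Z q)) p)
    {V : VField E M}
    (hV : ∀ Z : VField E M, CMDiff ∞ (T% Z) → CMDiffAt ∞ (fun q ↦ B q (V q) (Z q)) p) :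
    CMDiffAt ∞ (T% V) p := by
  obtain ⟨x, e, hx, he, h⟩ := exists_coordinates (E := E) p
  -- The Gram matrix of the frame is invertible: a kernel vector would give a combination of the
  -- frame orthogonal to everything.
  have hdet : (Matrix.of fun i j ↦ B p (e j p) (e i p)).det ≠ 0 := by
    intro h0
    obtain ⟨v, hv, hv0⟩ := Matrix.exists_mulVec_eq_zero_iff.2 h0
    obtain ⟨h1, h2⟩ := h.self_of_nhds
    have key : ∑ j, v j • e j p = 0 := by
      refine hB.1 _ fun w ↦ ?_
      rw [h2 w, map_sum]
      refine Finset.sum_eq_zero fun i _ ↦ ?_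
      have := congrFun hv0 i
      simp only [Matrix.mulVec, dotProduct, Matrix.of_apply, Pi.zero_apply] at this
      rw [map_smul, map_sum, LinearMap.sum_apply]
      simp only [map_smul, LinearMap.smul_apply, smul_eq_mul]
      rw [Finset.sum_congr rfl fun j _ ↦ mul_comm (v j) _, this, mul_zero]
    refine hv (funext fun i ↦ ?_)
    have := congrArg (mvfderiv 𝓘(ℝ, E) (x i) p) key
    simpa [map_sum, h1] using this
  have hc := contMDiffAt_of_mulVec (G := fun q ↦ Matrix.of fun i j ↦ B q (e j q) (e i q))
    (c := fun q i ↦ mvfderiv 𝓘(ℝ, E) (x i) q (V q)) (b := fun q i ↦ B q (V q) (e i q)) (p := p)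
    (fun i j ↦ hBs _ _ (he j) (he i)) hdet (fun i ↦ hV _ (he i)) (by
      filter_upwards [h] with q hq
      funext i
      conv_rhs => rw [hq.2 (V q)]
      simp [Matrix.mulVec, dotProduct, map_sum, LinearMap.sum_apply, mul_comm])
  have hs : CMDiffAt ∞ (T% fun q ↦ ∑ i, mvfderiv 𝓘(ℝ, E) (x i) q (V q) • e i q) p :=
    ContMDiffAt.sum_section fun i _ ↦ (hc i).smul_section (he i p)
  refine hs.congr_of_eventuallyEq ?_
  filter_upwards [h] with q hq
  exact congrArg (TotalSpace.mk' E q) (hq.2 (V q))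

end Representation

end SGeom

/-! ### Smooth vector fields as a Levi-Civita calculus -/

namespace SGeom

open Filter Topology

section SmoothFields

variable (E : Type*) [NormedAddCommGroup E] [NormedSpace ℝ E]
  (M : Type*) [TopologicalSpace M] [ChartedSpace E M]

/-- Smooth functions. -/
abbrev SmoothFn : Type _ := C^∞⟮𝓘(ℝ, E), M; ℝ⟯

/-- Smooth vector fields. -/
abbrev SmoothField [IsManifold 𝓘(ℝ, E) ∞ M] : Type _ :=
  Cₛ^∞⟮𝓘(ℝ, E); E, (TangentSpace 𝓘(ℝ, E) : M → Type _)⟯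

variable {E M} [IsManifold 𝓘(ℝ, E) ∞ M]

instance smoothFieldModule : Module (SmoothFn E M) (SmoothField E M) where
  smul f X := ⟨fun p ↦ f p • X p, f.contMDiff.smul_section X.contMDiff⟩
  one_smul X := by ext p; exact one_smul ℝ (X p)
  mul_smul f g X := by ext p; exact mul_smul (f p) (g p) (X p)
  smul_zero f := by ext p; exact smul_zero (f p)
  smul_add f X Y := by ext p; exact smul_add (f p) (X p) (Y p)
  add_smul f g X := by ext p; exact add_smul (f p) (g p) (X p)
  zero_smul X := by ext p; exact zero_smul ℝ (X p)

@[simp] theorem SmoothField.smul_apply (f : SmoothFn E M) (X : SmoothField E M) (p : M) :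
    (f • X) p = f p • X p := rfl

theorem SmoothField.add_apply (X Y : SmoothField E M) (p : M) : (X + Y) p = X p + Y p := rfl

theorem SmoothField.sub_apply (X Y : SmoothField E M) (p : M) : (X - Y) p = X p - Y p := rfl

theorem SmoothField.neg_apply (X : SmoothField E M) (p : M) : (-X) p = -X p := rfl

theorem SmoothField.sum_apply {ι : Type*} (t : Finset ι) (X : ι → SmoothField E M) (p : M) :
    (∑ i ∈ t, X i) p = ∑ i ∈ t, X i p := by
  classical
  induction t using Finset.induction_on with
  | empty => rfl
  | insert a t ha ih => rw [Finset.sum_insert ha, Finset.sum_insert ha, ← ih]; rfl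

theorem SmoothFn.sum_apply {ι : Type*} (t : Finset ι) (f : ι → SmoothFn E M) (p : M) :
    (∑ i ∈ t, f i) p = ∑ i ∈ t, f i p := by
  classical
  induction t using Finset.induction_on with
  | empty => rfl
  | insert a t ha ih => rw [Finset.sum_insert ha, Finset.sum_insert ha, ← ih]; rfl

theorem SmoothFn.mdifferentiableAt (f : SmoothFn E M) (p : M) : MDiffAt (fun q ↦ f q) p :=
  (f.contMDiff p).mdifferentiableAt (by simp)

theorem SmoothField.mdiffAt (X : SmoothField E M) (p : M) : MDiffAt (T% fun q ↦ X q) p :=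
  X.mdifferentiableAt

/-- Evaluation at a point. -/
def evalAt (p : M) : SmoothFn E M →+* ℝ where
  toFun f := f p
  map_one' := rfl
  map_mul' _ _ := rfl
  map_zero' := rfl
  map_add' _ _ := rfl

@[simp] theorem evalAt_apply (p : M) (f : SmoothFn E M) : evalAt p f = f p := rfl

end SmoothFields

namespace SemiRiemannianMetric

variable {E : Type*} [NormedAddCommGroup E] [NormedSpace ℝ E] [FiniteDimensional ℝ E]
  {M : Type*} [TopologicalSpace M] [ChartedSpace E M] [IsManifold 𝓘(ℝ, E) ∞ M]
  (g : SemiRiemannianMetric E M)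

theorem contMDiff_pair {X Y : VField E M} (hX : CMDiff ∞ (T% X)) (hY : CMDiff ∞ (T% Y)) :
    CMDiff ∞ (g.pair X Y) := by
  intro p
  have := ContMDiffAt.clm_bundle_apply₂ (F₁ := E) (F₂ := E) (F₃ := ℝ)
    (E₁ := (TangentSpace 𝓘(ℝ, E) : M → Type _)) (E₂ := (TangentSpace 𝓘(ℝ, E) : M → Type _))
    (E₃ := Trivial M ℝ) (b := fun x ↦ x) (ψ := g.inner) (g.contMDiff p) (hX p) (hY p)
  simp only [contMDiffAt_totalSpace] at this
  exact this.2

variable [T2Space M]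

/-- The pairing of ∇_X Y with any smooth Z is half the Koszul expression, hence smooth, and the
metric is nondegenerate. -/
theorem contMDiff_cov {X Y : VField E M} (hX : CMDiff ∞ (T% X)) (hY : CMDiff ∞ (T% Y)) :
    CMDiff ∞ (T% (g.cov X Y)) := by
  intro p
  have : CompleteSpace E := FiniteDimensional.complete ℝ E
  have hD {f : M → ℝ} {X : VField E M} (hf : CMDiff ∞ f) (hX : CMDiff ∞ (T% X)) :
      CMDiff ∞ (fun q ↦ mvfderiv 𝓘(ℝ, E) f q (X q)) :=
    fun q ↦ contMDiffAt_mvfderiv_apply (hf q) (hX q)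
  refine contMDiffAt_of_bilin (B := g.bilin) (g.bilin_nondegenerate p)
    (fun Y Z hY hZ ↦ g.contMDiff_pair hY hZ p) fun Z hZ ↦ ?_
  have hk : CMDiff ∞ (g.koszul X Y Z) :=
    (((((hD (g.contMDiff_pair hY hZ) hX).add (hD (g.contMDiff_pair hX hZ) hY)).sub
      (hD (g.contMDiff_pair hX hY) hZ)).add (g.contMDiff_pair (contMDiff_mlieBracket hX hY) hZ)).sub
      (g.contMDiff_pair (contMDiff_mlieBracket hX hZ) hY)).sub
      (g.contMDiff_pair (contMDiff_mlieBracket hY hZ) hX)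
  have := (contMDiff_const (c := (1 / 2 : ℝ))).mul hk p
  refine this.congr_of_eventuallyEq (Eventually.of_forall fun q ↦ ?_)
  have h2 := g.two_inner_nabla ((hX q).mdifferentiableAt (by simp))
    ((hY q).mdifferentiableAt (by simp)) ((hZ q).mdifferentiableAt (by simp))
  simp only [Pi.mul_apply, ← h2]
  change g.inner q (g.nabla Y q (X q)) (Z q) = _
  ring

/-- The Levi-Civita calculus of a semi-Riemannian manifold. -/
def calculus : LeviCivitaCalculus (SmoothFn E M) (SmoothField E M) where
  D :=
    { toFun := fun X ↦
        { toFun := fun f ↦ ⟨fun q ↦ mvfderiv 𝓘(ℝ, E) f q (X q),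
            fun q ↦ contMDiffAt_mvfderiv_apply (f.contMDiff q) (X.contMDiff q)⟩
          map_zero' := by
            ext q
            exact congrArg (fun l ↦ l (X q)) (mvfderiv_const (I := 𝓘(ℝ, E)) (0 : ℝ) (x := q))
          map_add' := fun f f' ↦ by
            ext q
            exact congrArg (fun l ↦ l (X q)) (mvfderiv_add (f.mdifferentiableAt q)
              (f'.mdifferentiableAt q)) }
      map_add' := fun X Y ↦ by ext f q; exact map_add (mvfderiv 𝓘(ℝ, E) f q) (X q) (Y q)
      map_smul' := fun f X ↦ by ext f' q; exact map_smul (mvfderiv 𝓘(ℝ, E) f' q) (f q) (X q) }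
  D_mul X f f' := by
    ext q
    exact (congrArg (fun l ↦ l (X q)) (mvfderiv_mul (f.mdifferentiableAt q)
      (f'.mdifferentiableAt q))).trans (by simp; rfl)
  cov :=
    { toFun := fun X ↦
        { toFun := fun Y ↦ ⟨g.cov X Y, g.contMDiff_cov X.contMDiff Y.contMDiff⟩
          map_zero' := by
            ext q
            exact congrArg (fun l ↦ l q (X q)) g.leviCivita.zero
          map_add' := fun Y Y' ↦ by
            ext q
            exact congrArg (fun l ↦ l (X q))
              (g.leviCivita.isCovariantDerivativeOnUniv.add (Y.mdiffAt q) (Y'.mdiffAt q)) }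
      map_add' := fun X X' ↦ by ext Y q; exact map_add (g.leviCivita Y q) (X q) (X' q)
      map_smul' := fun f X ↦ by ext Y q; exact map_smul (g.leviCivita Y q) (f q) (X q) }
  cov_smul X f Y := by
    ext q
    exact (congrArg (fun l ↦ l (X q)) (g.leviCivita.isCovariantDerivativeOnUniv.leibniz
      (Y.mdiffAt q) (f.mdifferentiableAt q))).trans (by simp; rfl)
  ip :=
    { toFun := fun X ↦
        { toFun := fun Y ↦ ⟨g.pair X Y, g.contMDiff_pair X.contMDiff Y.contMDiff⟩
          map_add' := fun Y Y' ↦ by ext q; exact map_add (g.inner q (X q)) (Y q) (Y' q)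
          map_smul' := fun f Y ↦ by ext q; exact map_smul (g.inner q (X q)) (f q) (Y q) }
      map_add' := fun X X' ↦ by
        ext Y q; exact congrArg (fun l ↦ l (Y q)) (map_add (g.inner q) (X q) (X' q))
      map_smul' := fun f X ↦ by
        ext Y q; exact congrArg (fun l ↦ l (Y q)) (map_smul (g.inner q) (f q) (X q)) }
  ip_symm X Y := by ext q; exact g.symm q _ _
  ip_nondegenerate X h := by
    ext q
    refine g.nondegenerate q _ fun w ↦ ?_
    obtain ⟨Y, hY, rfl⟩ := exists_vfield w
    exact congrArg (fun f : SmoothFn E M ↦ f q) (h ⟨Y, hY⟩)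
  D_ip X Y Z := by
    ext q
    exact g.leviCivita_metric (X.mdiffAt q) (Y.mdiffAt q) (Z.mdiffAt q)
  D_lie X Y f := by
    ext q
    have h := mvfderiv_mlieBracket f.contMDiff X.contMDiff Y.contMDiff q
    rw [← g.leviCivita_torsion (X.mdiffAt q) (Y.mdiffAt q)] at h
    exact h
  jacobi X Y Z := by
    have : CompleteSpace E := FiniteDimensional.complete ℝ E
    ext q
    have t (X Y : SmoothField E M) : g.cov X Y - g.cov Y X = mlieBracket 𝓘(ℝ, E) X Y :=
      funext fun q ↦ g.leviCivita_torsion (X.mdiffAt q) (Y.mdiffAt q)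
    have t2 (X Y Z : SmoothField E M) :
        g.cov X (g.cov Y Z - g.cov Z Y) q - g.cov (g.cov Y Z - g.cov Z Y) X q =
          mlieBracket 𝓘(ℝ, E) X (mlieBracket 𝓘(ℝ, E) Y Z) q := by
      rw [t]
      exact g.leviCivita_torsion (X.mdiffAt q)
        ((contMDiff_mlieBracket Y.contMDiff Z.contMDiff q).mdifferentiableAt (by simp))
    have J := leibniz_identity_mlieBracket_apply (I := 𝓘(ℝ, E)) (U := X) (V := Y) (W := Z)
      ((X.contMDiff q).of_le minSmoothness_two_le) ((Y.contMDiff q).of_le minSmoothness_two_le)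
      ((Z.contMDiff q).of_le minSmoothness_two_le)
    change (g.cov X (g.cov Y Z - g.cov Z Y) q - g.cov (g.cov Y Z - g.cov Z Y) X q) +
      (g.cov Y (g.cov Z X - g.cov X Z) q - g.cov (g.cov Z X - g.cov X Z) Y q) +
      (g.cov Z (g.cov X Y - g.cov Y X) q - g.cov (g.cov X Y - g.cov Y X) Z q) = 0
    have e : mlieBracket 𝓘(ℝ, E) Y (mlieBracket 𝓘(ℝ, E) Z X) q =
        -mlieBracket 𝓘(ℝ, E) Y (mlieBracket 𝓘(ℝ, E) X Z) q := by
      have h := mlieBracket_const_smul_right (c := (-1 : ℝ)) (V := (Y : VField E M))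
        (((contMDiff_mlieBracket X.contMDiff Z.contMDiff q).mdifferentiableAt (by simp)))
      rw [mlieBracket_swap (V := (Z : VField E M))]
      simpa using h
    rw [t2, t2, t2, J, e, mlieBracket_swap_apply (V := (Z : VField E M))]
    abel
  eq_zero_of_two_mul f h := by
    ext q
    have : (2 : SmoothFn E M) q * f q = 0 := congrArg (fun f : SmoothFn E M ↦ f q) h
    exact (mul_eq_zero.1 this).resolve_left (by
      rw [← one_add_one_eq_two]; change (1 : ℝ) + 1 ≠ 0; norm_num)

end SemiRiemannianMetric

end SGeom

/-! ### Curvature of an S-space form at a point -/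

namespace SGeom

open Filter Topology

variable {E : Type*} [NormedAddCommGroup E] [NormedSpace ℝ E] [FiniteDimensional ℝ E]
  {M : Type*} [TopologicalSpace M] [T2Space M] [ChartedSpace E M] [IsManifold 𝓘(ℝ, E) ∞ M]

namespace SemiRiemannianMetric

variable (g : SemiRiemannianMetric E M)

theorem calculus_lie_apply (X Y : SmoothField E M) (q : M) :
    g.calculus.lie X Y q = mlieBracket 𝓘(ℝ, E) X Y q :=
  g.leviCivita_torsion (X.mdiffAt q) (Y.mdiffAt q)

theorem calculus_R_apply (X Y Z : SmoothField E M) (q : M) :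
    g.calculus.R X Y Z q = g.curvature X Y Z q := by
  have h : g.calculus.lie X Y q = mlieBracket 𝓘(ℝ, E) X Y q := g.calculus_lie_apply X Y q
  change g.cov X (g.cov Y Z) q - g.cov Y (g.cov X Z) q - g.leviCivita Z q (g.calculus.lie X Y q) = _
  rw [h]; rfl

/-- Dependence on point values alone is proved for the first slot; the symmetries of R carry it to
the second and third. -/
theorem calculus_ip_R_congr {X X' Y Y' Z Z' W W' : SmoothField E M} {p : M} (hX : X p = X' p)
    (hY : Y p = Y' p) (hZ : Z p = Z' p) (hW : W p = W' p) :
    evalAt p (g.calculus.ip (g.calculus.R X Y Z) W) =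
      evalAt p (g.calculus.ip (g.calculus.R X' Y' Z') W') := by
  have h1 {X X' : SmoothField E M} (h : X p = X' p) (Y Z W : SmoothField E M) :
      evalAt p (g.calculus.ip (g.calculus.R X Y Z) W) =
        evalAt p (g.calculus.ip (g.calculus.R X' Y Z) W) := by
    obtain ⟨x, e, hx, he, hf⟩ := exists_coordinates (E := E) p
    obtain ⟨χ, hχ⟩ := (SmoothBumpFunction.nhds_basis_support (I := 𝓘(ℝ, E)) hf).ex_mem
    obtain ⟨V, hV⟩ : ∃ V, V = X - X' := ⟨_, rfl⟩
    have hVp : V p = 0 := by rw [hV, SmoothField.sub_apply, h, sub_self]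
    let x' (i) : SmoothFn E M := ⟨x i, hx i⟩
    let e' (i) : SmoothField E M := ⟨e i, he i⟩
    let χ' : SmoothFn E M := ⟨χ, χ.contMDiff⟩
    -- Multiplying by the bump function turns the local expansion of V into the global identity χV =
    -- ∑ χ dx_i(V) e_i, whose coefficients vanish at p.
    have h0 := LeviCivitaCalculus.ev_ip_R_eq_zero (C := g.calculus) (evalAt p) (χ := χ') χ.eq_one
      (e := e') (X := V) (θ := fun i ↦ χ' * g.calculus.D V (x' i)) (by
        ext q
        rw [SmoothField.sum_apply]
        by_cases hq : q ∈ Function.support χ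
        · have := congrArg (χ q • ·) ((hχ (subset_tsupport _ hq)).2 (V q))
          simp only [Finset.smul_sum, smul_smul] at this
          exact this
        · have hq0 : χ' q = 0 := Function.notMem_support.1 hq
          rw [SmoothField.smul_apply, hq0, zero_smul]
          refine (Finset.sum_eq_zero fun i _ ↦ ?_).symm
          rw [SmoothField.smul_apply]
          change (χ' q * _) • _ = _
          rw [hq0, zero_mul, zero_smul]) (fun i ↦ by
        change χ p * mvfderiv 𝓘(ℝ, E) (x i) p (V p) = 0
        rw [hVp, map_zero, mul_zero]) Y Z W
    have hX' : X = X' + V := by rw [hV]; abel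
    rw [hX', g.calculus.R_add_left, map_add, LinearMap.add_apply, map_add, h0, add_zero]
  have h2 {W W' : SmoothField E M} (h : W p = W' p) (V : SmoothField E M) :
      evalAt p (g.calculus.ip V W) = evalAt p (g.calculus.ip V W') := by
    change g.inner p (V p) (W p) = g.inner p (V p) (W' p)
    rw [h]
  rw [h1 hX, g.calculus.R_swap, map_neg, LinearMap.neg_apply, map_neg, h1 hY, ← map_neg,
    ← LinearMap.neg_apply, ← map_neg, ← g.calculus.R_swap, h2 hW, g.calculus.ip_R_pair, h1 hZ,
    ← g.calculus.ip_R_pair]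

end SemiRiemannianMetric

namespace IndefiniteFramedFStructure

variable {s : ℕ} (S : IndefiniteFramedFStructure E M s)

theorem contMDiff_act {X : VField E M} (hX : CMDiff ∞ (T% X)) : CMDiff ∞ (T% (act S.φ X)) :=
  fun p ↦ ContMDiffAt.clm_bundle_apply (F₁ := E) (F₂ := E)
    (E₁ := (TangentSpace 𝓘(ℝ, E) : M → Type _)) (E₂ := (TangentSpace 𝓘(ℝ, E) : M → Type _))
    (b := fun x ↦ x) (ϕ := S.φ) (S.contMDiff_φ p) (hX p)

theorem contMDiff_η_apply (α : Fin s) {X : VField E M} (hX : CMDiff ∞ (T% X)) :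
    CMDiff ∞ (fun p ↦ S.η α p (X p)) := by
  intro p
  have := ContMDiffAt.clm_bundle_apply (F₁ := E) (F₂ := ℝ)
    (E₁ := (TangentSpace 𝓘(ℝ, E) : M → Type _)) (E₂ := Trivial M ℝ)
    (b := fun x ↦ x) (ϕ := S.η α) (S.contMDiff_η α p) (hX p)
  simp only [contMDiffAt_totalSpace] at this
  exact this.2

variable {S}

/-- The `S`-structure on the module of smooth vector fields. -/
def IsSManifold.calculus (hS : S.IsSManifold) : S.g.calculus.SStructure s where
  φ :=
    { toFun := fun X ↦ ⟨act S.φ X, S.contMDiff_act X.contMDiff⟩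
      map_add' := fun X Y ↦ by ext q; exact map_add (S.φ q) (X q) (Y q)
      map_smul' := fun f X ↦ by ext q; exact map_smul (S.φ q) (f q) (X q) }
  ξ α := ⟨S.ξ α, S.contMDiff_ξ α⟩
  η α :=
    { toFun := fun X ↦ ⟨fun q ↦ S.η α q (X q), S.contMDiff_η_apply α X.contMDiff⟩
      map_add' := fun X Y ↦ by ext q; exact map_add (S.η α q) (X q) (Y q)
      map_smul' := fun f X ↦ by ext q; exact map_smul (S.η α q) (f q) (X q) }
  ε α := ⟨fun _ ↦ S.ε α, contMDiff_const⟩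
  D_ε X α := by
    ext q
    exact congrArg (fun l ↦ l (X q)) (mvfderiv_const (I := 𝓘(ℝ, E)) (S.ε α) (x := q))
  ε_sq α := by
    ext q
    change S.ε α * S.ε α = 1
    rcases S.ε_eq α with h | h <;> simp [h]
  φ_sq X := by
    ext q
    rw [SmoothField.add_apply, SmoothField.sum_apply]
    exact S.φ_sq q (X q)
  η_ξ α β := by
    ext q
    refine (S.η_ξ q α β).trans ?_
    split_ifs <;> rfl
  φ_ξ α := by ext q; exact S.φ_ξ q α
  compatible X Y := by
    ext q
    refine (S.compatible q (X q) (Y q)).trans ?_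
    rw [ContMDiffMap.coe_sub, Pi.sub_apply, SmoothFn.sum_apply]
    rfl
  dη_eq α X Y := by
    ext q
    have h := hS.dη_eq α X Y X.contMDiff Y.contMDiff q
    rw [extDerivOneForm, ← S.g.calculus_lie_apply] at h
    change _ - _ - S.η α q (S.g.calculus.lie X Y q) = (2 : SmoothFn E M) q * _
    have h2 : (2 : SmoothFn E M) q = 2 := by
      rw [← one_add_one_eq_two, ← one_add_one_eq_two]; rfl
    rw [h2]
    change _ = 2 * S.g.inner q (X q) (S.φ q (Y q))
    rw [← h, ← mul_assoc]
    norm_num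
    rfl
  normal X Y := by
    ext q
    have h := hS.normal X Y X.contMDiff Y.contMDiff q
    simp only [hS.dη_eq _ X Y X.contMDiff Y.contMDiff q] at h
    let φ' (X : SmoothField E M) : SmoothField E M := ⟨act S.φ X, S.contMDiff_act X.contMDiff⟩
    have hL (X Y : SmoothField E M) : (S.g.calculus.lie X Y : VField E M) =
        mlieBracket 𝓘(ℝ, E) X Y := funext fun q ↦ S.g.calculus_lie_apply X Y q
    have h2 : (2 : SmoothFn E M) q = 2 := by
      rw [← one_add_one_eq_two, ← one_add_one_eq_two]; rfl
    rw [SmoothField.add_apply, SmoothField.sum_apply]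
    refine Eq.trans ?_ h
    congr 1
    · change S.φ q (S.φ q (S.g.calculus.lie X Y q)) + S.g.calculus.lie (φ' X) (φ' Y) q
        - S.φ q (S.g.calculus.lie (φ' X) Y q) - S.φ q (S.g.calculus.lie X (φ' Y) q) = _
      rw [hL, hL, hL, hL]
      rfl
    · refine Finset.sum_congr rfl fun α _ ↦ ?_
      change ((2 : SmoothFn E M) q * S.g.inner q (X q) (S.φ q (Y q))) • S.ξ α q = _
      rw [h2]

/-- The part of the curvature tensor of an `S`-space form which enters the Codazzi equation. -/
theorem IsSSpaceForm.inner_curvature {c : ℝ} (hs : 1 ≤ s) (hS : S.IsSSpaceForm c) {p : M}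
    {X Y Z : VField E M} (hX : CMDiff ∞ (T% X)) (hY : CMDiff ∞ (T% Y)) (hZ : CMDiff ∞ (T% Z))
    (hZX : Z p = X p) {w : TangentSpace 𝓘(ℝ, E) p}
    (hXh : ∀ α, S.η α p (X p) = 0) (hYh : ∀ α, S.η α p (Y p) = 0) (hwh : ∀ α, S.η α p w = 0)
    (hXw : S.g.inner p (X p) w = 0) (hYw : S.g.inner p (Y p) w = 0) :
    S.g.inner p (S.g.curvature X Y Z p) w = 3 / 4 * (c - ∑ α, S.ε α) *
      (S.g.inner p (X p) (S.φ p (Y p)) * S.g.inner p (S.φ p (X p)) w) := by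
  let T := hS.toIsSManifold.calculus
  let C := S.g.calculus
  have hφφ {v : TangentSpace 𝓘(ℝ, E) p} (hv : ∀ α, S.η α p v = 0) :
      -S.φ p (S.φ p v) = v := by
    rw [S.φ_sq]; simp [hv]
  -- The projection -φ² yields globally horizontal fields and does not change values that are
  -- horizontal at p.
  let hor (V : SmoothField E M) : SmoothField E M := -T.φ (T.φ V)
  have hor_mem (V : SmoothField E M) : hor V ∈ T.horizontal :=
    neg_mem (LeviCivitaCalculus.SStructure.φ_mem_horizontal _)
  have hor_apply (V : SmoothField E M) (hv : ∀ α, S.η α p (V p) = 0) : hor V p = V p := hφφ hv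
  obtain ⟨W, hW, rfl⟩ := exists_vfield w
  have ip_apply (U V : SmoothField E M) :
    evalAt p (C.ip U V) = S.g.inner p (U p) (V p) := rfl
  have R_apply (U V Z W : SmoothField E M) :
      evalAt p (C.ip (C.R U V Z) W) = S.g.inner p (S.g.curvature U V Z p) (W p) := by
    rw [ip_apply, S.g.calculus_R_apply]
  have φ_apply (U : SmoothField E M) : T.φ U p = S.φ p (U p) := rfl
  have η_φ (α : Fin s) (u : TangentSpace 𝓘(ℝ, E) p) : S.η α p (S.φ p u) = 0 := by
    obtain ⟨U, hU, rfl⟩ := exists_vfield u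
    exact congrArg (evalAt p) (T.η_φ α ⟨U, hU⟩)
  -- The extension to null vectors needs one non-null horizontal vector. If there were none, g would
  -- vanish on horizontal pairs by polarization, and compatibility would force φ = 0 at p, contrary
  -- to the nonzero rank.
  obtain ⟨v, hv, hv0⟩ : ∃ v : TangentSpace 𝓘(ℝ, E) p,
      (∀ α, S.η α p v = 0) ∧ S.g.inner p v v ≠ 0 := by
    by_contra! hnull
    obtain ⟨r, hr, hrank⟩ := S.constant_rank
    refine hr ((hrank p).symm.trans ?_)
    suffices h : ∀ u, S.φ p u = 0 by
      have : S.φ p = 0 := ContinuousLinearMap.ext h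
      rw [this]; simp
    intro u
    refine S.g.nondegenerate p _ fun w ↦ ?_
    have h1 := S.compatible p (S.φ p u) w
    have hp (a b : TangentSpace 𝓘(ℝ, E) p) (ha : ∀ α, S.η α p a = 0) (hb : ∀ α, S.η α p b = 0) :
        S.g.inner p a b = 0 := by
      have h1 := hnull a ha
      have h2 := hnull b hb
      have h3 := hnull (a + b) fun α ↦ by rw [map_add, ha, hb, add_zero]
      have h4 := S.g.symm p a b
      simp only [map_add, add_apply] at h3
      linarith
    rw [hp _ _ (fun α ↦ η_φ α _) (fun α ↦ η_φ α _)] at h1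
    simpa [η_φ] using h1.symm
  obtain ⟨V, hV, rfl⟩ := exists_vfield v
  have hsec (U : SmoothField E M) (hU : U ∈ T.horizontal) (hU0 : evalAt p (C.ip U U) ≠ 0) :
      evalAt p (C.ip (C.R U (T.φ U) (T.φ U)) U) =
        c * (evalAt p (C.ip U U) * evalAt p (C.ip U U)) := by
    have hUp (α : Fin s) : S.η α p (U p) = 0 := congrArg (evalAt p) (hU α)
    have h := hS.φ_sectional U U.contMDiff p
      ⟨-S.φ p (U p), by rw [map_neg]; exact hφφ hUp⟩ hU0
    have e1 : S.g.inner p (S.φ p (U p)) (S.φ p (U p)) = S.g.inner p (U p) (U p) :=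
      congrArg (evalAt p) (LeviCivitaCalculus.SStructure.ip_φ_φ_of_horizontal hU U)
    have e2 : S.g.inner p (U p) (S.φ p (U p)) = 0 := by
      have h1 : S.g.inner p (S.φ p (U p)) (U p) = -S.g.inner p (U p) (S.φ p (U p)) :=
        congrArg (evalAt p) (T.φ_skew U U)
      have h2 := S.g.symm p (U p) (S.φ p (U p))
      linarith
    rw [SemiRiemannianMetric.sectionalCurvature] at h
    change _ / (_ * S.g.inner p (S.φ p (U p)) (S.φ p (U p)) -
      S.g.inner p (U p) (S.φ p (U p)) ^ 2) = c at h
    rw [e1, e2, div_eq_iff (by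
      have h0 : S.g.inner p (U p) (U p) ≠ 0 := hU0
      simpa using h0)] at h
    rw [R_apply]
    refine h.trans ?_
    rw [ip_apply]
    ring
  have hX' := hor_apply ⟨X, hX⟩ hXh
  have hY' := hor_apply ⟨Y, hY⟩ hYh
  have hW' := hor_apply ⟨W, hW⟩ hwh
  have hV' := hor_apply ⟨V, hV⟩ hv
  have hε : evalAt p T.εsum = ∑ α, S.ε α := by
    rw [evalAt_apply]
    exact SmoothFn.sum_apply _ _ _
  have key := LeviCivitaCalculus.SStructure.ip_R_of_sectional (S := T) ⟨0, hs⟩ (evalAt p) hsec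
    (hor_mem ⟨V, hV⟩) (by rw [ip_apply, hV']; exact hv0)
    (hor_mem ⟨X, hX⟩) (hor_mem ⟨Y, hY⟩) (hor_mem ⟨W, hW⟩)
    (by rw [ip_apply, hX', hW']; exact hXw) (by rw [ip_apply, hY', hW']; exact hYw)
  rw [S.g.calculus_ip_R_congr (Z' := ⟨Z, hZ⟩) hX' hY' (hX'.trans hZX.symm) hW', R_apply,
    ip_apply, ip_apply, φ_apply, φ_apply, hX', hY', hW', hε] at key
  exact key

end IndefiniteFramedFStructure

end SGeom

/-! ### Covariant differentiation of vector fields along a map -/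

namespace SGeom

open Filter Topology

variable {E : Type*} [NormedAddCommGroup E] [NormedSpace ℝ E] [FiniteDimensional ℝ E]
  {N : Type*} [TopologicalSpace N] [ChartedSpace E N] [IsManifold 𝓘(ℝ, E) ∞ N]
  {F : Type*} [NormedAddCommGroup F] [NormedSpace ℝ F]
  {M : Type*} [TopologicalSpace M] [ChartedSpace F M]

/-- The coordinates of the tangent vector `v` at `q` in the chart around `p`. -/
abbrev coordAt (p q : N) : TangentSpace 𝓘(ℝ, E) q →L[ℝ] E :=
  (trivializationAt E (TangentSpace 𝓘(ℝ, E) : N → Type _) p).continuousLinearMapAt ℝ q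

theorem eventually_coordAt (p : N) : ∀ᶠ q in 𝓝 p, ∀ v : TangentSpace 𝓘(ℝ, E) q,
    (trivializationAt E (TangentSpace 𝓘(ℝ, E) : N → Type _) p ⟨q, v⟩).2 = coordAt p q v := by
  filter_upwards [(trivializationAt E (TangentSpace 𝓘(ℝ, E) : N → Type _) p).open_baseSet.mem_nhds
    (FiberBundle.mem_baseSet_trivializationAt' p)] with q hq v
  exact ((trivializationAt E (TangentSpace 𝓘(ℝ, E) : N → Type _)
    p).continuousLinearMapAt_apply_of_mem ℝ hq v).symm

theorem symmL_coordAt (p : N) (v : TangentSpace 𝓘(ℝ, E) p) :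
    (trivializationAt E (TangentSpace 𝓘(ℝ, E) : N → Type _) p).symmL ℝ p (coordAt p p v) = v :=
  Trivialization.symmL_continuousLinearMapAt _ (FiberBundle.mem_baseSet_trivializationAt' p) v

theorem mvfderiv_congr {V : Type*} [NormedAddCommGroup V] [NormedSpace ℝ V] {a b : M → V} {x : M}
    (h : a =ᶠ[𝓝 x] b) : mvfderiv 𝓘(ℝ, F) a x = mvfderiv 𝓘(ℝ, F) b x :=
  h.mfderiv_eq

theorem mvfderiv_comp_vector {V : Type*} [NormedAddCommGroup V] [NormedSpace ℝ V] {a : N → V}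
    {f : M → N} {x : M} (ha : MDiffAt a (f x)) (hf : MDiffAt f x) :
    mvfderiv 𝓘(ℝ, F) (fun y ↦ a (f y)) x =
      (mvfderiv 𝓘(ℝ, E) a (f x)).comp (mfderiv 𝓘(ℝ, F) 𝓘(ℝ, E) f x) :=
  mfderiv_comp x ha hf

/-- Differentiability of a vector field along `f`. -/
def MDiffAlongAt (F : Type*) [NormedAddCommGroup F] [NormedSpace ℝ F] {M : Type*}
    [TopologicalSpace M] [ChartedSpace F M] (f : M → N) (V : VFieldAlong E f) (x : M) : Prop :=
  MDifferentiableAt 𝓘(ℝ, F) (𝓘(ℝ, E).prod 𝓘(ℝ, E)) (fun y ↦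
    TotalSpace.mk' E (E := (TangentSpace 𝓘(ℝ, E) : N → Type _)) (f y) (V y)) x

/-- Smoothness of a vector field along `f`. -/
def CMDiffAlongAt (F : Type*) [NormedAddCommGroup F] [NormedSpace ℝ F] {M : Type*}
    [TopologicalSpace M] [ChartedSpace F M] (f : M → N) (V : VFieldAlong E f) (x : M) : Prop :=
  ContMDiffAt 𝓘(ℝ, F) (𝓘(ℝ, E).prod 𝓘(ℝ, E)) ∞ (fun y ↦
    TotalSpace.mk' E (E := (TangentSpace 𝓘(ℝ, E) : N → Type _)) (f y) (V y)) x

theorem CMDiffAlongAt.mdiffAlongAt {f : M → N} {V : VFieldAlong E f} {x : M}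
    (h : CMDiffAlongAt F f V x) : MDiffAlongAt F f V x :=
  ContMDiffAt.mdifferentiableAt h (by simp)

theorem mdiffAlongAt_iff {f : M → N} {V : VFieldAlong E f} {x : M} :
    MDiffAlongAt F f V x ↔
    MDiffAt f x ∧ MDiffAt (fun y ↦ coordAt (E := E) (f x) (f y) (V y)) x := by
  rw [MDiffAlongAt, mdifferentiableAt_totalSpace]
  refine and_congr_right fun hf ↦ ?_
  refine Filter.EventuallyEq.mdifferentiableAt_iff ?_
  filter_upwards [hf.continuousAt.eventually (eventually_coordAt (E := E) (f x))] with y hy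
  exact hy _

theorem cmdiffAlongAt_iff {f : M → N} {V : VFieldAlong E f} {x : M} :
    CMDiffAlongAt F f V x ↔
    CMDiffAt ∞ f x ∧ CMDiffAt ∞ (fun y ↦ coordAt (E := E) (f x) (f y) (V y)) x := by
  rw [CMDiffAlongAt, contMDiffAt_totalSpace]
  refine and_congr_right fun hf ↦ ?_
  refine Filter.EventuallyEq.contMDiffAt_iff ?_
  filter_upwards [hf.continuousAt.eventually (eventually_coordAt (E := E) (f x))] with y hy
  exact hy _

namespace CMDiffAlongAt

variable {f : M → N} {V W : VFieldAlong E f} {a : M → ℝ} {x : M}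

theorem add (hV : CMDiffAlongAt F f V x) (hW : CMDiffAlongAt F f W x) :
    CMDiffAlongAt F f (V + W) x := by
  rw [cmdiffAlongAt_iff] at *
  exact ⟨hV.1, (hV.2.add hW.2).congr_of_eventuallyEq (.of_forall fun y ↦ by simp)⟩

theorem sub (hV : CMDiffAlongAt F f V x) (hW : CMDiffAlongAt F f W x) :
    CMDiffAlongAt F f (V - W) x := by
  rw [cmdiffAlongAt_iff] at *
  exact ⟨hV.1, (hV.2.sub hW.2).congr_of_eventuallyEq (.of_forall fun y ↦ by simp)⟩

theorem smul (ha : CMDiffAt ∞ a x) (hV : CMDiffAlongAt F f V x) :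
    CMDiffAlongAt F f (a • V) x := by
  rw [cmdiffAlongAt_iff] at *
  exact ⟨hV.1, (ha.smul hV.2).congr_of_eventuallyEq (.of_forall fun y ↦ by simp)⟩

theorem sum {ι : Type*} (t : Finset ι) {V : ι → VFieldAlong E f} (hf : CMDiffAt ∞ f x)
    (hV : ∀ i ∈ t, CMDiffAlongAt F f (V i) x) : CMDiffAlongAt F f (∑ i ∈ t, V i) x := by
  classical
  induction t using Finset.induction_on with
  | empty =>
    rw [cmdiffAlongAt_iff]
    exact ⟨hf, (contMDiffAt_const (c := 0)).congr_of_eventuallyEq (.of_forall fun y ↦ by simp)⟩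
  | insert i t hi ih =>
    rw [Finset.sum_insert hi]
    exact (hV i (by simp)).add (ih fun j hj ↦ hV j (by simp [hj]))

theorem congr (hV : CMDiffAlongAt F f V x) (h : ∀ᶠ y in 𝓝 x, V y = W y) : CMDiffAlongAt F f W x :=
  ContMDiffAt.congr_of_eventuallyEq hV (h.mono fun y hy ↦ by simp [hy])

theorem inner {g : SemiRiemannianMetric E N} (hV : CMDiffAlongAt F f V x)
    (hW : CMDiffAlongAt F f W x) : CMDiffAt ∞ (fun y ↦ g.inner (f y) (V y) (W y)) x := by
  have hf := (cmdiffAlongAt_iff.1 hV).1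
  have := ContMDiffAt.clm_bundle_apply₂ (F₁ := E) (F₂ := E) (F₃ := ℝ)
    (E₁ := (TangentSpace 𝓘(ℝ, E) : N → Type _)) (E₂ := (TangentSpace 𝓘(ℝ, E) : N → Type _))
    (E₃ := Trivial N ℝ) (b := f) (ψ := fun y ↦ g.inner (f y)) (v := V) (w := W)
    ((g.contMDiff (f x)).comp x hf) hV hW
  simp only [contMDiffAt_totalSpace] at this
  exact this.2

theorem comp {W : VField E N} (hW : CMDiffAt ∞ (T% W) (f x)) (hf : CMDiffAt ∞ f x) :
    CMDiffAlongAt F f (fun y ↦ W (f y)) x :=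
  ContMDiffAt.comp x hW hf

end CMDiffAlongAt

namespace SemiRiemannianMetric

variable (g : SemiRiemannianMetric E N)

/-- The difference of the Levi-Civita connection and the flat connection of the chart. -/
def chartDiff (p : N) (u : TangentSpace 𝓘(ℝ, E) p) (W : VField E N) : TangentSpace 𝓘(ℝ, E) p :=
  g.leviCivita W p u - (trivializationAt E (TangentSpace 𝓘(ℝ, E) : N → Type _) p).symmL ℝ p
    (mvfderiv 𝓘(ℝ, E) (fun q ↦ coordAt (E := E) p q (W q)) p u)

theorem mdifferentiableAt_coordAt {W : VField E N} {p : N} (hW : MDiffAt (T% W) p) :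
    MDiffAt (fun q ↦ coordAt (E := E) p q (W q)) p :=
  (mdiffAlongAt_iff (F := E) (f := fun q : N ↦ q) (V := W)).1 hW |>.2

/-- Both connections obey the same Leibniz rule, so the derivative terms cancel in the difference.
-/
theorem chartDiff_tensorial (p : N) (u : TangentSpace 𝓘(ℝ, E) p) :
    TensorialAt 𝓘(ℝ, E) E (g.chartDiff p u) p where
  smul {f W} hf hW := by
    have h1 := congrArg (fun l ↦ l u) (g.leviCivita.isCovariantDerivativeOnUniv.leibniz hW hf)
    have h2 : (fun q ↦ coordAt (E := E) p q ((f • W) q)) =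
        f • fun q ↦ coordAt (E := E) p q (W q) := by
      funext q; simp
    have h3 := congrArg (fun l ↦ l u) (mvfderiv_smul hf (mdifferentiableAt_coordAt hW))
    have h4 := symmL_coordAt p (W p)
    rw [chartDiff, chartDiff, h2]
    erw [h3, h1]
    simp only [add_apply, smul_apply, ContinuousLinearMap.smulRight_apply, map_add, map_smul]
    erw [h4]
    module
  add {W W'} hW hW' := by
    have h1 := congrArg (fun l ↦ l u) (g.leviCivita.isCovariantDerivativeOnUniv.add hW hW')
    have h2 : (fun q ↦ coordAt (E := E) p q ((W + W') q)) =
        (fun q ↦ coordAt (E := E) p q (W q)) + fun q ↦ coordAt (E := E) p q (W' q) := by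
      funext q; simp
    have h3 := congrArg (fun l ↦ l u) (mvfderiv_add (mdifferentiableAt_coordAt hW)
      (mdifferentiableAt_coordAt hW'))
    rw [chartDiff, chartDiff, chartDiff, h2]
    erw [h3, h1]
    simp only [add_apply, map_add]
    abel

theorem chartDiff_extend (p : N) (u v : TangentSpace 𝓘(ℝ, E) p) :
    g.chartDiff p u (FiberBundle.extend E v) = g.leviCivita (FiberBundle.extend E v) p u := by
  have h : (fun q ↦ coordAt (E := E) p q (FiberBundle.extend E v q)) =ᶠ[𝓝 p] fun _ ↦
      (trivializationAt E (TangentSpace 𝓘(ℝ, E) : N → Type _) p ⟨p, v⟩).2 := by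
    filter_upwards [(trivializationAt E (TangentSpace 𝓘(ℝ, E) : N → Type _)
      p).open_baseSet.mem_nhds (FiberBundle.mem_baseSet_trivializationAt' p),
      eventually_coordAt (E := E) p] with q hq hq'
    rw [← hq', FiberBundle.extend, Trivialization.apply_mk_symm _ hq]
  rw [chartDiff, mvfderiv_congr h, mvfderiv_const]
  simp

/-- The connection form of the Levi-Civita connection in the chart around `p`. -/
def connectionForm (p : N) (u : TangentSpace 𝓘(ℝ, E) p) :
    TangentSpace 𝓘(ℝ, E) p →L[ℝ] TangentSpace 𝓘(ℝ, E) p :=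
  TensorialAt.mkHom (I := 𝓘(ℝ, E)) (F := E) (V := (TangentSpace 𝓘(ℝ, E) : N → Type _))
    (g.chartDiff p u) p (g.chartDiff_tensorial p u)

variable {f : M → N} {X : VField F M} {V W : VFieldAlong E f} {a : M → ℝ} {x : M}

/-- Fields of the form `FiberBundle.extend` have locally constant chart coordinates, so on them the
connection reduces to its connection form. The pulled back derivative thereby becomes a flat
derivative plus a term linear in V x, from which its calculus rules follow. -/
theorem covAlong_eq (hf : ContinuousAt f x) : covAlong g f X V x =
    (trivializationAt E (TangentSpace 𝓘(ℝ, E) : N → Type _) (f x)).symmL ℝ (f x)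
      (mvfderiv 𝓘(ℝ, F) (fun y ↦ coordAt (E := E) (f x) (f y) (V y)) x (X x)) +
      g.connectionForm (f x) (mfderiv 𝓘(ℝ, F) 𝓘(ℝ, E) f x (X x)) (V x) := by
  have h : (fun y ↦ (trivializationAt E (TangentSpace 𝓘(ℝ, E) : N → Type _) (f x) ⟨f y, V y⟩).2)
      =ᶠ[𝓝 x] fun y ↦ coordAt (E := E) (f x) (f y) (V y) := by
    filter_upwards [hf.eventually (eventually_coordAt (E := E) (f x))] with y hy
    exact hy _
  simp only [covAlong]
  rw [mvfderiv_congr h, connectionForm, TensorialAt.mkHom_apply_eq_extend, chartDiff_extend]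

theorem covAlong_congr (hf : ContinuousAt f x) (h : ∀ᶠ y in 𝓝 x, V y = W y) :
    covAlong g f X V x = covAlong g f X W x := by
  rw [covAlong_eq g hf, covAlong_eq g hf, h.self_of_nhds, mvfderiv_congr (b := fun y ↦
    coordAt (E := E) (f x) (f y) (W y)) (h.mono fun y hy ↦ by simp [hy])]

theorem covAlong_add (hV : MDiffAlongAt F f V x) (hW : MDiffAlongAt F f W x) :
    covAlong g f X (V + W) x = covAlong g f X V x + covAlong g f X W x := by
  rw [mdiffAlongAt_iff] at hV hW
  have hf := hV.1.continuousAt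
  rw [covAlong_eq g hf, covAlong_eq g hf, covAlong_eq g hf]
  have h2 : (fun y ↦ coordAt (E := E) (f x) (f y) ((V + W) y)) =
      (fun y ↦ coordAt (E := E) (f x) (f y) (V y)) +
        fun y ↦ coordAt (E := E) (f x) (f y) (W y) := by
    funext q; simp
  rw [h2, mvfderiv_add hV.2 hW.2]
  simp only [Pi.add_apply, add_apply, map_add]
  abel

theorem covAlong_smul (ha : MDiffAt a x) (hV : MDiffAlongAt F f V x) :
    covAlong g f X (a • V) x =
      a x • covAlong g f X V x + mvfderiv 𝓘(ℝ, F) a x (X x) • V x := by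
  rw [mdiffAlongAt_iff] at hV
  have hf := hV.1.continuousAt
  rw [covAlong_eq g hf, covAlong_eq g hf]
  have h2 : (fun y ↦ coordAt (E := E) (f x) (f y) ((a • V) y)) =
      a • fun y ↦ coordAt (E := E) (f x) (f y) (V y) := by
    funext q; simp
  have h4 := symmL_coordAt (f x) (V x)
  rw [h2, mvfderiv_smul ha hV.2]
  simp only [add_apply, smul_apply, ContinuousLinearMap.smulRight_apply, map_add, map_smul, h4,
    Pi.smul_apply']
  module

theorem covAlong_comp {W : VField E N} (hW : MDiffAt (T% W) (f x)) (hf : MDiffAt f x) :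
    covAlong g f X (fun y ↦ W (f y)) x =
      g.leviCivita W (f x) (mfderiv 𝓘(ℝ, F) 𝓘(ℝ, E) f x (X x)) := by
  rw [covAlong_eq g hf.continuousAt, connectionForm, TensorialAt.mkHom_apply _ hW, chartDiff,
    mvfderiv_comp_vector (a := fun q ↦ coordAt (f x) q (W q)) (mdifferentiableAt_coordAt hW) hf]
  simp

theorem covAlong_sum {ι : Type*} (t : Finset ι) {V : ι → VFieldAlong E f} (hf : CMDiffAt ∞ f x)
    (hV : ∀ i ∈ t, CMDiffAlongAt F f (V i) x) :
    covAlong g f X (∑ i ∈ t, V i) x = ∑ i ∈ t, covAlong g f X (V i) x := by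
  classical
  induction t using Finset.induction_on with
  | empty =>
    rw [covAlong_eq g hf.continuousAt]
    simp [mvfderiv_const]
  | insert i t hi ih =>
    have h (j) (hj : j ∈ t) := hV j (Finset.mem_insert_of_mem hj)
    rw [Finset.sum_insert hi, Finset.sum_insert hi, ← ih h]
    exact g.covAlong_add (hV i (by simp)).mdiffAlongAt (CMDiffAlongAt.sum t hf h).mdiffAlongAt

end SemiRiemannianMetric

end SGeom

/-! ### Torsion and curvature of the pulled back connection -/

namespace SGeom

open Filter Topology

/-- Coordinate functions around `p` with their coordinate vector fields, both extended globally. -/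
structure CoordinateFrame {E : Type*} [NormedAddCommGroup E] [NormedSpace ℝ E]
    {M : Type*} [TopologicalSpace M] [ChartedSpace E M] [IsManifold 𝓘(ℝ, E) ∞ M] (p : M) where
  x : Fin (Module.finrank ℝ E) → M → ℝ
  e : Fin (Module.finrank ℝ E) → VField E M
  contMDiff_x (i) : CMDiff ∞ (x i)
  contMDiff_e (i) : CMDiff ∞ (T% (e i))
  eventually_dual : ∀ᶠ q in 𝓝 p, ∀ i j, mvfderiv 𝓘(ℝ, E) (x i) q (e j q) = if i = j then 1 else 0
  eventually_span : ∀ᶠ q in 𝓝 p, ∀ v : TangentSpace 𝓘(ℝ, E) q,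
    v = ∑ i, mvfderiv 𝓘(ℝ, E) (x i) q v • e i q

section

variable {E : Type*} [NormedAddCommGroup E] [NormedSpace ℝ E] [FiniteDimensional ℝ E]
  {N : Type*} [TopologicalSpace N] [T2Space N] [ChartedSpace E N] [IsManifold 𝓘(ℝ, E) ∞ N]

theorem nonempty_coordinateFrame (p : N) : Nonempty (CoordinateFrame (E := E) p) := by
  obtain ⟨x, e, hx, he, h⟩ := exists_coordinates (E := E) p
  exact ⟨⟨x, e, hx, he, h.mono fun q hq ↦ hq.1, h.mono fun q hq ↦ hq.2⟩⟩

/-- Near p the functions dx_k(e_i) are constant, so every dx_k annihilates the bracket. -/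
theorem CoordinateFrame.mlieBracket_eq_zero {p : N} (c : CoordinateFrame (E := E) p) (i j) :
    mlieBracket 𝓘(ℝ, E) (c.e i) (c.e j) p = 0 := by
  have h0 (k i j) : mvfderiv 𝓘(ℝ, E) (fun q ↦ mvfderiv 𝓘(ℝ, E) (c.x k) q (c.e i q)) p
      (c.e j p) = 0 := by
    rw [mvfderiv_congr (b := fun _ ↦ if k = i then (1 : ℝ) else 0)
      (c.eventually_dual.mono fun q hq ↦ hq k i), mvfderiv_const]
    rfl
  rw [c.eventually_span.self_of_nhds (mlieBracket 𝓘(ℝ, E) (c.e i) (c.e j) p)]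
  refine Finset.sum_eq_zero fun k _ ↦ ?_
  rw [mvfderiv_mlieBracket (c.contMDiff_x k) (c.contMDiff_e i) (c.contMDiff_e j), h0, h0, sub_zero,
    zero_smul]

end

namespace SemiRiemannianMetric

variable {E : Type*} [NormedAddCommGroup E] [NormedSpace ℝ E] [FiniteDimensional ℝ E]
  {N : Type*} [TopologicalSpace N] [T2Space N] [ChartedSpace E N] [IsManifold 𝓘(ℝ, E) ∞ N]
  (g : SemiRiemannianMetric E N)

/-- The curvature at a point depends only on the values of the vector fields at that point. -/
theorem curvature_congr {X X' Y Y' Z Z' : VField E N} {p : N}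
    (hX : CMDiff ∞ (T% X)) (hX' : CMDiff ∞ (T% X')) (hY : CMDiff ∞ (T% Y))
    (hY' : CMDiff ∞ (T% Y')) (hZ : CMDiff ∞ (T% Z)) (hZ' : CMDiff ∞ (T% Z'))
    (hXp : X p = X' p) (hYp : Y p = Y' p) (hZp : Z p = Z' p) :
    g.curvature X Y Z p = g.curvature X' Y' Z' p := by
  refine g.eq_of_inner_eq fun w ↦ ?_
  obtain ⟨W, hW, rfl⟩ := exists_vfield w
  have h := g.calculus_ip_R_congr (X := ⟨X, hX⟩) (X' := ⟨X', hX'⟩) (Y := ⟨Y, hY⟩) (Y' := ⟨Y', hY'⟩)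
    (Z := ⟨Z, hZ⟩) (Z' := ⟨Z', hZ'⟩) (W := ⟨W, hW⟩) (W' := ⟨W, hW⟩) hXp hYp hZp rfl
  change g.inner p (g.calculus.R _ _ _ p) (W p) = g.inner p (g.calculus.R _ _ _ p) (W p) at h
  rw [calculus_R_apply, calculus_R_apply] at h
  exact h

theorem curvature_swap {X Y Z : VField E N} (p : N) (hX : CMDiff ∞ (T% X))
    (hY : CMDiff ∞ (T% Y)) (hZ : CMDiff ∞ (T% Z)) :
    g.curvature X Y Z p = -g.curvature Y X Z p := by
  have h3 := congrArg (fun V : SmoothField E N ↦ V p)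
    (g.calculus.R_swap ⟨X, hX⟩ ⟨Y, hY⟩ ⟨Z, hZ⟩)
  simp only [SmoothField.neg_apply, calculus_R_apply] at h3
  exact h3

section

variable {ι : Type*} [Fintype ι] {e : ι → VField E N} (he : ∀ i, CMDiff ∞ (T% (e i))) (a : ι → ℝ)
  {X Y Z : VField E N} (p : N)
include he

theorem contMDiff_sum_const_smul : CMDiff ∞ (T% (fun q ↦ ∑ i, a i • e i q)) :=
  ContMDiff.sum_section fun i _ ↦ (he i).const_smul_section

theorem curvature_sum_left (hY : CMDiff ∞ (T% Y)) (hZ : CMDiff ∞ (T% Z)) :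
    g.curvature (fun q ↦ ∑ i, a i • e i q) Y Z p = ∑ i, a i • g.curvature (e i) Y Z p := by
  let e' (i) : SmoothField E N := ⟨e i, he i⟩
  let a' (i) : SmoothFn E N := ⟨fun _ ↦ a i, contMDiff_const⟩
  have h1 : (⟨fun q ↦ ∑ i, a i • e i q, contMDiff_sum_const_smul he a⟩ : SmoothField E N) =
      ∑ i, a' i • e' i := by
    ext q; rw [SmoothField.sum_apply]; rfl
  have h2 := map_sum (AddMonoidHom.mk' (fun X ↦ g.calculus.R X ⟨Y, hY⟩ ⟨Z, hZ⟩)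
    (fun X X' ↦ g.calculus.R_add_left X X' _ _)) (fun i ↦ a' i • e' i) Finset.univ
  simp only [AddMonoidHom.mk'_apply, g.calculus.R_smul_left] at h2
  rw [← h1] at h2
  have h3 := congrArg (fun V : SmoothField E N ↦ V p) h2
  simp only [SmoothField.sum_apply, SmoothField.smul_apply, calculus_R_apply] at h3
  exact h3

theorem curvature_sum_mid (hX : CMDiff ∞ (T% X)) (hZ : CMDiff ∞ (T% Z)) :
    g.curvature X (fun q ↦ ∑ i, a i • e i q) Z p = ∑ i, a i • g.curvature X (e i) Z p := by
  rw [g.curvature_swap p hX (contMDiff_sum_const_smul he a) hZ,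
    g.curvature_sum_left he a p hX hZ, ← Finset.sum_neg_distrib]
  refine Finset.sum_congr rfl fun i _ ↦ ?_
  rw [g.curvature_swap p hX (he i) hZ, smul_neg]

theorem curvature_sum_right (hX : CMDiff ∞ (T% X)) (hY : CMDiff ∞ (T% Y)) :
    g.curvature X Y (fun q ↦ ∑ i, a i • e i q) p = ∑ i, a i • g.curvature X Y (e i) p := by
  refine g.eq_of_inner_eq fun w ↦ ?_
  obtain ⟨W, hW, rfl⟩ := exists_vfield w
  let e' (i) : SmoothField E N := ⟨e i, he i⟩
  have pair {X Y Z W : VField E N} (hX : CMDiff ∞ (T% X)) (hY : CMDiff ∞ (T% Y))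
      (hZ : CMDiff ∞ (T% Z)) (hW : CMDiff ∞ (T% W)) :
      g.inner p (g.curvature X Y Z p) (W p) = g.inner p (g.curvature Z W X p) (Y p) := by
    have h := congrArg (evalAt p) (g.calculus.ip_R_pair ⟨X, hX⟩ ⟨Y, hY⟩ ⟨Z, hZ⟩ ⟨W, hW⟩)
    change g.inner p (g.calculus.R _ _ _ p) (W p) = g.inner p (g.calculus.R _ _ _ p) (Y p) at h
    rw [calculus_R_apply, calculus_R_apply] at h
    exact h
  rw [pair hX hY (contMDiff_sum_const_smul he a) hW, g.curvature_sum_left he a p hW hX]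
  simp only [map_sum, map_smul, sum_apply, smul_apply, pair hX hY (he _) hW]

end

variable {F : Type*} [NormedAddCommGroup F] [NormedSpace ℝ F] [FiniteDimensional ℝ F]
  {M : Type*} [TopologicalSpace M] [T2Space M] [ChartedSpace F M] [IsManifold 𝓘(ℝ, F) ∞ M]

section

variable {f : M → N} {x : M}

theorem mvfderiv_comp_push (hf : CMDiff ∞ f) {a : N → ℝ} (ha : CMDiff ∞ a) (Y : VField F M)
    (y : M) : mvfderiv 𝓘(ℝ, F) (fun z ↦ a (f z)) y (Y y) =
      mvfderiv 𝓘(ℝ, E) a (f y) (push E f Y y) := by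
  rw [mvfderiv_comp_vector ((ha (f y)).mdifferentiableAt (by simp))
    ((hf y).mdifferentiableAt (by simp))]
  rfl

theorem contMDiff_mvfderiv_comp (hf : CMDiff ∞ f) {a : N → ℝ} (ha : CMDiff ∞ a) {Y : VField F M}
    (hY : CMDiff ∞ (T% Y)) : CMDiff ∞ (fun y ↦ mvfderiv 𝓘(ℝ, F) (fun z ↦ a (f z)) y (Y y)) :=
  fun y ↦ contMDiffAt_mvfderiv_apply ((ha (f y)).comp y (hf y)) (hY y)

/-- The components of `push Y` in a coordinate frame. -/
def comps (f : M → N) (c : CoordinateFrame (E := E) (f x)) (Y : VField F M)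
    (i : Fin (Module.finrank ℝ E)) (y : M) : ℝ :=
  mvfderiv 𝓘(ℝ, F) (fun z ↦ c.x i (f z)) y (Y y)

theorem contMDiff_comps (hf : CMDiff ∞ f) (c : CoordinateFrame (E := E) (f x)) {Y : VField F M}
    (hY : CMDiff ∞ (T% Y)) (i) : CMDiff ∞ (comps f c Y i) :=
  contMDiff_mvfderiv_comp hf (c.contMDiff_x i) hY

theorem eventually_push_eq (hf : CMDiff ∞ f) (c : CoordinateFrame (E := E) (f x))
    (Y : VField F M) :
    ∀ᶠ y in 𝓝 x, push E f Y y =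
      (∑ i, comps f c Y i • (fun y ↦ c.e i (f y) : VFieldAlong E f) : VFieldAlong E f) y := by
  filter_upwards [(hf x).continuousAt.eventually c.eventually_span] with y hy
  rw [hy (push E f Y y), Finset.sum_apply]
  refine Finset.sum_congr rfl fun i _ ↦ ?_
  rw [← mvfderiv_comp_push hf (c.contMDiff_x i)]
  rfl

theorem comps_mlieBracket (hf : CMDiff ∞ f) (c : CoordinateFrame (E := E) (f x)) {X Y : VField F M}
    (hX : CMDiff ∞ (T% X)) (hY : CMDiff ∞ (T% Y)) (i) (y : M) :
    comps f c (mlieBracket 𝓘(ℝ, F) X Y) i y =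
      mvfderiv 𝓘(ℝ, F) (comps f c Y i) y (X y) - mvfderiv 𝓘(ℝ, F) (comps f c X i) y (Y y) :=
  mvfderiv_mlieBracket (f := fun z ↦ c.x i (f z)) ((c.contMDiff_x i).comp hf) hX hY y

theorem leviCivita_push (hf : CMDiff ∞ f) (c : CoordinateFrame (E := E) (f x)) (Y : VField F M)
    (W : VField E N) : ∀ᶠ y in 𝓝 x, g.leviCivita W (f y) (push E f Y y) =
      (∑ i, comps f c Y i • (fun y ↦ g.cov (c.e i) W (f y) : VFieldAlong E f) :
        VFieldAlong E f) y := by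
  filter_upwards [eventually_push_eq hf c Y] with y hy
  rw [hy, Finset.sum_apply, Finset.sum_apply, map_sum]
  refine Finset.sum_congr rfl fun i _ ↦ ?_
  exact map_smul _ _ _

theorem cmdiffAlongAt_push (hf : CMDiff ∞ f) {Y : VField F M} (hY : CMDiff ∞ (T% Y)) (x : M) :
    CMDiffAlongAt F f (push E f Y) x :=
  contMDiffAt_mfderiv_apply (hf x) (hY x)

theorem covAlong_comp_eq (hf : CMDiff ∞ f) {W : VField E N} (hW : CMDiff ∞ (T% W))
    (X : VField F M) : covAlong g f X (fun y ↦ W (f y)) =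
      fun y ↦ g.leviCivita W (f y) (push E f X y) :=
  funext fun y ↦ g.covAlong_comp ((hW (f y)).mdifferentiableAt (by simp))
    ((hf y).mdifferentiableAt (by simp))

theorem cmdiffAlongAt_covAlong_comp (hf : CMDiff ∞ f) {W : VField E N} (hW : CMDiff ∞ (T% W))
    {X : VField F M} (hX : CMDiff ∞ (T% X)) (x : M) :
    CMDiffAlongAt F f (covAlong g f X (fun y ↦ W (f y))) x := by
  obtain ⟨c⟩ := nonempty_coordinateFrame (E := E) (f x)
  rw [g.covAlong_comp_eq hf hW]
  refine CMDiffAlongAt.congr ?_ ((g.leviCivita_push hf c X W).mono fun y hy ↦ hy.symm)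
  exact CMDiffAlongAt.sum _ (hf x) fun i _ ↦ (CMDiffAlongAt.comp
    (g.contMDiff_cov (c.contMDiff_e i) hW (f x)) (hf x)).smul (contMDiff_comps hf c hX i x)

theorem covAlong_smul_eq {a : M → ℝ} (ha : CMDiff ∞ a) {V : VFieldAlong E f}
    (hV : ∀ x, CMDiffAlongAt F f V x) (X : VField F M) :
    covAlong g f X (a • V) =
      a • covAlong g f X V + (fun y ↦ mvfderiv 𝓘(ℝ, F) a y (X y)) • V :=
  funext fun y ↦ g.covAlong_smul ((ha y).mdifferentiableAt (by simp)) (hV y).mdiffAlongAt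

theorem covAlong_sum_eq {ι : Type*} (t : Finset ι) (hf : CMDiff ∞ f) {V : ι → VFieldAlong E f}
    (hV : ∀ i ∈ t, ∀ x, CMDiffAlongAt F f (V i) x) (X : VField F M) :
    covAlong g f X (∑ i ∈ t, V i) = ∑ i ∈ t, covAlong g f X (V i) :=
  funext fun y ↦ (g.covAlong_sum t (hf y) fun i hi ↦ hV i hi y).trans (Finset.sum_apply _ _ _).symm

theorem eventually_covAlong_congr (hf : CMDiff ∞ f) {V W : VFieldAlong E f} 
    (h : ∀ᶠ y in 𝓝 x, V y = W y) (X : VField F M) :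
    ∀ᶠ y in 𝓝 x, covAlong g f X V y = covAlong g f X W y :=
  h.eventually_nhds.mono fun y hy ↦ g.covAlong_congr (hf y).continuousAt hy

theorem covAlong_push_eq (hf : CMDiff ∞ f) (c : CoordinateFrame (E := E) (f x)) {Y : VField F M}
    (hY : CMDiff ∞ (T% Y)) (X : VField F M) :
    ∀ᶠ y in 𝓝 x, covAlong g f X (push E f Y) y = (∑ i, (comps f c Y i •
      covAlong g f X (fun y ↦ c.e i (f y)) +
      (fun y ↦ mvfderiv 𝓘(ℝ, F) (comps f c Y i) y (X y)) •
        (fun y ↦ c.e i (f y) : VFieldAlong E f)) : VFieldAlong E f) y := by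
  filter_upwards [g.eventually_covAlong_congr hf (eventually_push_eq hf c Y) X] with y hy
  rw [hy]
  have he (i) (x) : CMDiffAlongAt F f (fun y ↦ c.e i (f y) : VFieldAlong E f) x :=
    CMDiffAlongAt.comp (c.contMDiff_e i (f x)) (hf x)
  rw [g.covAlong_sum_eq _ hf fun i _ x ↦ (he i x).smul (contMDiff_comps hf c hY i x)]
  simp only [g.covAlong_smul_eq (contMDiff_comps hf c hY _) (he _)]

theorem cmdiffAlongAt_covAlong_push (hf : CMDiff ∞ f) {X Y : VField F M}
    (hX : CMDiff ∞ (T% X)) (hY : CMDiff ∞ (T% Y)) (x : M) :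
    CMDiffAlongAt F f (covAlong g f X (push E f Y)) x := by
  obtain ⟨c⟩ := nonempty_coordinateFrame (E := E) (f x)
  refine CMDiffAlongAt.congr (CMDiffAlongAt.sum _ (hf x) fun i _ ↦ ?_)
    ((g.covAlong_push_eq hf c hY X).mono fun y hy ↦ hy.symm)
  exact ((g.cmdiffAlongAt_covAlong_comp hf (c.contMDiff_e i) hX x).smul
    (contMDiff_comps hf c hY i x)).add ((CMDiffAlongAt.comp (c.contMDiff_e i (f x)) (hf x)).smul
      (contMDiffAt_mvfderiv_apply (contMDiff_comps hf c hY i x) (hX x)))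

/-- The pulled back Levi-Civita connection is torsion-free. -/
theorem covAlong_torsion (hf : CMDiff ∞ f) {X Y : VField F M}
    (hX : CMDiff ∞ (T% X)) (hY : CMDiff ∞ (T% Y)) :
    covAlong g f X (push E f Y) - covAlong g f Y (push E f X) =
      push E f (mlieBracket 𝓘(ℝ, F) X Y) := by
  funext x
  obtain ⟨c⟩ := nonempty_coordinateFrame (E := E) (f x)
  have hc (Z : VField F M) (i) : covAlong g f Z (fun y ↦ c.e i (f y)) x =
      ∑ k, comps f c Z k x • g.cov (c.e k) (c.e i) (f x) := by
    refine (congrFun (g.covAlong_comp_eq hf (c.contMDiff_e i) Z) x).trans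
      ((g.leviCivita_push hf c Z _).self_of_nhds.trans ?_)
    rw [Finset.sum_apply]
    rfl
  have hT (i k) : g.cov (c.e k) (c.e i) (f x) = g.cov (c.e i) (c.e k) (f x) := by
    rw [← sub_eq_zero, ← c.mlieBracket_eq_zero k i]
    exact g.leviCivita_torsion ((c.contMDiff_e k (f x)).mdifferentiableAt (by simp))
      ((c.contMDiff_e i (f x)).mdifferentiableAt (by simp))
  rw [Pi.sub_apply, (g.covAlong_push_eq hf c hY X).self_of_nhds,
    (g.covAlong_push_eq hf c hX Y).self_of_nhds, (eventually_push_eq hf c _).self_of_nhds]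
  simp only [Finset.sum_apply, Pi.add_apply, Pi.smul_apply', hc, comps_mlieBracket hf c hX hY,
    Finset.sum_add_distrib, Finset.smul_sum, smul_smul, sub_smul, Finset.sum_sub_distrib]
  have h : ∑ i, ∑ k, (comps f c X i x * comps f c Y k x) • g.cov (c.e k) (c.e i) (f x) =
      ∑ i, ∑ k, (comps f c Y i x * comps f c X k x) • g.cov (c.e k) (c.e i) (f x) := by
    rw [Finset.sum_comm]
    refine Finset.sum_congr rfl fun i _ ↦ Finset.sum_congr rfl fun k _ ↦ ?_
    rw [hT k i, mul_comm]
  rw [h]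
  abel

/-- The curvature of the pulled back Levi-Civita connection. -/
def curvatureAlong (f : M → N) (X Y : VField F M) (V : VFieldAlong E f) : VFieldAlong E f :=
  covAlong g f X (covAlong g f Y V) - covAlong g f Y (covAlong g f X V) -
    covAlong g f (mlieBracket 𝓘(ℝ, F) X Y) V

/-- In a coordinate frame the derivatives of the components of X and Y cancel against ∇_[X,Y], and
the remaining terms are curvatures of frame fields, whose brackets vanish at the base point. -/
theorem curvatureAlong_comp (hf : CMDiff ∞ f) {X Y : VField F M}
    (hX : CMDiff ∞ (T% X)) (hY : CMDiff ∞ (T% Y)) {X' Y' W : VField E N}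
    (hX' : CMDiff ∞ (T% X')) (hY' : CMDiff ∞ (T% Y')) (hW : CMDiff ∞ (T% W))
    (hXx : X' (f x) = push E f X x) (hYx : Y' (f x) = push E f Y x) :
    g.curvatureAlong f X Y (fun y ↦ W (f y)) x = g.curvature X' Y' W (f x) := by
  obtain ⟨c⟩ := nonempty_coordinateFrame (E := E) (f x)
  have hp (Z : VField F M) : push E f Z x = ∑ i, comps f c Z i x • c.e i (f x) := by
    rw [(eventually_push_eq hf c Z).self_of_nhds, Finset.sum_apply]; rfl
  have hl (Z : VField F M) (W : VField E N) : g.leviCivita W (f x) (push E f Z x) =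
      ∑ i, comps f c Z i x • g.cov (c.e i) W (f x) := by
    rw [(g.leviCivita_push hf c Z W).self_of_nhds, Finset.sum_apply]; rfl
  have he := c.contMDiff_e
  -- By tensoriality X' and Y' may be replaced by combinations of the frame with constant
  -- coefficients.
  rw [g.curvature_congr hX' (contMDiff_sum_const_smul he (fun i ↦ comps f c X i x)) hY'
    (contMDiff_sum_const_smul he (fun i ↦ comps f c Y i x)) hW hW (hXx.trans (hp X))
    (hYx.trans (hp Y)) rfl, g.curvature_sum_left he _ _ (contMDiff_sum_const_smul he _) hW]
  simp only [g.curvature_sum_mid he _ _ (he _) hW]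
  have hD (X : VField F M) {Y : VField F M} (hY : CMDiff ∞ (T% Y)) :
      covAlong g f X (covAlong g f Y fun y ↦ W (f y)) x =
      ∑ i, ((∑ k, (comps f c Y i x * comps f c X k x) • g.cov (c.e k) (g.cov (c.e i) W) (f x)) +
        mvfderiv 𝓘(ℝ, F) (comps f c Y i) x (X x) • g.cov (c.e i) W (f x)) := by
    have hs (i) (x) : CMDiffAlongAt F f (fun y ↦ g.cov (c.e i) W (f y) : VFieldAlong E f) x :=
      CMDiffAlongAt.comp (g.contMDiff_cov (he i) hW (f x)) (hf x)
    rw [g.covAlong_comp_eq hf hW, g.covAlong_congr (hf x).continuousAt (g.leviCivita_push hf c Y W),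
      g.covAlong_sum_eq _ hf fun i _ x ↦ (hs i x).smul (contMDiff_comps hf c hY i x),
      Finset.sum_apply]
    refine Finset.sum_congr rfl fun i _ ↦ ?_
    rw [g.covAlong_smul_eq (contMDiff_comps hf c hY i) (hs i),
      g.covAlong_comp_eq hf (g.contMDiff_cov (he i) hW), Pi.add_apply, Pi.smul_apply', hl,
      Finset.smul_sum]
    simp only [smul_smul]
    rfl
  have hR (i k) : g.curvature (c.e i) (c.e k) W (f x) =
      g.cov (c.e i) (g.cov (c.e k) W) (f x) - g.cov (c.e k) (g.cov (c.e i) W) (f x) := by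
    have : g.cov (mlieBracket 𝓘(ℝ, E) (c.e i) (c.e k)) W (f x) = 0 := by
      rw [cov, c.mlieBracket_eq_zero, map_zero]
    rw [curvature, Pi.sub_apply, this, sub_zero]; rfl
  rw [curvatureAlong, Pi.sub_apply, Pi.sub_apply, hD X hY, hD Y hX, g.covAlong_comp_eq hf hW]
  simp only [hl, hR, comps_mlieBracket hf c hX hY, Finset.sum_add_distrib,
    Finset.smul_sum, smul_smul, sub_smul, Finset.sum_sub_distrib, smul_sub]
  rw [Finset.sum_comm (f := fun i k ↦
    (comps f c Y i x * comps f c X k x) • g.cov (c.e k) (g.cov (c.e i) W) (f x))]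
  simp only [mul_comm (comps f c Y _ x)]
  abel

/-- First derivatives of a cancel in pairs, and second derivatives cancel against the derivative
along [X, Y]. -/
theorem curvatureAlong_smul {a : M → ℝ} (ha : CMDiff ∞ a) {X Y : VField F M}
    (hX : CMDiff ∞ (T% X)) (hY : CMDiff ∞ (T% Y)) {V : VFieldAlong E f}
    (hV : ∀ x, CMDiffAlongAt F f V x) (hXV : ∀ x, CMDiffAlongAt F f (covAlong g f X V) x)
    (hYV : ∀ x, CMDiffAlongAt F f (covAlong g f Y V) x) :
    g.curvatureAlong f X Y (a • V) = a • g.curvatureAlong f X Y V := by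
  have hd {X : VField F M} (hX : CMDiff ∞ (T% X)) :
      CMDiff ∞ (fun y ↦ mvfderiv 𝓘(ℝ, F) a y (X y)) :=
    fun y ↦ contMDiffAt_mvfderiv_apply (ha y) (hX y)
  have hadd (X : VField F M) {V W : VFieldAlong E f} (hV : ∀ x, CMDiffAlongAt F f V x)
      (hW : ∀ x, CMDiffAlongAt F f W x) :
      covAlong g f X (V + W) = covAlong g f X V + covAlong g f X W :=
    funext fun y ↦ g.covAlong_add (hV y).mdiffAlongAt (hW y).mdiffAlongAt
  rw [curvatureAlong, g.covAlong_smul_eq ha hV, g.covAlong_smul_eq ha hV,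
    g.covAlong_smul_eq ha hV, hadd X (fun x ↦ (hYV x).smul (ha x))
      (fun x ↦ (hV x).smul (hd hY x)), hadd Y (fun x ↦ (hXV x).smul (ha x))
      (fun x ↦ (hV x).smul (hd hX x)), g.covAlong_smul_eq ha hYV, g.covAlong_smul_eq ha hXV,
    g.covAlong_smul_eq (hd hY) hV, g.covAlong_smul_eq (hd hX) hV]
  funext y
  have h := mvfderiv_mlieBracket ha hX hY y
  simp only [curvatureAlong, Pi.sub_apply, Pi.add_apply, Pi.smul_apply', h]
  module

theorem curvatureAlong_sum {ι : Type*} (t : Finset ι) (hf : CMDiff ∞ f) {X Y : VField F M}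
    {V : ι → VFieldAlong E f}
    (hV : ∀ i x, CMDiffAlongAt F f (V i) x)
    (hXV : ∀ i x, CMDiffAlongAt F f (covAlong g f X (V i)) x)
    (hYV : ∀ i x, CMDiffAlongAt F f (covAlong g f Y (V i)) x) :
    g.curvatureAlong f X Y (∑ i ∈ t, V i) = ∑ i ∈ t, g.curvatureAlong f X Y (V i) := by
  simp only [curvatureAlong]
  rw [g.covAlong_sum_eq t hf (fun i _ ↦ hV i), g.covAlong_sum_eq t hf (fun i _ ↦ hV i),
    g.covAlong_sum_eq t hf (fun i _ ↦ hV i), g.covAlong_sum_eq t hf (fun i _ ↦ hXV i),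
    g.covAlong_sum_eq t hf (fun i _ ↦ hYV i), Finset.sum_sub_distrib, Finset.sum_sub_distrib]

/-- The curvature of the pulled back connection is the pulled back curvature. -/
theorem curvatureAlong_push (hf : CMDiff ∞ f) {X Y Z : VField F M}
    (hX : CMDiff ∞ (T% X)) (hY : CMDiff ∞ (T% Y)) (hZ : CMDiff ∞ (T% Z)) {X' Y' Z' : VField E N}
    (hX' : CMDiff ∞ (T% X')) (hY' : CMDiff ∞ (T% Y')) (hZ' : CMDiff ∞ (T% Z'))
    (hXx : X' (f x) = push E f X x) (hYx : Y' (f x) = push E f Y x)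
    (hZx : Z' (f x) = push E f Z x) :
    g.curvatureAlong f X Y (push E f Z) x = g.curvature X' Y' Z' (f x) := by
  obtain ⟨c⟩ := nonempty_coordinateFrame (E := E) (f x)
  have he := c.contMDiff_e
  have hp : push E f Z x = ∑ i, comps f c Z i x • c.e i (f x) := by
    rw [(eventually_push_eq hf c Z).self_of_nhds, Finset.sum_apply]; rfl
  have hc {V W : VFieldAlong E f} (h : ∀ᶠ y in 𝓝 x, V y = W y) :
      g.curvatureAlong f X Y V x = g.curvatureAlong f X Y W x := by
    have hfc := (hf x).continuousAt
    simp only [curvatureAlong, Pi.sub_apply]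
    rw [g.covAlong_congr hfc h, g.covAlong_congr hfc (g.eventually_covAlong_congr hf h X),
      g.covAlong_congr hfc (g.eventually_covAlong_congr hf h Y)]
  have hV (i) (y) : CMDiffAlongAt F f (fun y ↦ c.e i (f y) : VFieldAlong E f) y :=
    CMDiffAlongAt.comp (he i (f y)) (hf y)
  have hD {X : VField F M} (hX : CMDiff ∞ (T% X)) (i) (y) :=
    g.cmdiffAlongAt_covAlong_comp hf (he i) hX y
  have hs := contMDiff_comps hf c hZ
  have hD2 {X : VField F M} (hX : CMDiff ∞ (T% X)) (i) (y) : CMDiffAlongAt F f (covAlong g f X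
      (comps f c Z i • (fun y ↦ c.e i (f y) : VFieldAlong E f))) y := by
    rw [g.covAlong_smul_eq (hs i) (hV i)]
    exact ((hD hX i y).smul (hs i y)).add ((hV i y).smul
      (contMDiffAt_mvfderiv_apply (hs i y) (hX y)))
  rw [hc (eventually_push_eq hf c Z), g.curvature_congr hX' hX' hY' hY' hZ'
    (contMDiff_sum_const_smul he (fun i ↦ comps f c Z i x)) rfl rfl (hZx.trans hp),
    g.curvature_sum_right he _ _ hX' hY',
    g.curvatureAlong_sum _ hf (fun i y ↦ (hV i y).smul (hs i y)) (hD2 hX) (hD2 hY),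
    Finset.sum_apply]
  refine Finset.sum_congr rfl fun i _ ↦ ?_
  rw [g.curvatureAlong_smul (hs i) hX hY (hV i) (hD hX i) (hD hY i), Pi.smul_apply',
    g.curvatureAlong_comp hf hX hY hX' hY' (he i) hXx hYx]

end

end SemiRiemannianMetric

end SGeom

/-! ### Tangential and normal parts, and the Codazzi equation -/

namespace SGeom

open Filter Topology

section Submanifold

variable {E F : Type*} [NormedAddCommGroup E] [NormedSpace ℝ E] [FiniteDimensional ℝ E]
  [NormedAddCommGroup F] [NormedSpace ℝ F] [FiniteDimensional ℝ F]
  {N : Type*} [TopologicalSpace N] [ChartedSpace E N] [IsManifold 𝓘(ℝ, E) ∞ N]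
  {M : Type*} [TopologicalSpace M] [ChartedSpace F M]
  {g : SemiRiemannianMetric E N} {f : M → N}

namespace IsSubmanifold

variable (hf : IsSubmanifold (F := F) g f)

theorem induced_tan (x : M) (w : TangentSpace 𝓘(ℝ, E) (f x)) (v : TangentSpace 𝓘(ℝ, F) x) :
    induced g f x (hf.tan x w) v = g.inner (f x) w (mfderiv 𝓘(ℝ, F) 𝓘(ℝ, E) f x v) :=
  LinearMap.BilinForm.apply_toDual_symm_apply (hB := hf.induced_nondegenerate x)
    (g.bilin (f x) w ∘ₗ (mfderiv 𝓘(ℝ, F) 𝓘(ℝ, E) f x).toLinearMap) v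

theorem tan_mfderiv (x : M) (u : TangentSpace 𝓘(ℝ, F) x) :
    hf.tan x (mfderiv 𝓘(ℝ, F) 𝓘(ℝ, E) f x u) = u := by
  rw [← sub_eq_zero]
  refine hf.nondegenerate x _ fun v ↦ ?_
  have h := hf.induced_tan x (mfderiv 𝓘(ℝ, F) 𝓘(ℝ, E) f x u) v
  change g.inner (f x) (mfderiv 𝓘(ℝ, F) 𝓘(ℝ, E) f x (hf.tan x _)) _ = _ at h
  rw [map_sub, map_sub, sub_apply]
  exact sub_eq_zero.2 h

theorem tan_sub (x : M) (v w : TangentSpace 𝓘(ℝ, E) (f x)) :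
    hf.tan x (v - w) = hf.tan x v - hf.tan x w := by
  simp [tan, LinearMap.sub_comp]

theorem mfderiv_tan_add_nor (x : M) (w : TangentSpace 𝓘(ℝ, E) (f x)) :
    mfderiv 𝓘(ℝ, F) 𝓘(ℝ, E) f x (hf.tan x w) + hf.nor x w = w := by
  rw [nor]; abel

theorem inner_nor_of_normal {x : M} {n : TangentSpace 𝓘(ℝ, E) (f x)}
    (hn : ∀ v, g.inner (f x) (mfderiv 𝓘(ℝ, F) 𝓘(ℝ, E) f x v) n = 0)
    (w : TangentSpace 𝓘(ℝ, E) (f x)) : g.inner (f x) (hf.nor x w) n = g.inner (f x) w n := by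
  rw [nor, map_sub, sub_apply, hn, sub_zero]

theorem inner_mfderiv_nor (x : M) (w : TangentSpace 𝓘(ℝ, E) (f x)) (v : TangentSpace 𝓘(ℝ, F) x) :
    g.inner (f x) (mfderiv 𝓘(ℝ, F) 𝓘(ℝ, E) f x v) (hf.nor x w) = 0 :=
  (g.symm _ _ _).trans (hf.inner_nor x w v)

/-- A vector orthogonal to all normal vectors is tangent. -/
theorem nor_eq_zero {x : M} {w : TangentSpace 𝓘(ℝ, E) (f x)}
    (h : ∀ n, (∀ v, g.inner (f x) (mfderiv 𝓘(ℝ, F) 𝓘(ℝ, E) f x v) n = 0) →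
      g.inner (f x) w n = 0) : hf.nor x w = 0 := by
  refine g.nondegenerate _ _ fun y ↦ ?_
  rw [← hf.mfderiv_tan_add_nor x y, map_add, hf.inner_nor, zero_add,
    hf.inner_nor_of_normal (hf.inner_mfderiv_nor x y), h _ (hf.inner_mfderiv_nor x y)]

theorem mem_range_iff {x : M} {w : TangentSpace 𝓘(ℝ, E) (f x)} :
    w ∈ (mfderiv 𝓘(ℝ, F) 𝓘(ℝ, E) f x).range ↔ hf.nor x w = 0 := by
  refine ⟨fun ⟨u, hu⟩ ↦ ?_, fun h ↦ ⟨hf.tan x w, ?_⟩⟩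
  · have hu' : mfderiv 𝓘(ℝ, F) 𝓘(ℝ, E) f x u = w := hu
    rw [nor, ← hu', hf.tan_mfderiv, sub_self]
  · have := hf.mfderiv_tan_add_nor x w
    rw [h, add_zero] at this
    exact this

end IsSubmanifold

theorem covAlong_sub_left (X X' : VField F M) (V : VFieldAlong E f) :
    covAlong g f (X - X') V = covAlong g f X V - covAlong g f X' V := by
  funext x
  simp only [covAlong, Pi.sub_apply, map_sub]
  abel

namespace IsSubmanifold

variable [T2Space N] [T2Space M] [IsManifold 𝓘(ℝ, F) ∞ M] (hf : IsSubmanifold (F := F) g f)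

/-- The tangential part is determined by its products with tangent fields under the nondegenerate
induced metric, and these are smooth. -/
theorem contMDiff_tan {V : VFieldAlong E f} (hV : ∀ x, CMDiffAlongAt F f V x) :
    CMDiff ∞ (T% (fun x ↦ hf.tan x (V x))) := fun x ↦
  contMDiffAt_of_bilin (B := induced g f) (hf.induced_nondegenerate x)
    (fun _ _ hY hZ ↦ (SemiRiemannianMetric.cmdiffAlongAt_push hf.contMDiff hY x).inner
      (SemiRiemannianMetric.cmdiffAlongAt_push hf.contMDiff hZ x)) fun Z hZ ↦ by
    refine ((hV x).inner (g := g) (SemiRiemannianMetric.cmdiffAlongAt_push hf.contMDiff hZ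
      x)).congr_of_eventuallyEq (.of_forall fun y ↦ ?_)
    exact hf.induced_tan y (V y) (Z y)

theorem cmdiffAlongAt_nor {V : VFieldAlong E f} (hV : ∀ x, CMDiffAlongAt F f V x) (x : M) :
    CMDiffAlongAt F f (fun x ↦ hf.nor x (V x)) x :=
  (hV x).sub (SemiRiemannianMetric.cmdiffAlongAt_push hf.contMDiff (hf.contMDiff_tan hV) x)

/-- The Codazzi equation: under the classical Codazzi equation, the curvature of the ambient space
maps tangent vectors to tangent vectors. -/
theorem SatisfiesClassicalCodazzi.inner_curvature {hf : IsSubmanifold (F := F) g f}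
    (hC : hf.SatisfiesClassicalCodazzi) {X Y Z : VField F M}
    (hX : CMDiff ∞ (T% X)) (hY : CMDiff ∞ (T% Y)) (hZ : CMDiff ∞ (T% Z)) {X' Y' Z' : VField E N}
    (hX' : CMDiff ∞ (T% X')) (hY' : CMDiff ∞ (T% Y')) (hZ' : CMDiff ∞ (T% Z')) {x : M}
    (hXx : X' (f x) = push E f X x) (hYx : Y' (f x) = push E f Y x)
    (hZx : Z' (f x) = push E f Z x) {n : TangentSpace 𝓘(ℝ, E) (f x)}
    (hn : ∀ v, g.inner (f x) (mfderiv 𝓘(ℝ, F) 𝓘(ℝ, E) f x v) n = 0) :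
    g.inner (f x) (g.curvature X' Y' Z' (f x)) n = 0 := by
  rw [← g.curvatureAlong_push hf.contMDiff hX hY hZ hX' hY' hZ' hXx hYx hZx,
    SemiRiemannianMetric.curvatureAlong, Pi.sub_apply, Pi.sub_apply]
  have hcov {X Y : VField F M} (hX : CMDiff ∞ (T% X)) (hY : CMDiff ∞ (T% Y)) :=
    g.cmdiffAlongAt_covAlong_push hf.contMDiff hX hY
  -- The normal component of the derivative of the Gauss decomposition ∇̃_X Y = ∇_X Y + h(X, Y).
  have split {X Y : VField F M} (hX : CMDiff ∞ (T% X)) (hY : CMDiff ∞ (T% Y)) (U : VField F M) :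
      g.inner (f x) (covAlong g f U (covAlong g f X (push E f Y)) x) n =
        g.inner (f x) (hf.secondFF U (hf.nabla X Y) x) n +
        g.inner (f x) (hf.normalCov U (hf.secondFF X Y) x) n := by
    have h1 : covAlong g f X (push E f Y) = push E f (hf.nabla X Y) + hf.secondFF X Y :=
      funext fun y ↦ (hf.mfderiv_tan_add_nor y _).symm
    rw [h1, g.covAlong_add (V := push E f (hf.nabla X Y)) (W := hf.secondFF X Y)
      (SemiRiemannianMetric.cmdiffAlongAt_push hf.contMDiff
      (hf.contMDiff_tan (hcov hX hY)) x).mdiffAlongAt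
      (hf.cmdiffAlongAt_nor (hcov hX hY) x).mdiffAlongAt, secondFF, normalCov,
      hf.inner_nor_of_normal hn, hf.inner_nor_of_normal hn, map_add, add_apply]
  -- The induced connection is torsion-free, so h([X, Y], Z) supplies the terms h(∇_X Y, Z) and
  -- h(∇_Y X, Z) of the covariant derivatives of h.
  have hT : mlieBracket 𝓘(ℝ, F) X Y = hf.nabla X Y - hf.nabla Y X := by
    funext y
    have h := congrFun (g.covAlong_torsion hf.contMDiff hX hY) y
    rw [Pi.sub_apply] at h
    rw [Pi.sub_apply, nabla, nabla, ← hf.tan_sub, h, push, hf.tan_mfderiv]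
  have hL (U : VField F M) : g.inner (f x) (covAlong g f U (push E f Z) x) n =
      g.inner (f x) (hf.secondFF U Z x) n := (hf.inner_nor_of_normal hn _).symm
  have key := congrArg (fun v ↦ g.inner (f x) v n) (congrFun (hC X Y Z hX hY hZ) x)
  simp only [covSecondFF, Pi.sub_apply, map_sub, sub_apply] at key
  rw [map_sub, map_sub, sub_apply, sub_apply, split hY hZ, split hX hZ, hT, covAlong_sub_left,
    Pi.sub_apply, map_sub, sub_apply, hL, hL]
  linarith

end IsSubmanifold

end Submanifold

/-! ### Pointwise identities for φ, ξ, η -/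

section Structure

variable {E : Type*} [NormedAddCommGroup E] [NormedSpace ℝ E]
  {N : Type*} [TopologicalSpace N] [ChartedSpace E N] [IsManifold 𝓘(ℝ, E) ∞ N] {s : ℕ}

theorem FramedFStructure.η_φ (S : FramedFStructure E N s) (p : N) (α : Fin s)
    (v : TangentSpace 𝓘(ℝ, E) p) : S.η α p (S.φ p v) = 0 := by
  have h1 := S.φ_sq p (S.φ p v)
  rw [S.φ_sq p v] at h1
  simp only [map_add, map_neg, map_sum, map_smul, S.φ_ξ, smul_zero, Finset.sum_const_zero,
    add_zero] at h1
  have h2 := congrArg (S.η α p) (left_eq_add.1 h1)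
  simpa [S.η_ξ] using h2

namespace IndefiniteFramedFStructure

variable (S : IndefiniteFramedFStructure E N s) (p : N)

theorem inner_ξ_eq (v : TangentSpace 𝓘(ℝ, E) p) (α : Fin s) :
    S.g.inner p v (S.ξ α p) = S.ε α * S.η α p v := by
  have h := S.compatible p v (S.ξ α p)
  simp only [S.φ_ξ, map_zero, S.η_ξ, mul_ite, mul_one, mul_zero, Finset.sum_ite_eq',
    Finset.mem_univ, if_true] at h
  exact (sub_eq_zero.1 h.symm)

theorem inner_φ_skew (v w : TangentSpace 𝓘(ℝ, E) p) :
    S.g.inner p (S.φ p v) w = -S.g.inner p v (S.φ p w) := by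
  have h := S.compatible p v (S.φ p w)
  rw [S.φ_sq p w] at h
  simp only [map_add, map_neg, map_sum, map_smul, inner_ξ_eq, S.η_φ, smul_eq_mul, mul_zero,
    Finset.sum_const_zero, add_zero, sub_zero] at h
  linarith

end IndefiniteFramedFStructure

end Structure

/-! ### The dichotomy at a point and its globalization -/

section Conclusion

variable {E F : Type*} [NormedAddCommGroup E] [NormedSpace ℝ E] [FiniteDimensional ℝ E]
  [NormedAddCommGroup F] [NormedSpace ℝ F] [FiniteDimensional ℝ F]
  {N : Type*} [TopologicalSpace N] [T2Space N] [ChartedSpace E N] [IsManifold 𝓘(ℝ, E) ∞ N]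
  {M : Type*} [TopologicalSpace M] [T2Space M] [ChartedSpace F M] [IsManifold 𝓘(ℝ, F) ∞ M]
  {s : ℕ} {S : IndefiniteFramedFStructure E N s} {f : M → N}

/-- The two evaluations of g(R(u, v)u, n) are compared: zero by Codazzi, and 3/4 (c - ε) g(u, φv)
g(φu, n) in the space form. Here u and v are first replaced by their horizontal parts, which stay
tangent and have the same image under φ. -/
theorem inner_φ_mul_inner_φ_eq_zero {c : ℝ} (hs : 1 ≤ s) (hS : S.IsSSpaceForm c)
    (hc : c ≠ ∑ α, S.ε α) (hf : IsSubmanifold (F := F) S.g f) (hξ : TangentToFrame F S f)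
    (hC : hf.SatisfiesClassicalCodazzi) (x : M) (u v : TangentSpace 𝓘(ℝ, F) x)
    {n : TangentSpace 𝓘(ℝ, E) (f x)}
    (hn : ∀ v, S.g.inner (f x) (mfderiv 𝓘(ℝ, F) 𝓘(ℝ, E) f x v) n = 0) :
    S.g.inner (f x) (S.φ (f x) (mfderiv 𝓘(ℝ, F) 𝓘(ℝ, E) f x u))
      (mfderiv 𝓘(ℝ, F) 𝓘(ℝ, E) f x v) *
      S.g.inner (f x) (S.φ (f x) (mfderiv 𝓘(ℝ, F) 𝓘(ℝ, E) f x u)) n = 0 := by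
  obtain ⟨ζ, hζ⟩ : ∃ ζ : Fin s → TangentSpace 𝓘(ℝ, F) x,
      ∀ α, mfderiv 𝓘(ℝ, F) 𝓘(ℝ, E) f x (ζ α) = S.ξ α (f x) :=
    ⟨fun α ↦ (hξ α x).choose, fun α ↦ (hξ α x).choose_spec⟩
  have hor (u : TangentSpace 𝓘(ℝ, F) x) : ∃ u' : TangentSpace 𝓘(ℝ, F) x,
      mfderiv 𝓘(ℝ, F) 𝓘(ℝ, E) f x u' = mfderiv 𝓘(ℝ, F) 𝓘(ℝ, E) f x u -
        ∑ α, S.η α (f x) (mfderiv 𝓘(ℝ, F) 𝓘(ℝ, E) f x u) • S.ξ α (f x) :=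
    ⟨u - ∑ α, S.η α (f x) (mfderiv 𝓘(ℝ, F) 𝓘(ℝ, E) f x u) • ζ α, by simp [hζ]⟩
  have hη (a : TangentSpace 𝓘(ℝ, E) (f x)) (β) :
      S.η β (f x) (a - ∑ α, S.η α (f x) a • S.ξ α (f x)) = 0 := by simp [S.η_ξ]
  have hφ (a : TangentSpace 𝓘(ℝ, E) (f x)) :
      S.φ (f x) (a - ∑ α, S.η α (f x) a • S.ξ α (f x)) = S.φ (f x) a := by simp [S.φ_ξ]
  have hnη (α) : S.η α (f x) n = 0 := by
    have h := S.inner_ξ_eq (f x) n α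
    rw [S.g.symm, ← hζ α, hn] at h
    rcases S.ε_eq α with h' | h' <;> simpa [h'] using h.symm
  obtain ⟨u', hu'⟩ := hor u
  obtain ⟨v', hv'⟩ := hor v
  obtain ⟨X, hX, hXu⟩ := exists_vfield u'
  obtain ⟨Y, hY, hYv⟩ := exists_vfield v'
  obtain ⟨X', hX', hXx⟩ := exists_vfield (push E f X x)
  obtain ⟨Y', hY', hYx⟩ := exists_vfield (push E f Y x)
  have h1 := hC.inner_curvature hX hY hX hX' hY' hX' hXx hYx hXx hn
  rw [push, hXu, hu'] at hXx
  rw [push, hYv, hv'] at hYx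
  rw [hS.inner_curvature hs hX' hY' hX' rfl (by rw [hXx]; exact hη _) (by rw [hYx]; exact hη _)
    hnη (by rw [hXx, ← hu']; exact hn _) (by rw [hYx, ← hv']; exact hn _), hXx, hYx, hφ, hφ,
    mul_eq_zero] at h1
  have h2 := h1.resolve_left (by
    have := sub_ne_zero.2 hc
    positivity)
  -- As φv is orthogonal to every ξ_α, the removed components of u do not contribute to g(u, φv).
  have h3 (α) : S.g.inner (f x) (S.ξ α (f x))
      (S.φ (f x) (mfderiv 𝓘(ℝ, F) 𝓘(ℝ, E) f x v)) = 0 := by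
    rw [S.g.symm, S.inner_ξ_eq, S.η_φ, mul_zero]
  simp only [map_sub, sub_apply, map_sum, sum_apply, map_smul, smul_apply, h3, smul_zero,
    Finset.sum_const_zero, sub_zero] at h2
  rw [S.inner_φ_skew, neg_mul, h2, neg_zero]

/-- The vectors u with φu tangent and those with φu normal form two subspaces covering T_xM, so one
of them is the whole space. -/
theorem mem_range_or_inner_φ_eq_zero {c : ℝ} (hs : 1 ≤ s) (hS : S.IsSSpaceForm c)
    (hc : c ≠ ∑ α, S.ε α) (hf : IsSubmanifold (F := F) S.g f) (hξ : TangentToFrame F S f)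
    (hC : hf.SatisfiesClassicalCodazzi) (x : M) :
    (∀ u, S.φ (f x) (mfderiv 𝓘(ℝ, F) 𝓘(ℝ, E) f x u) ∈ (mfderiv 𝓘(ℝ, F) 𝓘(ℝ, E) f x).range) ∨
    ∀ u v, S.g.inner (f x) (S.φ (f x) (mfderiv 𝓘(ℝ, F) 𝓘(ℝ, E) f x u))
      (mfderiv 𝓘(ℝ, F) 𝓘(ℝ, E) f x v) = 0 := by
  have h (u : TangentSpace 𝓘(ℝ, F) x) :
      S.φ (f x) (mfderiv 𝓘(ℝ, F) 𝓘(ℝ, E) f x u) ∈ (mfderiv 𝓘(ℝ, F) 𝓘(ℝ, E) f x).range ∨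
      ∀ v, S.g.inner (f x) (S.φ (f x) (mfderiv 𝓘(ℝ, F) 𝓘(ℝ, E) f x u))
        (mfderiv 𝓘(ℝ, F) 𝓘(ℝ, E) f x v) = 0 := by
    by_contra! hcon
    obtain ⟨h1, v, hv⟩ := hcon
    refine h1 (hf.mem_range_iff.2 (hf.nor_eq_zero fun n hn ↦ ?_))
    exact (mul_eq_zero.1 (inner_φ_mul_inner_φ_eq_zero hs hS hc hf hξ hC x u v hn)).resolve_left hv
  by_contra! hcon
  obtain ⟨⟨a, ha⟩, b, v, hb⟩ := hcon
  have ha' := (h a).resolve_left ha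
  have hb' := (h b).resolve_right fun hb' ↦ hb (hb' v)
  rcases h (a + b) with h' | h'
  · rw [map_add, map_add] at h'
    exact ha ((Submodule.add_mem_iff_left _ hb').1 h')
  · have := h' v
    rw [map_add, map_add, map_add, add_apply, ha', zero_add] at this
    exact hb this

theorem cmdiffAlongAt_φ (S : IndefiniteFramedFStructure E N s) (hf : CMDiff ∞ f)
    {V : VFieldAlong E f} {x : M} (hV : CMDiffAlongAt F f V x) :
    CMDiffAlongAt F f (fun y ↦ S.φ (f y) (V y)) x :=
  ContMDiffAt.clm_bundle_apply (F₁ := E) (F₂ := E)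
    (E₁ := (TangentSpace 𝓘(ℝ, E) : N → Type _)) (E₂ := (TangentSpace 𝓘(ℝ, E) : N → Type _))
    (b := f) (ϕ := fun y ↦ S.φ (f y)) ((S.contMDiff_φ (f x)).comp x (hf x)) hV

theorem isClosed_setOf_inner_φ_eq_zero (S : IndefiniteFramedFStructure E N s) (hf : CMDiff ∞ f) :
    IsClosed {x : M | ∀ u v : TangentSpace 𝓘(ℝ, F) x,
      S.g.inner (f x) (S.φ (f x) (mfderiv 𝓘(ℝ, F) 𝓘(ℝ, E) f x u))
        (mfderiv 𝓘(ℝ, F) 𝓘(ℝ, E) f x v) = 0} := by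
  rw [← isOpen_compl_iff, isOpen_iff_eventually]
  intro x hx
  simp only [Set.mem_compl_iff, Set.mem_ofPred_eq, not_forall] at hx ⊢
  obtain ⟨u, v, h⟩ := hx
  obtain ⟨U, hU, rfl⟩ := exists_vfield u
  obtain ⟨V, hV, rfl⟩ := exists_vfield v
  have hc := ((cmdiffAlongAt_φ S hf (SemiRiemannianMetric.cmdiffAlongAt_push hf hU x)).inner
    (g := S.g) (SemiRiemannianMetric.cmdiffAlongAt_push hf hV x)).continuousAt
  exact (hc.eventually_ne h).mono fun y hy ↦ ⟨U y, V y, hy⟩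

/-- If φu has a nonzero normal part, some w pairs nontrivially with it, and by continuity this
persists nearby for smooth extensions of u and w. -/
theorem isClosed_setOf_φ_mem_range (hf : IsSubmanifold (F := F) S.g f) :
    IsClosed {x : M | ∀ u : TangentSpace 𝓘(ℝ, F) x,
      S.φ (f x) (mfderiv 𝓘(ℝ, F) 𝓘(ℝ, E) f x u) ∈
        (mfderiv 𝓘(ℝ, F) 𝓘(ℝ, E) f x).range} := by
  rw [← isOpen_compl_iff, isOpen_iff_eventually]
  intro x hx
  simp only [Set.mem_compl_iff, Set.mem_ofPred_eq, not_forall, hf.mem_range_iff] at hx ⊢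
  obtain ⟨u, h⟩ := hx
  obtain ⟨U, hU, rfl⟩ := exists_vfield u
  obtain ⟨w, hw⟩ : ∃ w, S.g.inner (f x) (hf.nor x (S.φ (f x) (mfderiv 𝓘(ℝ, F) 𝓘(ℝ, E) f x (U x))))
      w ≠ 0 := by
    by_contra! h'
    exact h (S.g.nondegenerate _ _ h')
  obtain ⟨W, hW, rfl⟩ := exists_vfield w
  have hc := ((hf.cmdiffAlongAt_nor (fun x ↦ cmdiffAlongAt_φ S hf.contMDiff
    (SemiRiemannianMetric.cmdiffAlongAt_push hf.contMDiff hU x)) x).inner (g := S.g)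
    (CMDiffAlongAt.comp (hW (f x)) (hf.contMDiff x))).continuousAt
  refine (hc.eventually_ne hw).mono fun y hy ↦ ⟨U y, fun h0 ↦ hy ?_⟩
  change S.g.inner (f y) (hf.nor y (S.φ (f y) (mfderiv 𝓘(ℝ, F) 𝓘(ℝ, E) f y (U y)))) _ = 0
  rw [h0, map_zero, zero_apply]

/-- If `φ` vanishes on one tangent space of `M`, then `dim M = s` and `φ` vanishes on all of
them. -/
theorem φ_mfderiv_eq_zero (hf : IsSubmanifold (F := F) S.g f) (hξ : TangentToFrame F S f) {x : M}
    (hx : ∀ u, S.φ (f x) (mfderiv 𝓘(ℝ, F) 𝓘(ℝ, E) f x u) = 0) (y : M)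
    (u : TangentSpace 𝓘(ℝ, F) y) : S.φ (f y) (mfderiv 𝓘(ℝ, F) 𝓘(ℝ, E) f y u) = 0 := by
  -- The η^α define a map from T_yM to ℝ^s which is onto at each y because the ξ_α are tangent. At x
  -- it is also injective, since φ²v = 0 and η^α(v) = 0 give v = 0. Hence dim M = s, and the map is
  -- bijective at every y.
  let L (y : M) : F →ₗ[ℝ] (Fin s → ℝ) :=
    LinearMap.pi fun α ↦ ((S.η α (f y)).comp (mfderiv 𝓘(ℝ, F) 𝓘(ℝ, E) f y)).toLinearMap
  have hL (y : M) (u : TangentSpace 𝓘(ℝ, F) y) (α) :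
    L y u α = S.η α (f y) (mfderiv 𝓘(ℝ, F) 𝓘(ℝ, E) f y u) := rfl
  choose ζ hζ using hξ
  have hζ' (α y) : mfderiv 𝓘(ℝ, F) 𝓘(ℝ, E) f y (ζ α y) = S.ξ α (f y) := hζ α y
  have hsurj (y : M) : Function.Surjective (L y) := by
    intro a
    refine ⟨(∑ α, a α • ζ α y : TangentSpace 𝓘(ℝ, F) y), ?_⟩
    funext β
    rw [hL]
    simp [hζ', S.η_ξ]
  have hinj : Function.Injective (L x) := by
    rw [← LinearMap.ker_eq_bot, LinearMap.ker_eq_bot']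
    intro v hv
    have h := S.φ_sq (f x) (mfderiv 𝓘(ℝ, F) 𝓘(ℝ, E) f x v)
    have hη (α) : S.η α (f x) (mfderiv 𝓘(ℝ, F) 𝓘(ℝ, E) f x v) = 0 := congrFun hv α
    have h0 : S.φ (f x) (mfderiv 𝓘(ℝ, F) 𝓘(ℝ, E) f x v) = 0 := hx v
    rw [h0] at h
    simp only [hη, zero_smul, Finset.sum_const_zero, add_zero, map_zero] at h
    have h1 : mfderiv 𝓘(ℝ, F) 𝓘(ℝ, E) f x v = 0 := neg_eq_zero.1 h.symm
    exact hf.injective x (h1.trans (map_zero _).symm)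
  have hdim : Module.finrank ℝ F = Module.finrank ℝ (Fin s → ℝ) :=
    (LinearEquiv.ofBijective (L x) ⟨hinj, hsurj x⟩).finrank_eq
  have hy : Function.Injective (L y) :=
    (LinearMap.injective_iff_surjective_of_finrank_eq_finrank hdim).2 (hsurj y)
  have hu : u = ∑ α, S.η α (f y) (mfderiv 𝓘(ℝ, F) 𝓘(ℝ, E) f y u) • ζ α y := by
    refine hy (funext fun β ↦ ?_)
    rw [hL, hL]
    simp [hζ', S.η_ξ]
  rw [hu]
  simp [hζ', S.φ_ξ]

end Conclusion

end SGeom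

end

/-- A submanifold `f : M → N` of an indefinite `S`-space form `N` of constant `φ`-sectional
curvature `c ≠ ε = ∑ ε_α`, tangent to the structure vector fields `ξ_α`, whose second fundamental
form satisfies the classical Codazzi equation, is `φ`-invariant or `φ`-anti-invariant. -/
theorem lemma2p1
    {E : Type*} [NormedAddCommGroup E] [NormedSpace ℝ E] [FiniteDimensional ℝ E]
    {F : Type*} [NormedAddCommGroup F] [NormedSpace ℝ F] [FiniteDimensional ℝ F]
    {N : Type*} [TopologicalSpace N] [T2Space N] [ChartedSpace E N] [IsManifold 𝓘(ℝ, E) ∞ N]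
    {M : Type*} [TopologicalSpace M] [T2Space M] [ConnectedSpace M] [ChartedSpace F M]
    [IsManifold 𝓘(ℝ, F) ∞ M]
    {s : ℕ} (hs : 1 ≤ s) (S : SGeom.IndefiniteFramedFStructure E N s)
    (c : ℝ) (hS : S.IsSSpaceForm c) (hc : c ≠ ∑ α, S.ε α)
    (f : M → N) (hf : SGeom.IsSubmanifold (F := F) S.g f)
    (hξ : SGeom.TangentToFrame F S f) (hCodazzi : hf.SatisfiesClassicalCodazzi) :
    SGeom.IsPhiInvariant F S f ∨ SGeom.IsPhiAntiInvariant F S f := by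
  have hor := SGeom.mem_range_or_inner_φ_eq_zero hs hS hc hf hξ hCodazzi
  have hI := SGeom.isClosed_setOf_φ_mem_range hf
  have hA := SGeom.isClosed_setOf_inner_φ_eq_zero (F := F) S hf.contMDiff
  -- If both alternatives hold at one point, φ vanishes on TM; otherwise the two closed sets are
  -- complementary and M is connected.
  by_cases hx : ∃ x : M, (∀ u : TangentSpace 𝓘(ℝ, F) x,
      S.φ (f x) (mfderiv 𝓘(ℝ, F) 𝓘(ℝ, E) f x u) ∈ (mfderiv 𝓘(ℝ, F) 𝓘(ℝ, E) f x).range) ∧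
      ∀ u v : TangentSpace 𝓘(ℝ, F) x, S.g.inner (f x)
        (S.φ (f x) (mfderiv 𝓘(ℝ, F) 𝓘(ℝ, E) f x u)) (mfderiv 𝓘(ℝ, F) 𝓘(ℝ, E) f x v) = 0
  · obtain ⟨x, hx1, hx2⟩ := hx
    refine Or.inl fun y u ↦ ?_
    rw [SGeom.φ_mfderiv_eq_zero hf hξ (x := x) (fun u ↦ ?_) y u]
    · exact zero_mem _
    · obtain ⟨v, hv⟩ := hx1 u
      have hv' : mfderiv 𝓘(ℝ, F) 𝓘(ℝ, E) f x v =
          S.φ (f x) (mfderiv 𝓘(ℝ, F) 𝓘(ℝ, E) f x u) := hv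
      -- The vector φu is both tangent and orthogonal to T_xM, hence zero by nondegeneracy of the
      -- induced metric.
      rw [← hv', hf.nondegenerate x v fun w ↦ by rw [hv']; exact hx2 u w, map_zero]
  · have hcompl : {x : M | ∀ u v : TangentSpace 𝓘(ℝ, F) x,
        S.g.inner (f x) (S.φ (f x) (mfderiv 𝓘(ℝ, F) 𝓘(ℝ, E) f x u))
          (mfderiv 𝓘(ℝ, F) 𝓘(ℝ, E) f x v) = 0}ᶜ = {x : M | ∀ u : TangentSpace 𝓘(ℝ, F) x,
        S.φ (f x) (mfderiv 𝓘(ℝ, F) 𝓘(ℝ, E) f x u) ∈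
          (mfderiv 𝓘(ℝ, F) 𝓘(ℝ, E) f x).range} := by
      ext x
      exact ⟨fun h ↦ (hor x).resolve_right h, fun h h' ↦ hx ⟨x, h, h'⟩⟩
    rcases isClopen_iff.1 ⟨hI, hcompl ▸ hA.isOpen_compl⟩ with h | h
    · refine Or.inr fun x ↦ (hor x).resolve_left fun h' ↦ ?_
      exact h.subset (show x ∈ {x : M | _} from h')
    · exact Or.inl fun x ↦ h.superset (Set.mem_univ x)
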